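/- Let $d\ge 2$. A *singular datum* at a point of a $d$-dimensional hypersurface is a tuple $(g,K,\mu,v)$ consisting of a positive definite metric $g_{ab}$, a $(1,1)$-tensor $K^a{}_b$ with $\operatorname{Tr}K=1$ that is symmetric with respect to $g$, a scalar $\mu\ge 0$ and a covector $v_a$, subject to the reduced Hamiltonian constraint $1-\operatorname{Tr}(K^2)=2\mu$. Such data describe the asymptotics of a self-gravitating, asymptotically stiff fluid near a quiescent spacelike singularity. A *singular data set* is a smooth field of singular data on the hypersurface that satisfies in addition the reduced momentum constraint $\nabla_aK^a{}_b=2\mu v_b$, where $\nabla$ is the Levi-Civita connection of $g$. Write $\mathring K=K-\tfrac1d\delta$ for the traceless part, and $$\tau_m=\operatorname{Tr}(\mathring K^m)\quad(2\le m\le d),\qquad \upsilon_m=g(\mathring K^{m-1}v,v)\quad(1\le m\le d),$$ where indices are raised and lowered with $g$. Let $\mathcal S:(g^-,K^-,\mu^-,v^-)\mapsto(g^+,K^+,\mu^+,v^+)$ be an ultra-local map (the outgoing data at a point depend only on the incoming singular datum at that point, not on derivatives along the hypersurface) that is covariant (it commutes with all changes of coordinates, i.e. pointwise with the action of $GL(d,\mathbb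 R)$ on tensors) and differentiable, including at $\mathring K^-=0$. Then $\mathcal S$ preserves the constraints, i.e. maps every singular data set on every open coordinate patch to fields that are again pointwise singular data and satisfy the reduced momentum constraint, if and only if it belongs to one of the following two classes. (A) *Isotropic maps*: $\mathring K^+=0$, $v^+=0$, $\mu^+=\frac{d-1}{2d}$, and $g^+$ is a positive definite covariant combination of the incoming data, namely a linear combination of the tensors $g^-_{ac}((K^-)^m)^c{}_b$ and $(v^-(K^-)^l)_a\,(v^-(K^-)^m)_b$, $0\le l,m<d$, with coefficients that are functions of the invariants $\tau_2^-,\dots,\tau_d^-,\upsilon_1^-,\dots,\upsilon_d^-$. (B) *Anisotropic maps*: there are a constant $\gamma\in\mathbb R\setminus\{0\}$ and a positive function $\omega=\omega(\tau_2^-,\dots,\tau_d^-,\upsilon_1^-,\dots,\upsilon_d^-)$ such that $$\mathring K^+=\gamma\omega^{-1}\mathring K^-,\qquad g^+=\omega^{2/d}g^-,\qquad \mu^+v^+=\gamma\omega^{-1}\mu^-v^-,$$ $$\frac{d-1}{2d}-\mu^+=\gamma^2\omega^{-2}\Bigl(\frac{d-1}{2d}-\mu^-\Bigr),$$ where $\gamma$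 and $\omega$ are such that the resulting density satisfies $\mu^+\ge 0$. -/

import Mathlib

open scoped Matrix

attribute [local instance] Matrix.normedAddCommGroup Matrix.normedSpace

/-- The components at one point, in some coordinate system, of a tuple `(g, K, μ, v)`:
a metric `g_{ab}` (matrix entry `g a b`), a `(1,1)`-tensor `K^a_b` (matrix entry `K a b`),
a scalar `μ` and a covector `v_a`. -/
abbrev PointData (d : ℕ) : Type :=
  Matrix (Fin d) (Fin d) ℝ × Matrix (Fin d) (Fin d) ℝ × ℝ × (Fin d → ℝ)

namespace PointData

variable {d : ℕ}

/-- The metric `g_{ab}`. -/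
def g (D : PointData d) : Matrix (Fin d) (Fin d) ℝ := D.1

/-- The extrinsic curvature `K^a_b`. -/
def K (D : PointData d) : Matrix (Fin d) (Fin d) ℝ := D.2.1

/-- The (rescaled) fluid density `μ`. -/
def μ (D : PointData d) : ℝ := D.2.2.1

/-- The (rescaled) spatial fluid velocity `v_a`. -/
def v (D : PointData d) : Fin d → ℝ := D.2.2.2

/-- The traceless part `K - δ / d` of a unit-trace `K`. -/
noncomputable def Kring (D : PointData d) : Matrix (Fin d) (Fin d) ℝ :=
  D.K - (1 / (d : ℝ)) • (1 : Matrix (Fin d) (Fin d) ℝ)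

/-- The algebraic conditions on `(g, K, μ, v)`: the metric is Riemannian, `K` has unit trace and
is symmetric with respect to `g`, and the density is non-negative. -/
structure IsAdmissible (D : PointData d) : Prop where
  posDef : D.g.PosDef
  trace_eq : D.K.trace = 1
  symm : (D.g * D.K).IsSymm
  nonneg : 0 ≤ D.μ

/-- The reduced Hamiltonian constraint `1 - K^a_b K^b_a = 2 μ`. -/
def Hamiltonian (D : PointData d) : Prop :=
  1 - (D.K * D.K).trace = 2 * D.μ

/-- The tensorial change of components under a linear change of frame in which the components
of vectors transform as `X ↦ A X`. -/
noncomputable def transform (A : GL (Fin d) ℝ) (D : PointData d) : PointData d :=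
  (((A⁻¹ : GL (Fin d) ℝ) : Matrix (Fin d) (Fin d) ℝ)ᵀ * D.g *
      ((A⁻¹ : GL (Fin d) ℝ) : Matrix (Fin d) (Fin d) ℝ),
    (A : Matrix (Fin d) (Fin d) ℝ) * D.K * ((A⁻¹ : GL (Fin d) ℝ) : Matrix (Fin d) (Fin d) ℝ),
    D.μ,
    ((A⁻¹ : GL (Fin d) ℝ) : Matrix (Fin d) (Fin d) ℝ)ᵀ *ᵥ D.v)

/-- The scalar invariants `τ_m = Tr(K̊^m)` for `m = 2, …, d` (entry `i` is `m = i + 2`). -/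
noncomputable def tau (D : PointData d) : Fin (d - 1) → ℝ :=
  fun i => (D.Kring ^ ((i : ℕ) + 2)).trace

/-- The scalar invariants `υ_m = g(K̊^(m-1) v, v)` for `m = 1, …, d` (entry `i` is `m = i + 1`),
where the index of `v` is raised with the inverse metric. -/
noncomputable def upsilon (D : PointData d) : Fin d → ℝ :=
  fun i => D.v ⬝ᵥ (D.Kring ^ (i : ℕ) *ᵥ (D.g⁻¹ *ᵥ D.v))

end PointData

/-- The set of pointwise singular data `(g, K, μ, v)`: admissible and subject to the (algebraic)
reduced Hamiltonian constraint. -/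
def singularPointData (d : ℕ) : Set (PointData d) :=
  {D | D.IsAdmissible ∧ D.Hamiltonian}

/-- The partial derivative `∂_a f`. -/
noncomputable def pderiv {d : ℕ} (a : Fin d) (f : (Fin d → ℝ) → ℝ) (x : Fin d → ℝ) : ℝ :=
  fderiv ℝ f x (Pi.single a 1)

/-- The Christoffel symbol `Γ^c_{ab}` of the metric field `x ↦ g x`. -/
noncomputable def christoffel {d : ℕ} (g : (Fin d → ℝ) → Matrix (Fin d) (Fin d) ℝ)
    (c a b : Fin d) (x : Fin d → ℝ) : ℝ :=
  (1 / 2) * ∑ e, (g x)⁻¹ c e *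
    (pderiv a (fun y => g y b e) x + pderiv b (fun y => g y a e) x - pderiv e (fun y => g y a b) x)

/-- The Levi-Civita divergence
`∇_a K^a_b = ∂_a K^a_b + Γ^a_{ac} K^c_b - Γ^c_{ab} K^a_c`. -/
noncomputable def divergence {d : ℕ} (g K : (Fin d → ℝ) → Matrix (Fin d) (Fin d) ℝ)
    (b : Fin d) (x : Fin d → ℝ) : ℝ :=
  (∑ a, pderiv a (fun y => K y a b) x)
    + (∑ a, ∑ c, christoffel g a a c x * K x c b)
    - (∑ a, ∑ c, christoffel g c a b x * K x a c)

/-- A field of data on the coordinate patch `U` satisfies all the requirements on singular data: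
the algebraic conditions, the reduced Hamiltonian constraint, and the reduced momentum constraint
`∇_a K^a_b = 2 μ v_b`. -/
structure SatisfiesConstraints {d : ℕ} (U : Set (Fin d → ℝ)) (Φ : (Fin d → ℝ) → PointData d) :
    Prop where
  admissible : ∀ x ∈ U, (Φ x).IsAdmissible
  hamiltonian : ∀ x ∈ U, (Φ x).Hamiltonian
  momentum : ∀ x ∈ U, ∀ b,
    divergence (fun y => (Φ y).g) (fun y => (Φ y).K) b x = 2 * (Φ x).μ * (Φ x).v b

/-- An ultra-local map `S` (outgoing data at a point are a function of incoming data at that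
point) is covariant if it commutes with all changes of frame. -/
def IsCovariant {d : ℕ} (S : PointData d → PointData d) : Prop :=
  ∀ A : GL (Fin d) ℝ, ∀ D ∈ singularPointData d, S (D.transform A) = (S D).transform A

/-- An ultra-local map `S` preserves the constraints if, on every open coordinate patch, every
smooth singular data set is mapped pointwise to a singular data set. -/
def PreservesConstraints {d : ℕ} (S : PointData d → PointData d) : Prop :=
  ∀ U : Set (Fin d → ℝ), IsOpen U → ∀ Φ : (Fin d → ℝ) → PointData d, ContDiffOn ℝ (⊤ : ℕ∞) Φ U →
    SatisfiesConstraints U Φ → SatisfiesConstraints U (fun x => S (Φ x))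

/-- `g⁺` is a covariant combination of the incoming data: a combination of the tensors
`g_{ac} (K^m)^c_b` and `(K^l v)_a (K^m v)_b`, with `0 ≤ l, m < d`, whose coefficients are functions
of the scalar invariants. (The scalar `μ` is itself a function of `τ_2`.) -/
def IsCovariantCombination {d : ℕ}
    (gplus : PointData d → Matrix (Fin d) (Fin d) ℝ) : Prop :=
  ∃ (α : Fin d → (Fin (d - 1) → ℝ) → (Fin d → ℝ) → ℝ)
    (β : Fin d → Fin d → (Fin (d - 1) → ℝ) → (Fin d → ℝ) → ℝ),
    ∀ D ∈ singularPointData d, gplus D =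
      (∑ m : Fin d, α m D.tau D.upsilon • (D.g * D.K ^ (m : ℕ)))
      + ∑ l : Fin d, ∑ m : Fin d, β l m D.tau D.upsilon •
          Matrix.vecMulVec (D.v ᵥ* D.K ^ (l : ℕ)) (D.v ᵥ* D.K ^ (m : ℕ))

/-- Isotropic maps: `K̊⁺ = 0`, `v⁺ = 0`, `μ⁺ = (d-1)/(2d)`, and `g⁺` is a positive covariant
combination of the incoming data. -/
structure IsIsotropic {d : ℕ} (S : PointData d → PointData d) : Prop where
  kring : ∀ D ∈ singularPointData d, (S D).Kring = 0
  vel : ∀ D ∈ singularPointData d, (S D).v = 0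
  dens : ∀ D ∈ singularPointData d, (S D).μ = ((d : ℝ) - 1) / (2 * d)
  posDef : ∀ D ∈ singularPointData d, (S D).g.PosDef
  combination : IsCovariantCombination (fun D => (S D).g)

/-- Anisotropic maps with parameters `γ` and `ω`. The outgoing density, which is determined by
`γ` and `ω`, has to be non-negative. -/
structure IsAnisotropicWith {d : ℕ} (γ : ℝ) (ω : (Fin (d - 1) → ℝ) → (Fin d → ℝ) → ℝ)
    (S : PointData d → PointData d) : Prop where
  kring : ∀ D ∈ singularPointData d, (S D).Kring = (γ * (ω D.tau D.upsilon)⁻¹) • D.Kring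
  metric : ∀ D ∈ singularPointData d, (S D).g = (ω D.tau D.upsilon) ^ (2 / (d : ℝ)) • D.g
  momentum : ∀ D ∈ singularPointData d,
    (S D).μ • (S D).v = (γ * (ω D.tau D.upsilon)⁻¹ * D.μ) • D.v
  dens : ∀ D ∈ singularPointData d, ((d : ℝ) - 1) / (2 * d) - (S D).μ =
    γ ^ 2 * ((ω D.tau D.upsilon) ^ 2)⁻¹ * (((d : ℝ) - 1) / (2 * d) - D.μ)
  nonneg : ∀ D ∈ singularPointData d, 0 ≤ (S D).μ

/-- Anisotropic maps: `γ ≠ 0` is a constant and `ω` is a positive function of the invariants. -/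
def IsAnisotropic {d : ℕ} (S : PointData d → PointData d) : Prop :=
  ∃ (γ : ℝ) (ω : (Fin (d - 1) → ℝ) → (Fin d → ℝ) → ℝ),
    γ ≠ 0 ∧ (∀ t u, 0 < ω t u) ∧ IsAnisotropicWith γ ω S

/-!
The mathematics behind the classification.

*Necessity.* In an orthonormal frame, pointwise data with `μ > 0` are given by a traceless symmetric
matrix `k = K̊` and by the momentum density `p = 2 μ v`; both range over an open set. On a flat
coordinate patch the reduced momentum constraint reads `∂_a k_{ab} = p_b`, and a suitable quadratic
term in `k` realizes every one-jet of `(k, p)` that satisfies it at one point (`exists_field`). In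
terms of the tensor density `Q = √(det g⁺) K̊⁺`, the outgoing constraint is an identity between the
derivative of `Q`, the work `½ √(det g⁺) tr (K̊⁺ (g⁺)⁻¹ δg⁺)` and the outgoing momentum, valid for
all admissible one-jets (`exists_outDensity_deriv`). Since a one-jet is only restricted by its
divergence, `dQ` is independent of `v` and acts through a matrix of Lagrange multipliers
(`exists_lagrange_multiplier`). Covariance under reflections and the trace and symmetry of `Q` reduce
this matrix to a multiple of the identity, and a map on a convex domain of dimension at least two
whose derivative is everywhere a multiple of the identity is affine. Isotropy gives `Q = 0` at
`k = 0`, so that `Q = γ k` with a constant `γ` (`exists_outDensity_eq_smul`).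

The constraint then collapses to `√(det g⁺) μ⁺ v⁺ = γ μ v` and to the vanishing of the work. If
`γ ≠ 0`, then `g⁺` is diagonal in a generic eigenframe of `k` and the work condition is
`∑ k_i δ(log g⁺_{ii}) = 0`. Integrating along rays from `k = 0` gives `∑ k_i log g⁺_{ii} = 0`;
differentiating this identity and using the condition once more shows that all `g⁺_{ii}` agree, so
`g⁺` is conformal to `g` (`map_g_eq_smul_one`) and `ω` is the ratio of the volume densities. If
`γ = 0`, then `K̊⁺` and `v⁺` vanish. Data with `μ = 0` are limits of data with `μ > 0`.

*Invariants.* The traces `τ_m` determine the eigenvalues of `K̊` by Newton's identities, and the `υ_m`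
determine the norms of the projections of `v` to the eigenspaces by Lagrange interpolation; hence the
invariants separate the orbits of the frame changes (`exists_transform_eq`). A bilinear form
invariant under the stabilizer of the data is a covariant combination of them, as is seen in an
eigenframe in which `v` has at most one component in each eigenspace (`exists_combination`).

*Sufficiency.* The divergence of a traceless symmetric tensor is conformally covariant
(`divergence_conformal`), which is exactly what the anisotropic maps require; for isotropic maps both
sides of the momentum constraint vanish.
-/

/-! ### Divergence and volume density -/

section MatrixCalculus

/-- The Levi-Civita divergence of `K = δ / d + k` only involves the metric derivatives through
`tr (g⁻¹ ∂_c g)` and `tr (k g⁻¹ ∂_b g)`: the trace part of `K` drops out. -/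
theorem divergence_eq {d : ℕ} {g K : (Fin d → ℝ) → Matrix (Fin d) (Fin d) ℝ} {x : Fin d → ℝ}
    (G : Fin d → Matrix (Fin d) (Fin d) ℝ) (k : Matrix (Fin d) (Fin d) ℝ)
    (hG : ∀ a i j, pderiv a (fun y => g y i j) x = G a i j)
    (hGs : ∀ a, (G a).IsSymm) (hg : (g x).IsSymm) (hgdet : IsUnit (g x).det)
    (hgK : (g x * K x).IsSymm) (s : ℝ) (hk : K x = s • 1 + k) (b : Fin d) :
    divergence g K b x = (∑ a, pderiv a (fun y => K y a b) x)
      + 1 / 2 * ∑ c, ((g x)⁻¹ * G c).trace * k c b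
      - 1 / 2 * (k * ((g x)⁻¹ * G b)).trace := by
  set h := (g x)⁻¹ with hh
  have hs : ∀ i j, h i j = h j i := fun i j => (hg.inv.apply j i)
  have hKh : (K x * h)ᵀ = K x * h := by
    have h1 : (K x)ᵀ * g x = g x * K x := by
      have := hgK.eq
      rwa [Matrix.transpose_mul, hg.eq] at this
    rw [Matrix.transpose_mul, hg.inv.eq]
    calc h * (K x)ᵀ = h * ((K x)ᵀ * g x) * h := by
          rw [Matrix.mul_assoc, Matrix.mul_assoc, Matrix.mul_nonsing_inv _ hgdet, Matrix.mul_one]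
      _ = K x * h := by
          rw [h1, ← Matrix.mul_assoc, Matrix.nonsing_inv_mul _ hgdet, Matrix.one_mul]
  have hq : ∀ i j, (K x * h) i j = (K x * h) j i := fun i j => by
    conv_lhs => rw [← hKh]
    rfl
  have hGs' : ∀ a i j, G a i j = G a j i := fun a i j => ((hGs a).apply j i)
  have e1 : ∀ c, ∑ a, christoffel g a a c x = 1 / 2 * (h * G c).trace := by
    intro c
    have h0 : ∑ a, ∑ e, h a e * G a c e = ∑ a, ∑ e, h a e * G e a c := by
      rw [Finset.sum_comm]
      refine Finset.sum_congr rfl fun a _ => Finset.sum_congr rfl fun e _ => ?_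
      rw [hs, hGs']
    simp only [christoffel, hG, ← hh, ← Finset.mul_sum, mul_add, mul_sub, Finset.sum_add_distrib,
      Finset.sum_sub_distrib, h0, Matrix.trace, Matrix.diag, Matrix.mul_apply]
    have h1 : ∑ a, ∑ e, h a e * G c a e = ∑ a, ∑ e, h a e * G c e a :=
      Finset.sum_congr rfl fun a _ => Finset.sum_congr rfl fun e _ => by rw [hGs']
    rw [h1]; ring
  have e2 : ∑ a, ∑ c, christoffel g c a b x * K x a c = 1 / 2 * (K x * (h * G b)).trace := by
    have h0 : ∀ F : Fin d → Fin d → ℝ, ∑ a, ∑ c, (1 / 2 * ∑ e, h c e * F a e) * K x a c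
        = 1 / 2 * ∑ a, ∑ e, (K x * h) a e * F a e := by
      intro F
      simp only [Finset.mul_sum, Finset.sum_mul, Matrix.mul_apply]
      refine Finset.sum_congr rfl fun a _ => ?_
      rw [Finset.sum_comm]
      refine Finset.sum_congr rfl fun a _ => Finset.sum_congr rfl fun e _ => ?_
      ring
    simp only [christoffel, hG, ← hh]
    rw [h0 (fun a e => G a b e + G b a e - G e a b)]
    have h2 : ∑ a, ∑ e, (K x * h) a e * G a b e = ∑ a, ∑ e, (K x * h) a e * G e a b := by
      rw [Finset.sum_comm]
      refine Finset.sum_congr rfl fun a _ => Finset.sum_congr rfl fun e _ => ?_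
      rw [hq, hGs']
    have h3 : ∑ a, ∑ e, (K x * h) a e * G b a e = (K x * h * G b).trace := by
      simp only [Matrix.trace, Matrix.diag, Matrix.mul_apply (M := K x * h)]
      exact Finset.sum_congr rfl fun a _ => Finset.sum_congr rfl fun e _ => by rw [hGs']
    simp only [mul_add, mul_sub, Finset.sum_add_distrib, Finset.sum_sub_distrib, h2, h3,
      Matrix.mul_assoc]
    ring
  have e3 : ∑ a, ∑ c, christoffel g a a c x * K x c b
      = 1 / 2 * ∑ c, (h * G c).trace * K x c b := by
    rw [Finset.sum_comm, Finset.mul_sum]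
    refine Finset.sum_congr rfl fun c _ => ?_
    rw [← Finset.sum_mul, e1]; ring
  have e4 : ∑ c, (h * G c).trace * K x c b = s * (h * G b).trace
      + ∑ c, (h * G c).trace * k c b := by
    rw [hk]
    simp [Matrix.one_apply, mul_add, Finset.sum_add_distrib, mul_comm]
  rw [divergence, e2, e3, e4, hk]
  simp only [Matrix.add_mul, Matrix.trace_add, Matrix.smul_mul, Matrix.one_mul, Matrix.trace_smul,
    smul_eq_mul]
  ring

theorem differentiable_det (d : ℕ) :
    Differentiable ℝ (fun M : Matrix (Fin d) (Fin d) ℝ => M.det) := by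
  simp only [Matrix.det_apply]
  fun_prop

/-- Jacobi's formula for the derivative of the volume density `√(det g)`. -/
theorem hasFDerivAt_sqrt_det {d : ℕ} {X : Type*} [NormedAddCommGroup X] [NormedSpace ℝ X]
    {F : X → Matrix (Fin d) (Fin d) ℝ} {F' : X →L[ℝ] Matrix (Fin d) (Fin d) ℝ} {x : X}
    (hF : HasFDerivAt F F' x) (hdet : 0 < (F x).det) :
    ∃ r' : X →L[ℝ] ℝ, HasFDerivAt (fun y => √(F y).det) r' x ∧
      ∀ w, r' w = 1 / 2 * √(F x).det * ((F x)⁻¹ * F' w).trace := by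
  have h1 : HasFDerivAt (fun y => √(F y).det) _ x :=
    ((differentiable_det d (F x)).hasFDerivAt.comp x hF).sqrt hdet.ne'
  refine ⟨_, h1, fun w => ?_⟩
  have hu : IsUnit (F x).det := hdet.ne'.isUnit
  have h2 : fderiv ℝ (fun M : Matrix (Fin d) (Fin d) ℝ => M.det) (F x) (F' w)
      = (F x).det * ((F x)⁻¹ * F' w).trace := by
    have hl : HasDerivAt (fun t : ℝ => (F x + t • F' w).det)
        (fderiv ℝ (fun M : Matrix (Fin d) (Fin d) ℝ => M.det) (F x) (F' w)) 0 := by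
      have hline : HasDerivAt (fun t : ℝ => F x + t • F' w) (F' w) 0 := by
        have h := ((hasDerivAt_id (0 : ℝ)).smul_const (F' w)).const_add (F x)
        rwa [one_smul] at h
      have h0 : F x + (0 : ℝ) • F' w = F x := by rw [zero_smul, add_zero]
      have := (differentiable_det d (F x + (0 : ℝ) • F' w)).hasFDerivAt.comp_hasDerivAt 0 hline
      rw [h0] at this
      exact this
    set M := (F x)⁻¹ * F' w with hM
    have hpoly : (fun t : ℝ => (F x + t • F' w).det) = fun t => (F x).det *
        (1 + M.trace * t + (Matrix.det (1 + (Polynomial.X : Polynomial ℝ) •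
          M.map Polynomial.C)).divX.divX.eval t * t ^ 2) := by
      funext t
      rw [← Matrix.det_one_add_smul, ← Matrix.det_mul, Matrix.mul_add, Matrix.mul_one,
        Matrix.mul_smul, hM, ← Matrix.mul_assoc, Matrix.mul_nonsing_inv _ hu, Matrix.one_mul]
    rw [hpoly] at hl
    set q := (Matrix.det (1 + (Polynomial.X : Polynomial ℝ) • M.map Polynomial.C)).divX.divX
    have hr : HasDerivAt (fun t : ℝ => (F x).det * (1 + M.trace * t + q.eval t * t ^ 2))
        ((F x).det * M.trace) 0 := by
      have := ((((hasDerivAt_id (0 : ℝ)).const_mul M.trace).const_add 1).add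
        ((q.hasDerivAt 0).mul (hasDerivAt_pow 2 (0 : ℝ)))).const_mul (F x).det
      simpa using this
    exact hl.unique hr
  change 1 / (2 * √(F x).det) *
    fderiv ℝ (fun M : Matrix (Fin d) (Fin d) ℝ => M.det) (F x) (F' w) = _
  rw [h2]
  have h3 : √(F x).det ≠ 0 := (Real.sqrt_pos.2 hdet).ne'
  field_simp
  rw [Real.sq_sqrt hdet.le]

end MatrixCalculus

namespace PointData

variable {d : ℕ}

/-! ### Changes of frame -/

section Transform

theorem transform_g (A : GL (Fin d) ℝ) (D : PointData d) : (D.transform A).g =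
    ((A⁻¹ : GL (Fin d) ℝ) : Matrix (Fin d) (Fin d) ℝ)ᵀ * D.g *
      ((A⁻¹ : GL (Fin d) ℝ) : Matrix (Fin d) (Fin d) ℝ) := rfl

theorem transform_K (A : GL (Fin d) ℝ) (D : PointData d) : (D.transform A).K =
    (A : Matrix (Fin d) (Fin d) ℝ) * D.K * ((A⁻¹ : GL (Fin d) ℝ) : Matrix (Fin d) (Fin d) ℝ) := rfl

theorem transform_μ (A : GL (Fin d) ℝ) (D : PointData d) : (D.transform A).μ = D.μ := rfl

theorem transform_v (A : GL (Fin d) ℝ) (D : PointData d) : (D.transform A).v =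
    ((A⁻¹ : GL (Fin d) ℝ) : Matrix (Fin d) (Fin d) ℝ)ᵀ *ᵥ D.v := rfl

theorem ext_of {D D' : PointData d} (hg : D.g = D'.g) (hK : D.K = D'.K) (hμ : D.μ = D'.μ)
    (hv : D.v = D'.v) : D = D' :=
  Prod.ext hg (Prod.ext hK (Prod.ext hμ hv))

theorem transform_Kring (A : GL (Fin d) ℝ) (D : PointData d) : (D.transform A).Kring =
    (A : Matrix (Fin d) (Fin d) ℝ) * D.Kring *
      ((A⁻¹ : GL (Fin d) ℝ) : Matrix (Fin d) (Fin d) ℝ) := by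
  simp [Kring, transform_K, Matrix.mul_sub, Matrix.sub_mul]

theorem transform_transform (A B : GL (Fin d) ℝ) (D : PointData d) :
    (D.transform A).transform B = D.transform (B * A) := by
  refine ext_of ?_ ?_ rfl ?_
  · simp only [transform_g, mul_inv_rev, Units.val_mul, Matrix.transpose_mul, Matrix.mul_assoc]
  · simp only [transform_K, mul_inv_rev, Units.val_mul, Matrix.mul_assoc]
  · simp only [transform_v, mul_inv_rev, Units.val_mul, Matrix.transpose_mul, Matrix.mulVec_mulVec]

theorem transform_one (D : PointData d) : D.transform 1 = D := by
  refine ext_of ?_ ?_ rfl ?_ <;> simp [transform_g, transform_K, transform_v]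

theorem transform_inv_transform (A : GL (Fin d) ℝ) (D : PointData d) :
    (D.transform A).transform A⁻¹ = D := by
  rw [transform_transform, inv_mul_cancel, transform_one]

theorem trace_conj (A : GL (Fin d) ℝ) (M : Matrix (Fin d) (Fin d) ℝ) :
    ((A : Matrix (Fin d) (Fin d) ℝ) * M *
      ((A⁻¹ : GL (Fin d) ℝ) : Matrix (Fin d) (Fin d) ℝ)).trace = M.trace := by
  rw [Matrix.trace_mul_comm, ← Matrix.mul_assoc, Units.inv_mul, Matrix.one_mul]

theorem isSymm_of_posDef {g : Matrix (Fin d) (Fin d) ℝ} (h : g.PosDef) : g.IsSymm := by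
  have := h.isHermitian
  rwa [Matrix.IsHermitian, Matrix.conjTranspose_eq_transpose_of_trivial] at this

theorem isUnit_det_of_posDef {g : Matrix (Fin d) (Fin d) ℝ} (h : g.PosDef) : IsUnit g.det :=
  h.det_pos.ne'.isUnit

theorem transform_mem {D : PointData d} (hD : D ∈ singularPointData d) (A : GL (Fin d) ℝ) :
    D.transform A ∈ singularPointData d := by
  obtain ⟨⟨h1, h2, h3, h4⟩, h5⟩ := hD
  refine ⟨⟨?_, ?_, ?_, h4⟩, ?_⟩
  · rw [transform_g, ← Matrix.conjTranspose_eq_transpose_of_trivial]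
    refine h1.conjTranspose_mul_mul_same ?_
    exact Matrix.mulVec_injective_of_isUnit (Units.isUnit _)
  · rw [transform_K, trace_conj, h2]
  · have h : (D.transform A).g * (D.transform A).K =
        ((A⁻¹ : GL (Fin d) ℝ) : Matrix (Fin d) (Fin d) ℝ)ᵀ * (D.g * D.K) *
          ((A⁻¹ : GL (Fin d) ℝ) : Matrix (Fin d) (Fin d) ℝ) := by
      rw [transform_g, transform_K]
      simp only [Matrix.mul_assoc]
      rw [Units.inv_mul_cancel_left]
    rw [h, Matrix.IsSymm, Matrix.transpose_mul, Matrix.transpose_mul, h3.eq,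
      Matrix.transpose_transpose]
    simp only [Matrix.mul_assoc]
  · have h : (D.transform A).K * (D.transform A).K = (A : Matrix (Fin d) (Fin d) ℝ) * (D.K * D.K) *
          ((A⁻¹ : GL (Fin d) ℝ) : Matrix (Fin d) (Fin d) ℝ) := by
      rw [transform_K]
      simp only [Matrix.mul_assoc]
      rw [Units.inv_mul_cancel_left]
    rw [Hamiltonian, h, trace_conj]
    exact h5

theorem transform_tau (A : GL (Fin d) ℝ) (D : PointData d) : (D.transform A).tau = D.tau := by
  funext i
  rw [tau, tau, transform_Kring, Units.conj_pow, trace_conj]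

theorem transform_g_inv (A : GL (Fin d) ℝ) (D : PointData d) : (D.transform A).g⁻¹ =
    (A : Matrix (Fin d) (Fin d) ℝ) * D.g⁻¹ * (A : Matrix (Fin d) (Fin d) ℝ)ᵀ := by
  rw [transform_g, Matrix.mul_inv_rev, Matrix.mul_inv_rev, ← Matrix.coe_units_inv, inv_inv,
    ← Matrix.transpose_nonsing_inv, ← Matrix.coe_units_inv, inv_inv, Matrix.mul_assoc]

theorem transform_upsilon (A : GL (Fin d) ℝ) (D : PointData d) :
    (D.transform A).upsilon = D.upsilon := by
  funext i
  rw [upsilon, upsilon, transform_Kring, Units.conj_pow, transform_g_inv, transform_v]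
  have h : (A : Matrix (Fin d) (Fin d) ℝ)ᵀ *
      ((A⁻¹ : GL (Fin d) ℝ) : Matrix (Fin d) (Fin d) ℝ)ᵀ = 1 := by
    rw [← Matrix.transpose_mul, Units.inv_mul, Matrix.transpose_one]
  rw [Matrix.mulVec_transpose, ← Matrix.dotProduct_mulVec]
  congr 1
  rw [← Matrix.mulVec_transpose]
  simp only [Matrix.mulVec_mulVec, Matrix.mul_assoc, h, Matrix.mul_one, Units.inv_mul_cancel_left]

theorem transform_det_div (A : GL (Fin d) ℝ) (D D' : PointData d) :
    (D'.transform A).g.det / (D.transform A).g.det = D'.g.det / D.g.det := by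
  have h : ((A⁻¹ : GL (Fin d) ℝ) : Matrix (Fin d) (Fin d) ℝ).det ≠ 0 :=
    ((Matrix.isUnit_iff_isUnit_det _).1 (Units.isUnit (A⁻¹ : GL (Fin d) ℝ))).ne_zero
  simp only [transform_g, Matrix.det_mul, Matrix.det_transpose]
  rw [mul_div_mul_right _ _ h, mul_div_mul_left _ _ h]

end Transform

/-! ### Adapted frames -/

section Frames

/-- The change of frame given by an orthogonal matrix. -/
def orthoGL (O : Matrix (Fin d) (Fin d) ℝ) (h : O * Oᵀ = 1) : GL (Fin d) ℝ :=
  ⟨O, Oᵀ, h, mul_eq_one_comm.1 h⟩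

theorem orthoGL_val (O : Matrix (Fin d) (Fin d) ℝ) (h : O * Oᵀ = 1) :
    ((orthoGL O h : GL (Fin d) ℝ) : Matrix (Fin d) (Fin d) ℝ) = O := rfl

theorem orthoGL_inv (O : Matrix (Fin d) (Fin d) ℝ) (h : O * Oᵀ = 1) :
    (((orthoGL O h)⁻¹ : GL (Fin d) ℝ) : Matrix (Fin d) (Fin d) ℝ) = Oᵀ := rfl

/-- Spectral theorem in matrix form. -/
theorem exists_ortho_diagonal {M : Matrix (Fin d) (Fin d) ℝ} (hM : M.IsSymm) :
    ∃ (O : Matrix (Fin d) (Fin d) ℝ) (l : Fin d → ℝ), O * Oᵀ = 1 ∧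
      O * M * Oᵀ = Matrix.diagonal l := by
  have hH : M.IsHermitian := by
    rwa [Matrix.IsHermitian, Matrix.conjTranspose_eq_transpose_of_trivial]
  have hU := hH.eigenvectorUnitary.2
  refine ⟨(hH.eigenvectorUnitary : Matrix (Fin d) (Fin d) ℝ)ᵀ, hH.eigenvalues, ?_, ?_⟩
  · have := (Matrix.mem_unitaryGroup_iff').1 hU
    rwa [Matrix.star_eq_conjTranspose, Matrix.conjTranspose_eq_transpose_of_trivial] at this
  · have := hH.conjStarAlgAut_star_eigenvectorUnitary
    rw [Unitary.conjStarAlgAut_star_apply, Matrix.star_eq_conjTranspose,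
      Matrix.conjTranspose_eq_transpose_of_trivial] at this
    rw [Matrix.transpose_transpose, this]
    rfl

/-- Every metric is the identity in a suitable frame. -/
theorem exists_transform_g_eq_one {D : PointData d} (hD : D.g.PosDef) :
    ∃ A : GL (Fin d) ℝ, (D.transform A).g = 1 := by
  obtain ⟨O, l, hO, hl⟩ := exists_ortho_diagonal (isSymm_of_posDef hD)
  have hO' : Oᵀ * O = 1 := mul_eq_one_comm.1 hO
  have hpos : ∀ i, 0 < l i := by
    have h1 : (Matrix.diagonal l).PosDef := by
      rw [← hl]
      have := hD.conjTranspose_mul_mul_same (B := Oᵀ) (Matrix.mulVec_injective_of_isUnit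
        (IsUnit.of_mul_eq_one _ hO'))
      rwa [Matrix.conjTranspose_eq_transpose_of_trivial, Matrix.transpose_transpose] at this
    exact Matrix.posDef_diagonal_iff.1 h1
  set s : Fin d → ℝ := fun i => √(l i) with hs
  have hs0 : ∀ i, s i ≠ 0 := fun i => (Real.sqrt_pos.2 (hpos i)).ne'
  have hss : Matrix.diagonal s * Matrix.diagonal s⁻¹ = 1 := by
    rw [Matrix.diagonal_mul_diagonal, ← Matrix.diagonal_one]
    congr 1; funext i; simp [hs0 i]
  have hss' := mul_eq_one_comm.1 hss
  refine ⟨⟨Matrix.diagonal s * O, Oᵀ * Matrix.diagonal s⁻¹, ?_, ?_⟩, ?_⟩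
  · rw [Matrix.mul_assoc, ← Matrix.mul_assoc O, hO, Matrix.one_mul, hss]
  · rw [Matrix.mul_assoc, ← Matrix.mul_assoc _ _ O, hss', Matrix.one_mul, hO']
  · change (Oᵀ * Matrix.diagonal s⁻¹)ᵀ * D.g * (Oᵀ * Matrix.diagonal s⁻¹) = 1
    rw [Matrix.transpose_mul, Matrix.transpose_transpose, Matrix.diagonal_transpose]
    have : Matrix.diagonal s⁻¹ * O * D.g * (Oᵀ * Matrix.diagonal s⁻¹)
        = Matrix.diagonal s⁻¹ * (O * D.g * Oᵀ) * Matrix.diagonal s⁻¹ := by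
      simp only [Matrix.mul_assoc]
    rw [this, hl, Matrix.diagonal_mul_diagonal, Matrix.diagonal_mul_diagonal,
      ← Matrix.diagonal_one]
    congr 1; funext i
    have : l i = s i * s i := (Real.mul_self_sqrt (hpos i).le).symm
    rw [this]
    simp [hs0 i]

/-- A frame in which the metric is the identity and the extrinsic curvature is diagonal. -/
theorem exists_transform_diagonal {D : PointData d} (hD : D ∈ singularPointData d) :
    ∃ (A : GL (Fin d) ℝ) (l : Fin d → ℝ), (D.transform A).g = 1 ∧
      (D.transform A).K = Matrix.diagonal l := by
  obtain ⟨A, hA⟩ := exists_transform_g_eq_one hD.1.posDef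
  have h1 := (transform_mem hD A).1.symm
  rw [hA, Matrix.one_mul] at h1
  obtain ⟨O, l, hO, hl⟩ := exists_ortho_diagonal h1
  refine ⟨orthoGL O hO * A, l, ?_, ?_⟩
  · rw [← transform_transform, transform_g, hA, orthoGL_inv, Matrix.mul_one,
      Matrix.transpose_transpose, hO]
  · rw [← transform_transform, transform_K, orthoGL_val, orthoGL_inv, hl]

/-- The reflection of the `i`-th axis. -/
def flip (i : Fin d) : Matrix (Fin d) (Fin d) ℝ :=
  Matrix.diagonal fun j => if j = i then -1 else 1

theorem flip_mul_transpose (i : Fin d) : flip i * (flip i)ᵀ = 1 := by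
  rw [flip, Matrix.diagonal_transpose, Matrix.diagonal_mul_diagonal, ← Matrix.diagonal_one]
  congr 1; funext j
  split_ifs <;> norm_num

theorem flip_transpose (i : Fin d) : (flip i)ᵀ = flip i := Matrix.diagonal_transpose _

theorem flip_conj_apply (i a b : Fin d) (M : Matrix (Fin d) (Fin d) ℝ) :
    (flip i * M * flip i) a b = (if a = i then -1 else 1) * M a b * (if b = i then -1 else 1) := by
  rw [flip, Matrix.mul_diagonal, Matrix.diagonal_mul]

/-- A matrix unchanged by the reflection of an axis is block diagonal. -/
theorem apply_eq_zero_of_flip {i a : Fin d} {M : Matrix (Fin d) (Fin d) ℝ}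
    (hM : flip i * M * flip i = M) (ha : a ≠ i) : M a i = 0 ∧ M i a = 0 := by
  have h1 := congrFun (congrFun hM a) i
  have h2 := congrFun (congrFun hM i) a
  rw [flip_conj_apply] at h1 h2
  simp only [ha, if_true, if_false] at h1 h2
  constructor <;> linarith

/-- The frame change permuting the axes by `σ`. -/
def permMatrix (σ : Equiv.Perm (Fin d)) : Matrix (Fin d) (Fin d) ℝ :=
  (1 : Matrix (Fin d) (Fin d) ℝ).submatrix σ id

theorem permMatrix_mul_mul (σ : Equiv.Perm (Fin d)) (M : Matrix (Fin d) (Fin d) ℝ) :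
    permMatrix σ * M * (permMatrix σ)ᵀ = M.submatrix σ σ := by
  ext i j
  simp [permMatrix, Matrix.mul_apply, Matrix.one_apply, Finset.sum_ite_eq]

theorem permMatrix_mul_transpose (σ : Equiv.Perm (Fin d)) :
    permMatrix σ * (permMatrix σ)ᵀ = 1 := by
  have := permMatrix_mul_mul σ 1
  rw [Matrix.mul_one] at this
  rw [this, Matrix.submatrix_one_equiv]

theorem permMatrix_mulVec (σ : Equiv.Perm (Fin d)) (w : Fin d → ℝ) (i : Fin d) :
    (permMatrix σ *ᵥ w) i = w (σ i) := by
  simp [permMatrix, Matrix.mulVec, dotProduct, Matrix.one_apply]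

end Frames

end PointData

/-! ### Power sums and interpolation -/

section Interpolation

/-- Every function on the values of `l` is a polynomial of degree less than `d` in them. -/
theorem exists_coeff_interpolate {d : ℕ} (l : Fin d → ℝ) (f : ℝ → ℝ) :
    ∃ c : Fin d → ℝ, ∀ i, ∑ m : Fin d, c m * l i ^ (m : ℕ) = f (l i) := by
  classical
  set s : Finset ℝ := Finset.univ.image l
  have hinj : Set.InjOn (id : ℝ → ℝ) s := Function.injective_id.injOn
  set p := Lagrange.interpolate s id f
  have hp : p.degree < (d : WithBot ℕ) := by
    refine (Lagrange.degree_interpolate_lt f hinj).trans_le ?_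
    have : s.card ≤ d := Finset.card_image_le.trans (by simp)
    exact_mod_cast this
  refine ⟨fun m => p.coeff m, fun i => ?_⟩
  have h1 : p.eval (l i) = f (l i) :=
    Lagrange.eval_interpolate_at_node (v := id) f hinj
      (Finset.mem_image_of_mem l (Finset.mem_univ i))
  rw [← h1, Fin.sum_univ_eq_sum_range (fun m => p.coeff m * l i ^ m) d]
  by_cases h0 : p = 0
  · simp [h0]
  · exact (Polynomial.eval_eq_sum_range' ((Polynomial.natDegree_lt_iff_degree_lt h0).2 hp) _).symm

/-- The first `d` power sums determine a `d`-tuple up to order (Newton's identities). -/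
theorem exists_perm_of_sum_pow_eq {d : ℕ} (l l' : Fin d → ℝ)
    (h : ∀ m, 1 ≤ m → m ≤ d → ∑ i, l i ^ m = ∑ i, l' i ^ m) :
    ∃ σ : Equiv.Perm (Fin d), l' = l ∘ σ := by
  classical
  -- Newton's identities determine the elementary symmetric functions recursively.
  have hes : ∀ k, k ≤ d → MvPolynomial.aeval l (MvPolynomial.esymm (Fin d) ℝ k)
      = MvPolynomial.aeval l' (MvPolynomial.esymm (Fin d) ℝ k) := by
    intro k
    induction k using Nat.strong_induction_on with
    | _ k ih =>
      intro hk
      rcases Nat.eq_zero_or_pos k with rfl | hpos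
      · simp
      have e : ∀ x : Fin d → ℝ, (k : ℝ) * MvPolynomial.aeval x (MvPolynomial.esymm (Fin d) ℝ k) =
          (-1) ^ (k + 1) * ∑ a ∈ Finset.HasAntidiagonal.antidiagonal k with a.1 < k, (-1) ^ a.1 *
            MvPolynomial.aeval x (MvPolynomial.esymm (Fin d) ℝ a.1) * ∑ i, x i ^ a.2 := by
        intro x
        have := congrArg (MvPolynomial.aeval x) (MvPolynomial.mul_esymm_eq_sum (Fin d) ℝ k)
        simpa [MvPolynomial.psum, map_sum] using this
      have e' : (k : ℝ) * MvPolynomial.aeval l (MvPolynomial.esymm (Fin d) ℝ k)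
          = k * MvPolynomial.aeval l' (MvPolynomial.esymm (Fin d) ℝ k) := by
        rw [e, e]
        congr 1
        refine Finset.sum_congr rfl fun a ha => ?_
        rw [Finset.mem_filter, Finset.HasAntidiagonal.mem_antidiagonal] at ha
        rw [ih a.1 ha.2 (by omega), h a.2 (by omega) (by omega)]
      exact mul_left_cancel₀ (by exact_mod_cast hpos.ne') e'
  have hm : Finset.univ.val.map l = Finset.univ.val.map l' := by
    have h1 : ((Finset.univ.val.map l).map fun t => Polynomial.X - Polynomial.C t).prod
        = ((Finset.univ.val.map l').map fun t => Polynomial.X - Polynomial.C t).prod := by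
      rw [Multiset.prod_X_sub_X_eq_sum_esymm, Multiset.prod_X_sub_X_eq_sum_esymm]
      simp only [Multiset.card_map, Finset.card_val, Finset.card_univ, Fintype.card_fin]
      refine Finset.sum_congr rfl fun j hj => ?_
      rw [← MvPolynomial.aeval_esymm_eq_multiset_esymm (Fin d) ℝ,
        ← MvPolynomial.aeval_esymm_eq_multiset_esymm (Fin d) ℝ, hes j (by
          have := Finset.mem_range.1 hj; omega)]
    have h2 := congrArg Polynomial.roots h1
    rwa [Polynomial.roots_multiset_prod_X_sub_C, Polynomial.roots_multiset_prod_X_sub_C] at h2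
  -- Both tuples take each value equally often; the permutation matches the fibres.
  have hc : ∀ c : ℝ, Nonempty ({i // l' i = c} ≃ {i // l i = c}) := by
    intro c
    have := congrArg (Multiset.count c) hm
    rw [Multiset.count_map, Multiset.count_map] at this
    refine ⟨Fintype.equivOfCardEq ?_⟩
    rw [Fintype.card_subtype, Fintype.card_subtype, Finset.card_def, Finset.card_def,
      Finset.filter_val, Finset.filter_val]
    simp only [eq_comm (a := c)] at this
    exact this.symm
  have e := fun c => Classical.choice (hc c)
  refine ⟨Equiv.ofFiberEquiv e, ?_⟩
  funext i
  exact (Equiv.ofFiberEquiv_map e i).symm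

end Interpolation

/-! ### Reflections in the eigenspaces -/

section BlockReflection

/-- Simultaneous Householder reflections in the level sets of `l`: a symmetric involution that
commutes with `diag l` and maps `v` to `v'`, two vectors with equal norm on each level set. -/
theorem exists_block_reflection {d : ℕ} (l v v' : Fin d → ℝ)
    (h : ∀ i, ∑ j with l j = l i, v j ^ 2 = ∑ j with l j = l i, v' j ^ 2) :
    ∃ O : Matrix (Fin d) (Fin d) ℝ, O.IsSymm ∧ O * O = 1 ∧
      O * Matrix.diagonal l * O = Matrix.diagonal l ∧ O *ᵥ v = v' := by
  classical
  set w : Fin d → ℝ := v - v' with hw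
  set n : ℝ → ℝ := fun c => ∑ j with l j = c, w j ^ 2 with hn
  -- `B` is the sum over the level sets of the orthogonal projections to the lines of `v - v'`.
  -- Where `v = v'` the line degenerates and `x / 0 = 0` gives the projection zero.
  set B : Matrix (Fin d) (Fin d) ℝ :=
    Matrix.of fun i j => if l j = l i then w i * w j / n (l i) else 0 with hB
  have hBs : Bᵀ = B := by
    ext i j
    simp only [hB, Matrix.transpose_apply, Matrix.of_apply, eq_comm (a := l i)]
    split_ifs with hij
    · rw [hij, mul_comm]
    · rfl
  have hBB : B * B = B := by
    ext i j
    simp only [hB, Matrix.mul_apply, Matrix.of_apply]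
    split_ifs with hij
    · have h1 : ∀ k, (if l k = l i then w i * w k / n (l i) else 0) *
          (if l j = l k then w k * w j / n (l k) else 0)
          = (w i * w j / n (l i) / n (l i)) * (if l k = l i then w k ^ 2 else 0) := by
        intro k
        by_cases hk : l k = l i
        · simp only [hk, hij, if_true]; ring
        · simp [hk]
      simp only [h1, ← Finset.mul_sum, ← Finset.sum_filter]
      change w i * w j / n (l i) / n (l i) * n (l i) = _
      by_cases h0 : n (l i) = 0
      · simp [h0]
      · field_simp
    · refine Finset.sum_eq_zero fun k _ => ?_
      by_cases hk : l k = l i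
      · simp [hk, hij]
      · simp [hk]
  have hBl : B * Matrix.diagonal l = Matrix.diagonal l * B := by
    ext i j
    simp only [hB, Matrix.mul_diagonal, Matrix.diagonal_mul, Matrix.of_apply]
    split_ifs with hij
    · rw [hij, mul_comm]
    · simp
  have hBv : B *ᵥ v = (1 / 2 : ℝ) • w := by
    funext i
    have h1 : (B *ᵥ v) i = w i / n (l i) * ∑ j with l j = l i, w j * v j := by
      simp only [hB, Matrix.mulVec, dotProduct, Matrix.of_apply, Finset.mul_sum,
        Finset.sum_filter]
      refine Finset.sum_congr rfl fun j _ => ?_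
      split_ifs <;> ring
    have h2 : 2 * ∑ j with l j = l i, w j * v j = n (l i) := by
      have : n (l i) = 2 * (∑ j with l j = l i, w j * v j) +
          (∑ j with l j = l i, v' j ^ 2 - ∑ j with l j = l i, v j ^ 2) := by
        simp only [hn, Finset.mul_sum, ← Finset.sum_add_distrib, ← Finset.sum_sub_distrib, hw,
          Pi.sub_apply]
        exact Finset.sum_congr rfl fun j _ => by ring
      rw [this, h i]; ring
    rw [h1, Pi.smul_apply, smul_eq_mul]
    by_cases h0 : n (l i) = 0
    · have : w i = 0 := by
        have h3 := (Finset.sum_eq_zero_iff_of_nonneg (fun j _ => sq_nonneg (w j))).1 h0 i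
          (by simp)
        exact pow_eq_zero_iff (two_ne_zero) |>.1 h3
      simp [this]
    · rw [← h2] at h0 ⊢
      have h3 := right_ne_zero_of_mul h0
      generalize ∑ j with l j = l i, w j * v j = y at *
      field_simp
  refine ⟨1 - (2 : ℝ) • B, ?_, ?_, ?_, ?_⟩
  · rw [Matrix.IsSymm, Matrix.transpose_sub, Matrix.transpose_smul, hBs, Matrix.transpose_one]
  · simp only [Matrix.sub_mul, Matrix.mul_sub, Matrix.smul_mul, Matrix.mul_smul, Matrix.one_mul,
      Matrix.mul_one, hBB]
    module
  · have : (1 - (2 : ℝ) • B) * Matrix.diagonal l = Matrix.diagonal l * (1 - (2 : ℝ) • B) := by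
      simp only [Matrix.sub_mul, Matrix.mul_sub, Matrix.smul_mul, Matrix.mul_smul, Matrix.one_mul,
        Matrix.mul_one, hBl]
    rw [this, Matrix.mul_assoc]
    simp only [Matrix.sub_mul, Matrix.mul_sub, Matrix.smul_mul, Matrix.mul_smul, Matrix.one_mul,
      Matrix.mul_one, hBB]
    module
  · rw [Matrix.sub_mulVec, Matrix.smul_mulVec, hBv, Matrix.one_mulVec, hw]
    module

end BlockReflection

namespace PointData

variable {d : ℕ}

/-! ### The scalar invariants separate the orbits -/

section Invariants

theorem Kring_diagonal {D : PointData d} {l : Fin d → ℝ} (hK : D.K = Matrix.diagonal l) :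
    D.Kring = Matrix.diagonal fun i => l i - 1 / d := by
  rw [Kring, hK]
  ext i j
  by_cases h : i = j
  · subst h; simp
  · simp [h]

theorem tau_diagonal {D : PointData d} {l : Fin d → ℝ} (hK : D.K = Matrix.diagonal l)
    (i : Fin (d - 1)) : D.tau i = ∑ j, (l j - 1 / d) ^ ((i : ℕ) + 2) := by
  rw [tau, Kring_diagonal hK, Matrix.diagonal_pow, Matrix.trace_diagonal]
  rfl

theorem upsilon_diagonal {D : PointData d} {l : Fin d → ℝ} (hg : D.g = 1)
    (hK : D.K = Matrix.diagonal l) (i : Fin d) :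
    D.upsilon i = ∑ j, (l j - 1 / d) ^ (i : ℕ) * D.v j ^ 2 := by
  rw [upsilon, Kring_diagonal hK, Matrix.diagonal_pow, hg, inv_one, Matrix.one_mulVec, dotProduct]
  refine Finset.sum_congr rfl fun j _ => ?_
  rw [Matrix.mulVec_diagonal, Pi.pow_apply]
  ring

theorem μ_eq {D : PointData d} (hD : D ∈ singularPointData d) :
    D.μ = (1 - (D.K * D.K).trace) / 2 := by
  have := hD.2
  rw [Hamiltonian] at this
  linarith

/-- Pointwise data in diagonal frames with the same eigenvalues and the same norms of the
projections of `v` to the eigenspaces are related by a change of frame. -/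
theorem exists_transform_of_diagonal {D : PointData d} {l : Fin d → ℝ}
    (hg : D.g = 1) (hK : D.K = Matrix.diagonal l) (v' : Fin d → ℝ)
    (h : ∀ i, ∑ j with l j = l i, D.v j ^ 2 = ∑ j with l j = l i, v' j ^ 2) :
    ∃ A : GL (Fin d) ℝ, (D.transform A).g = 1 ∧ (D.transform A).K = Matrix.diagonal l ∧
      (D.transform A).v = v' := by
  obtain ⟨O, hs, hOO, hl, hv⟩ := exists_block_reflection l D.v v' h
  have hO : O * Oᵀ = 1 := by rw [hs.eq, hOO]
  refine ⟨orthoGL O hO, ?_, ?_, ?_⟩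
  · rw [transform_g, hg, orthoGL_inv, Matrix.mul_one, Matrix.transpose_transpose, hO]
  · rw [transform_K, hK, orthoGL_val, orthoGL_inv, hs.eq, hl]
  · rw [transform_v, orthoGL_inv, Matrix.transpose_transpose, hv]

/-- The invariants `τ_m`, `υ_m` separate the orbits of the frame changes. -/
theorem exists_transform_eq (hd : 0 < d) {D D' : PointData d} (hD : D ∈ singularPointData d)
    (hD' : D' ∈ singularPointData d) (ht : D.tau = D'.tau) (hu : D.upsilon = D'.upsilon) :
    ∃ A : GL (Fin d) ℝ, D.transform A = D' := by
  obtain ⟨A₁, l₁, hg₁, hK₁⟩ := exists_transform_diagonal hD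
  obtain ⟨A₂, l₂, hg₂, hK₂⟩ := exists_transform_diagonal hD'
  have hm₁ := transform_mem hD A₁
  have hm₂ := transform_mem hD' A₂
  have hd' : (d : ℝ) ≠ 0 := by exact_mod_cast hd.ne'
  obtain ⟨σ, hσ⟩ := exists_perm_of_sum_pow_eq (fun i => l₁ i - 1 / d) (fun i => l₂ i - 1 / d) (by
    intro m h1 hm
    rcases Nat.lt_or_ge m 2 with h2 | h2
    · obtain rfl : m = 1 := by omega
      have e₁ := hm₁.1.trace_eq
      have e₂ := hm₂.1.trace_eq
      rw [hK₁, Matrix.trace_diagonal] at e₁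
      rw [hK₂, Matrix.trace_diagonal] at e₂
      simp [Finset.sum_sub_distrib, e₁, e₂]
    · have e₁ := tau_diagonal hK₁ ⟨m - 2, by omega⟩
      have e₂ := tau_diagonal hK₂ ⟨m - 2, by omega⟩
      rw [transform_tau] at e₁ e₂
      rw [ht] at e₁
      rw [e₁] at e₂
      simpa only [show m - 2 + 2 = m by omega] using e₂)
  have hl : l₂ = l₁ ∘ σ := by
    funext i
    have := congrFun hσ i
    simpa using this
  set P := orthoGL (permMatrix σ) (permMatrix_mul_transpose σ)
  set D₁ := (D.transform A₁).transform P with hD₁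
  have hm₁' : D₁ ∈ singularPointData d := transform_mem hm₁ P
  have hg₁' : D₁.g = 1 := by
    rw [hD₁, transform_g, hg₁, orthoGL_inv, Matrix.mul_one, Matrix.transpose_transpose,
      permMatrix_mul_transpose]
  have hK₁' : D₁.K = Matrix.diagonal l₂ := by
    rw [hD₁, transform_K, hK₁, orthoGL_inv, orthoGL_val, permMatrix_mul_mul,
      Matrix.submatrix_diagonal_equiv, hl]
  obtain ⟨B, hBg, hBK, hBv⟩ := exists_transform_of_diagonal hg₁' hK₁' (D'.transform A₂).v (by
    intro i
    -- The norm of the projection of `v` to an eigenspace is a combination of the `υ_m`.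
    obtain ⟨c, hc⟩ := exists_coeff_interpolate (fun j => l₂ j - 1 / d)
      (fun x => if x = l₂ i - 1 / d then 1 else 0)
    have e : ∀ E : PointData d, E.g = 1 → E.K = Matrix.diagonal l₂ →
        ∑ j with l₂ j = l₂ i, E.v j ^ 2 = ∑ m, c m * E.upsilon m := by
      intro E h1 h2
      simp only [upsilon_diagonal h1 h2, Finset.mul_sum]
      rw [Finset.sum_comm, Finset.sum_filter]
      refine Finset.sum_congr rfl fun j _ => ?_
      have := hc j
      simp only [← mul_assoc, ← Finset.sum_mul, this]
      by_cases hij : l₂ j = l₂ i <;> simp [hij]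
    rw [e _ hg₁' hK₁', e _ hg₂ hK₂, hD₁, transform_upsilon, transform_upsilon, transform_upsilon,
      hu])
  have hfin : D₁.transform B = D'.transform A₂ := by
    refine ext_of (hBg.trans hg₂.symm) (hBK.trans hK₂.symm) ?_ hBv
    rw [μ_eq (transform_mem hm₁' B), μ_eq hm₂, hBK, hK₂]
  refine ⟨A₂⁻¹ * (B * (P * A₁)), ?_⟩
  rw [← transform_transform, ← transform_transform, ← transform_transform, ← hD₁, hfin,
    transform_inv_transform]

/-- A frame in which, moreover, `v` has at most one non-zero component in each eigenspace. -/
theorem exists_transform_normal {D : PointData d} (hD : D ∈ singularPointData d) :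
    ∃ (A : GL (Fin d) ℝ) (l : Fin d → ℝ), (D.transform A).g = 1 ∧
      (D.transform A).K = Matrix.diagonal l ∧
      ∀ i j, l i = l j → (D.transform A).v i ≠ 0 → (D.transform A).v j ≠ 0 → i = j := by
  classical
  obtain ⟨A, l, hg, hK⟩ := exists_transform_diagonal hD
  set v := (D.transform A).v
  set v' : Fin d → ℝ := fun i =>
    if ∀ j, l j = l i → i ≤ j then √(∑ j with l j = l i, v j ^ 2) else 0 with hv'
  obtain ⟨B, h1, h2, h3⟩ := exists_transform_of_diagonal hg hK v' (by
    intro i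
    obtain ⟨i₀, hi₀, hmin⟩ := Finset.exists_min_image (Finset.univ.filter fun j => l j = l i) id
      ⟨i, by simp⟩
    simp only [Finset.mem_filter, Finset.mem_univ, true_and, id] at hi₀ hmin
    rw [Finset.sum_eq_single (f := fun j => v' j ^ 2) i₀]
    · simp only [hv', hi₀]
      rw [if_pos hmin, Real.sq_sqrt (Finset.sum_nonneg fun j _ => sq_nonneg _)]
    · intro j hj hne
      have hj' : l j = l i := by simpa using hj
      have : ¬ ∀ k, l k = l j → j ≤ k := fun hall =>
        hne (le_antisymm (hall i₀ (hi₀.trans hj'.symm)) (hmin j hj'))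
      simp [hv', this]
    · intro h
      exact absurd (by simpa using hi₀) h)
  refine ⟨B * A, l, ?_⟩
  rw [← transform_transform]
  refine ⟨h1, h2, fun i j hij hi hj => ?_⟩
  rw [h3] at hi hj
  simp only [hv', ne_eq, ite_eq_right_iff, not_forall] at hi hj
  obtain ⟨hi, -⟩ := hi
  obtain ⟨hj, -⟩ := hj
  exact le_antisymm (hi j hij.symm) (hj i hij)

end Invariants

/-! ### Covariant combinations -/

section Combination

/-- A reflection of an axis orthogonal to `v` is a symmetry of the data in an eigenframe. -/
theorem transform_flip {D : PointData d} {l : Fin d → ℝ} (hg : D.g = 1)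
    (hK : D.K = Matrix.diagonal l) {i : Fin d} (hv : D.v i = 0) :
    D.transform (orthoGL (flip i) (flip_mul_transpose i)) = D := by
  refine ext_of ?_ ?_ rfl ?_
  · rw [transform_g, hg, orthoGL_inv, Matrix.mul_one, Matrix.transpose_transpose,
      flip_mul_transpose]
  · rw [transform_K, hK, orthoGL_val, orthoGL_inv, flip_transpose]
    ext a b
    rw [flip_conj_apply, Matrix.diagonal_apply]
    split_ifs <;> simp_all
  · rw [transform_v, orthoGL_inv, Matrix.transpose_transpose]
    funext j
    rw [flip, Matrix.mulVec_diagonal]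
    split_ifs with h
    · rw [h, hv]; simp
    · simp

/-- So is the exchange of two axes in an eigenspace on which `v` has equal components. -/
theorem transform_swap {D : PointData d} {l : Fin d → ℝ} (hg : D.g = 1)
    (hK : D.K = Matrix.diagonal l) {i j : Fin d} (hl : l i = l j) (hv : D.v i = D.v j) :
    D.transform (orthoGL (permMatrix (Equiv.swap i j)) (permMatrix_mul_transpose _)) = D := by
  have hsw : ∀ f : Fin d → ℝ, f i = f j → ∀ k, f (Equiv.swap i j k) = f k := by
    intro f hf k
    rw [Equiv.swap_apply_def]
    split_ifs with h1 h2
    · rw [h1, hf]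
    · rw [h2, hf]
    · rfl
  refine ext_of ?_ ?_ rfl ?_
  · rw [transform_g, hg, orthoGL_inv, Matrix.mul_one, Matrix.transpose_transpose,
      permMatrix_mul_transpose]
  · rw [transform_K, hK, orthoGL_val, orthoGL_inv, permMatrix_mul_mul,
      Matrix.submatrix_diagonal_equiv]
    congr 1
    funext k
    exact hsw l hl k
  · rw [transform_v, orthoGL_inv, Matrix.transpose_transpose]
    funext k
    rw [permMatrix_mulVec, hsw _ hv]

/-- The combination of the covariant symmetric tensors built from `D` with coefficients `α`, `β`. -/
def combination (α : Fin d → ℝ) (β : Fin d → Fin d → ℝ) (D : PointData d) :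
    Matrix (Fin d) (Fin d) ℝ :=
  (∑ m : Fin d, α m • (D.g * D.K ^ (m : ℕ)))
    + ∑ l : Fin d, ∑ m : Fin d, β l m •
        Matrix.vecMulVec (D.v ᵥ* D.K ^ (l : ℕ)) (D.v ᵥ* D.K ^ (m : ℕ))

theorem combination_transform (α : Fin d → ℝ) (β : Fin d → Fin d → ℝ) (D : PointData d)
    (A : GL (Fin d) ℝ) : combination α β (D.transform A) =
      ((A⁻¹ : GL (Fin d) ℝ) : Matrix (Fin d) (Fin d) ℝ)ᵀ * combination α β D *
      ((A⁻¹ : GL (Fin d) ℝ) : Matrix (Fin d) (Fin d) ℝ) := by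
  have h1 : ∀ m : ℕ, (D.transform A).g * (D.transform A).K ^ m =
      ((A⁻¹ : GL (Fin d) ℝ) : Matrix (Fin d) (Fin d) ℝ)ᵀ * (D.g * D.K ^ m) *
      ((A⁻¹ : GL (Fin d) ℝ) : Matrix (Fin d) (Fin d) ℝ) := by
    intro m
    rw [transform_g, transform_K, Units.conj_pow]
    simp only [Matrix.mul_assoc]
    rw [Units.inv_mul_cancel_left]
  have h2 : ∀ m : ℕ, (D.transform A).v ᵥ* (D.transform A).K ^ m =
      (D.v ᵥ* D.K ^ m) ᵥ* ((A⁻¹ : GL (Fin d) ℝ) : Matrix (Fin d) (Fin d) ℝ) := by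
    intro m
    rw [transform_v, transform_K, Units.conj_pow, Matrix.mulVec_transpose, Matrix.vecMul_vecMul,
      Matrix.vecMul_vecMul, Matrix.mul_assoc, Units.inv_mul_cancel_left]
  have h3 : ∀ (M : Matrix (Fin d) (Fin d) ℝ) (a b : Fin d → ℝ),
      Matrix.vecMulVec (a ᵥ* M) (b ᵥ* M) = Mᵀ * Matrix.vecMulVec a b * M := by
    intro M a b
    rw [Matrix.mul_vecMulVec, Matrix.vecMulVec_mul, Matrix.mulVec_transpose]
  simp only [combination, h1, h2, h3, Matrix.mul_add, Matrix.add_mul, Matrix.mul_sum,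
    Matrix.sum_mul, Matrix.mul_smul, Matrix.smul_mul]

/-- A bilinear form invariant under the stabilizer of `D` is a covariant combination. -/
theorem exists_combination {D : PointData d} (hD : D ∈ singularPointData d)
    (M : Matrix (Fin d) (Fin d) ℝ)
    (hM : ∀ A : GL (Fin d) ℝ, D.transform A = D →
      ((A⁻¹ : GL (Fin d) ℝ) : Matrix (Fin d) (Fin d) ℝ)ᵀ * M *
      ((A⁻¹ : GL (Fin d) ℝ) : Matrix (Fin d) (Fin d) ℝ) = M) :
    ∃ (α : Fin d → ℝ) (β : Fin d → Fin d → ℝ), M = combination α β D := by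
  classical
  obtain ⟨A, l, hg, hK, hn⟩ := exists_transform_normal hD
  set D₁ := D.transform A with hD₁
  set N := ((A⁻¹ : GL (Fin d) ℝ) : Matrix (Fin d) (Fin d) ℝ)ᵀ * M *
      ((A⁻¹ : GL (Fin d) ℝ) : Matrix (Fin d) (Fin d) ℝ) with hN
  have hMN : M = (A : Matrix (Fin d) (Fin d) ℝ)ᵀ * N * (A : Matrix (Fin d) (Fin d) ℝ) := by
    have h1 : (A : Matrix (Fin d) (Fin d) ℝ)ᵀ *
        ((A⁻¹ : GL (Fin d) ℝ) : Matrix (Fin d) (Fin d) ℝ)ᵀ = 1 := by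
      rw [← Matrix.transpose_mul, Units.inv_mul, Matrix.transpose_one]
    rw [hN, Matrix.mul_assoc, Matrix.mul_assoc, Matrix.mul_assoc, Units.inv_mul, Matrix.mul_one,
      ← Matrix.mul_assoc, h1, Matrix.one_mul]
  have hinv : ∀ B : GL (Fin d) ℝ, D₁.transform B = D₁ →
      ((B⁻¹ : GL (Fin d) ℝ) : Matrix (Fin d) (Fin d) ℝ)ᵀ * N *
      ((B⁻¹ : GL (Fin d) ℝ) : Matrix (Fin d) (Fin d) ℝ) = N := by
    intro B hB
    have h2 := hM (A⁻¹ * (B * A)) (by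
      rw [← transform_transform, ← transform_transform, ← hD₁, hB, hD₁, transform_inv_transform])
    simp only [mul_inv_rev, inv_inv, Units.val_mul, Matrix.transpose_mul] at h2
    have h3 : ((A⁻¹ : GL (Fin d) ℝ) : Matrix (Fin d) (Fin d) ℝ)ᵀ *
        (A : Matrix (Fin d) (Fin d) ℝ)ᵀ = 1 := by
      rw [← Matrix.transpose_mul, Units.mul_inv, Matrix.transpose_one]
    conv_rhs => rw [hN, ← h2]
    rw [hN]
    simp only [Matrix.mul_assoc, Units.mul_inv, Matrix.mul_one]
    rw [← Matrix.mul_assoc _ (A : Matrix (Fin d) (Fin d) ℝ)ᵀ, h3, Matrix.one_mul]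
  -- Axes on which `v` vanishes can be reflected, and permuted within an eigenspace, without
  -- changing the data; `N` inherits these symmetries.
  have hoff : ∀ i j, i ≠ j → D₁.v i * D₁.v j = 0 → N i j = 0 := by
    intro i j hij h0
    rcases mul_eq_zero.1 h0 with h | h
    · have := hinv _ (transform_flip hg hK h)
      rw [orthoGL_inv, Matrix.transpose_transpose, flip_transpose] at this
      exact (apply_eq_zero_of_flip this hij.symm).2
    · have := hinv _ (transform_flip hg hK h)
      rw [orthoGL_inv, Matrix.transpose_transpose, flip_transpose] at this
      exact (apply_eq_zero_of_flip this hij).1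
  have hdiag : ∀ i j, l i = l j → D₁.v i = 0 → D₁.v j = 0 → N i i = N j j := by
    intro i j hl hi hj
    have := hinv _ (transform_swap hg hK hl (hi.trans hj.symm))
    rw [orthoGL_inv, Matrix.transpose_transpose, permMatrix_mul_mul] at this
    have h4 := congrFun (congrFun this j) j
    rw [Matrix.submatrix_apply, Equiv.swap_apply_right] at h4
    exact h4
  set a : ℝ → ℝ := fun x =>
    if h : ∃ i, l i = x ∧ D₁.v i = 0 then N h.choose h.choose else 0 with ha
  have ha' : ∀ i, D₁.v i = 0 → a (l i) = N i i := by
    intro i hi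
    have hex : ∃ j, l j = l i ∧ D₁.v j = 0 := ⟨i, rfl, hi⟩
    simp only [ha, dif_pos hex]
    exact hdiag _ _ hex.choose_spec.1 hex.choose_spec.2 hi
  obtain ⟨α, hα⟩ := exists_coeff_interpolate l a
  choose e he using fun i : Fin d =>
    exists_coeff_interpolate l (fun x => if x = l i then 1 else 0)
  -- `b i j` is the coefficient of the product of the projections of `v` to the eigenspaces of
  -- `l i` and `l j`; it vanishes unless `v i` and `v j` are non-zero, by the convention `x / 0 = 0`.
  set b : Fin d → Fin d → ℝ := fun i j =>
    (N i j - if i = j then a (l i) else 0) / (D₁.v i * D₁.v j) with hb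
  refine ⟨α, fun p q => ∑ i, ∑ j, b i j * (e i p * e j q), ?_⟩
  have hcomb : combination α (fun p q => ∑ i, ∑ j, b i j * (e i p * e j q)) D₁ = N := by
    ext x y
    have hpow : ∀ m : ℕ, D₁.K ^ m = Matrix.diagonal fun i => l i ^ m := by
      intro m
      rw [hK, Matrix.diagonal_pow]
      rfl
    have hv : ∀ m : ℕ, D₁.v ᵥ* D₁.K ^ m = fun i => D₁.v i * l i ^ m := by
      intro m
      funext i
      rw [hpow, Matrix.vecMul_diagonal]
    have hfirst : (∑ m : Fin d, α m • (D₁.g * D₁.K ^ (m : ℕ))) x y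
        = if x = y then a (l x) else 0 := by
      rw [Matrix.sum_apply, ← hα x]
      simp only [hg, Matrix.one_mul, hpow, Matrix.smul_apply, Matrix.diagonal_apply, smul_eq_mul]
      split_ifs <;> simp
    have hsecond : (∑ p : Fin d, ∑ q : Fin d, (∑ i, ∑ j, b i j * (e i p * e j q)) •
        Matrix.vecMulVec (D₁.v ᵥ* D₁.K ^ (p : ℕ)) (D₁.v ᵥ* D₁.K ^ (q : ℕ))) x y
        = ∑ i, ∑ j, b i j * ((if l x = l i then 1 else 0) * (if l y = l j then 1 else 0)) *
          (D₁.v x * D₁.v y) := by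
      have h5 : ∀ i j, b i j * ((if l x = l i then 1 else 0) * (if l y = l j then 1 else 0)) *
          (D₁.v x * D₁.v y) = ∑ p : Fin d, ∑ q : Fin d, b i j * (e i p * e j q) *
            (D₁.v x * l x ^ (p : ℕ) * (D₁.v y * l y ^ (q : ℕ))) := by
        intro i j
        rw [← he i x, ← he j y, Finset.sum_mul_sum]
        simp only [Finset.mul_sum, Finset.sum_mul]
        refine Finset.sum_congr rfl fun p _ => Finset.sum_congr rfl fun q _ => ?_
        ring
      simp only [h5]
      simp only [Matrix.sum_apply, Matrix.smul_apply, smul_eq_mul, hv, Matrix.vecMulVec_apply,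
        Finset.sum_mul]
      calc _ = ∑ p, ∑ i, ∑ q : Fin d, ∑ j, b i j * (e i p * e j q) *
            (D₁.v x * l x ^ (p : ℕ) * (D₁.v y * l y ^ (q : ℕ))) :=
            Finset.sum_congr rfl fun p _ => Finset.sum_comm
        _ = ∑ i, ∑ p, ∑ q : Fin d, ∑ j, b i j * (e i p * e j q) *
            (D₁.v x * l x ^ (p : ℕ) * (D₁.v y * l y ^ (q : ℕ))) := Finset.sum_comm
        _ = ∑ i, ∑ p, ∑ j, ∑ q : Fin d, b i j * (e i p * e j q) *
            (D₁.v x * l x ^ (p : ℕ) * (D₁.v y * l y ^ (q : ℕ))) :=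
            Finset.sum_congr rfl fun i _ => Finset.sum_congr rfl fun p _ => Finset.sum_comm
        _ = _ := Finset.sum_congr rfl fun i _ => Finset.sum_comm
    rw [combination, Matrix.add_apply, hfirst, hsecond]
    by_cases h0 : D₁.v x * D₁.v y = 0
    · simp only [h0, mul_zero, Finset.sum_const_zero, add_zero]
      split_ifs with hxy
      · subst hxy
        exact ha' x (mul_self_eq_zero.1 h0)
      · exact (hoff x y hxy h0).symm
    · have hx := left_ne_zero_of_mul h0
      have hy := right_ne_zero_of_mul h0
      have hzero : ∀ i j, (i ≠ x ∨ j ≠ y) → b i j * ((if l x = l i then 1 else 0) *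
          (if l y = l j then 1 else 0)) * (D₁.v x * D₁.v y) = 0 := by
        intro i j hij
        by_cases h6 : l x = l i ∧ l y = l j ∧ D₁.v i * D₁.v j ≠ 0
        · obtain ⟨h7, h8, h9⟩ := h6
          have e1 := hn x i h7 hx (left_ne_zero_of_mul h9)
          have e2 := hn y j h8 hy (right_ne_zero_of_mul h9)
          rcases hij with hij | hij
          · exact absurd e1.symm hij
          · exact absurd e2.symm hij
        · by_cases h7 : l x = l i
          · by_cases h8 : l y = l j
            · have h9 : D₁.v i * D₁.v j = 0 := by
                by_contra h9; exact h6 ⟨h7, h8, h9⟩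
              simp [hb, h9]
            · simp [h8]
          · simp [h7]
      rw [Finset.sum_eq_single x, Finset.sum_eq_single y]
      · simp only [hb, if_true]
        field_simp
        ring
      · intro j _ hj
        exact hzero x j (Or.inr hj)
      · simp
      · intro i _ hi
        exact Finset.sum_eq_zero fun j _ => hzero i j (Or.inl hi)
      · simp
  -- Transform the identity back from the normal form.
  have hback := combination_transform α (fun p q => ∑ i, ∑ j, b i j * (e i p * e j q)) D₁ A⁻¹
  rw [hD₁, transform_inv_transform, ← hD₁, inv_inv, hcomb, ← hMN] at hback
  exact hback.symm

/-- The outgoing metric of a covariant map is a covariant combination of the incoming data: the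
coefficients are chosen on one representative of each orbit. -/
theorem isCovariantCombination_of_isCovariant (hd : 0 < d) {S : PointData d → PointData d}
    (hcov : IsCovariant S) : IsCovariantCombination (fun D => (S D).g) := by
  classical
  have hex : ∀ (t : Fin (d - 1) → ℝ) (u : Fin d → ℝ),
      ∃ (α : Fin d → ℝ) (β : Fin d → Fin d → ℝ),
      ∀ D ∈ singularPointData d, D.tau = t → D.upsilon = u → (S D).g = combination α β D := by
    intro t u
    by_cases h : ∃ D ∈ singularPointData d, D.tau = t ∧ D.upsilon = u
    · obtain ⟨D, hD, rfl, rfl⟩ := h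
      obtain ⟨α, β, hαβ⟩ := exists_combination hD (S D).g (by
        intro A hA
        have := hcov A D hD
        rw [hA] at this
        conv_rhs => rw [this]
        rfl)
      refine ⟨α, β, fun D' hD' ht hu => ?_⟩
      obtain ⟨A, rfl⟩ := exists_transform_eq hd hD hD' ht.symm hu.symm
      rw [hcov A D hD, combination_transform, ← hαβ]
      rfl
    · exact ⟨0, 0, fun D hD ht hu => absurd ⟨D, hD, ht, hu⟩ h⟩
  choose α β hαβ using hex
  refine ⟨fun m t u => α t u m, fun l m t u => β t u l m, fun D hD => ?_⟩
  exact hαβ _ _ D hD rfl rfl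

end Combination

end PointData

namespace PointData

variable {d : ℕ}

/-! ### Components of differentiable fields -/

section Components

/-- The component `g_{ij}` as a linear functional of the data. -/
noncomputable def gEntry (i j : Fin d) : PointData d →L[ℝ] ℝ :=
  LinearMap.toContinuousLinearMap
    { toFun := fun D => D.g i j
      map_add' := fun _ _ => rfl
      map_smul' := fun _ _ => rfl }

/-- The component `K^i_j` as a linear functional of the data. -/
noncomputable def KEntry (i j : Fin d) : PointData d →L[ℝ] ℝ :=
  LinearMap.toContinuousLinearMap
    { toFun := fun D => D.K i j
      map_add' := fun _ _ => rfl
      map_smul' := fun _ _ => rfl }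

variable {X : Type*} [NormedAddCommGroup X] [NormedSpace ℝ X] {Φ : X → PointData d}
  {Φ' : X →L[ℝ] PointData d} {x : X}

theorem hasFDerivAt_g (h : HasFDerivAt Φ Φ' x) (i j : Fin d) :
    HasFDerivAt (fun y => (Φ y).g i j) ((gEntry i j).comp Φ') x :=
  (gEntry i j).hasFDerivAt.comp x h

theorem hasFDerivAt_K (h : HasFDerivAt Φ Φ' x) (i j : Fin d) :
    HasFDerivAt (fun y => (Φ y).K i j) ((KEntry i j).comp Φ') x :=
  (KEntry i j).hasFDerivAt.comp x h

theorem Kring_apply (D : PointData d) (i j : Fin d) :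
    D.Kring i j = D.K i j - (1 / (d : ℝ)) * (1 : Matrix (Fin d) (Fin d) ℝ) i j := rfl

theorem K_eq (D : PointData d) : D.K = (1 / (d : ℝ)) • 1 + D.Kring := by
  rw [Kring]; abel

theorem hasFDerivAt_Kring (h : HasFDerivAt Φ Φ' x) (i j : Fin d) :
    HasFDerivAt (fun y => (Φ y).Kring i j) ((KEntry i j).comp Φ') x :=
  (hasFDerivAt_K h i j).sub_const _

theorem pderiv_g {Φ : (Fin d → ℝ) → PointData d} {Φ' : (Fin d → ℝ) →L[ℝ] PointData d}
    {x : Fin d → ℝ} (h : HasFDerivAt Φ Φ' x) (c i j : Fin d) :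
    pderiv c (fun y => (Φ y).g i j) x = (Φ' (Pi.single c 1)).g i j := by
  rw [pderiv, (hasFDerivAt_g h i j).fderiv]
  rfl

end Components

theorem trace_Kring (hd : 0 < d) {D : PointData d} (h : D.K.trace = 1) : D.Kring.trace = 0 := by
  have hd' : (d : ℝ) ≠ 0 := by exact_mod_cast hd.ne'
  rw [Kring, Matrix.trace_sub, Matrix.trace_smul, Matrix.trace_one, h]
  simp [hd']

theorem trace_K_mul_K (hd : 0 < d) {D : PointData d} (h : D.Kring.trace = 0) :
    (D.K * D.K).trace = 1 / d + (D.Kring * D.Kring).trace := by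
  have hd' : (d : ℝ) ≠ 0 := by exact_mod_cast hd.ne'
  rw [K_eq D]
  simp only [Matrix.add_mul, Matrix.mul_add, Matrix.smul_mul, Matrix.mul_smul, Matrix.one_mul,
    Matrix.mul_one, Matrix.trace_add, Matrix.trace_smul, h, Matrix.trace_one, smul_eq_mul,
    Fintype.card_fin]
  field_simp
  ring

end PointData

open PointData

/-! ### Conformal covariance of the divergence -/

section Divergence

variable {d : ℕ}

theorem metric_deriv_isSymm {U : Set (Fin d → ℝ)} (hU : IsOpen U) {Φ : (Fin d → ℝ) → PointData d}
    (hadm : ∀ x ∈ U, (Φ x).IsAdmissible) {x : Fin d → ℝ} (hx : x ∈ U) (a : Fin d) :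
    (Matrix.of fun i j => pderiv a (fun y => (Φ y).g i j) x).IsSymm := by
  ext i j
  simp only [Matrix.transpose_apply, Matrix.of_apply, pderiv]
  congr 1
  refine Filter.EventuallyEq.fderiv_eq ?_
  filter_upwards [hU.mem_nhds hx] with y hy
  exact (isSymm_of_posDef (hadm y hy).posDef).apply i j

/-- `divergence_eq` for the metric and the curvature of a field of admissible data. -/
theorem divergence_of_admissible {U : Set (Fin d → ℝ)} (hU : IsOpen U)
    {Φ : (Fin d → ℝ) → PointData d} (hadm : ∀ x ∈ U, (Φ x).IsAdmissible) {x : Fin d → ℝ}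
    (hx : x ∈ U) (b : Fin d) :
    divergence (fun y => (Φ y).g) (fun y => (Φ y).K) b x =
      (∑ a, pderiv a (fun y => (Φ y).Kring a b) x)
      + 1 / 2 * ∑ c, ((Φ x).g⁻¹ * Matrix.of fun i j => pderiv c (fun y => (Φ y).g i j) x).trace
          * (Φ x).Kring c b
      - 1 / 2 * ((Φ x).Kring *
          ((Φ x).g⁻¹ * Matrix.of fun i j => pderiv b (fun y => (Φ y).g i j) x)).trace := by
  rw [divergence_eq (fun a => Matrix.of fun i j => pderiv a (fun y => (Φ y).g i j) x) (Φ x).Kring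
    (fun a i j => rfl) (fun a => metric_deriv_isSymm hU hadm hx a)
    (isSymm_of_posDef (hadm x hx).posDef) (isUnit_det_of_posDef (hadm x hx).posDef)
    (hadm x hx).symm (1 / d) (K_eq _) b]
  congr 3
  funext a
  simp only [pderiv, Kring_apply, fderiv_sub_const]

/-- The divergence of a traceless symmetric tensor is conformally covariant with weight `-d`: if
`g` is replaced by `s g` and `K̊` by `γ s^(-d/2) K̊`, the divergence is multiplied by
`γ s^(-d/2)`. -/
theorem divergence_conformal {U : Set (Fin d → ℝ)} (hU : IsOpen U)
    {Φ Ψ : (Fin d → ℝ) → PointData d} (hΦ : ∀ x ∈ U, (Φ x).IsAdmissible)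
    (hΨ : ∀ x ∈ U, (Ψ x).IsAdmissible) {x : Fin d → ℝ} (hx : x ∈ U)
    (hdΦ : DifferentiableAt ℝ Φ x) (hd : 0 < d) (γ : ℝ) {s : (Fin d → ℝ) → ℝ}
    (hs : DifferentiableAt ℝ s x) (hpos : ∀ y, 0 < s y)
    (hg : ∀ y ∈ U, (Ψ y).g = s y • (Φ y).g)
    (hk : ∀ y ∈ U, (Ψ y).Kring = (γ * s y ^ (-(d / 2 : ℝ))) • (Φ y).Kring) (b : Fin d) :
    divergence (fun y => (Ψ y).g) (fun y => (Ψ y).K) b x =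
      γ * s x ^ (-(d / 2 : ℝ)) * divergence (fun y => (Φ y).g) (fun y => (Φ y).K) b x := by
  have hs0 : s x ≠ 0 := (hpos x).ne'
  set u := γ * s x ^ (-(d / 2 : ℝ)) with hu
  set G : Fin d → Matrix (Fin d) (Fin d) ℝ :=
    fun c => Matrix.of fun i j => pderiv c (fun y => (Φ y).g i j) x with hG
  set σ : Fin d → ℝ := fun c => pderiv c s x with hσ
  have e1 : ∀ c, (Matrix.of fun i j => pderiv c (fun y => (Ψ y).g i j) x)
      = σ c • (Φ x).g + s x • G c := by
    intro c
    ext i j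
    have h1 : (fun y => (Ψ y).g i j) =ᶠ[nhds x] fun y => s y * (Φ y).g i j := by
      filter_upwards [hU.mem_nhds hx] with y hy
      rw [hg y hy]; rfl
    simp only [Matrix.of_apply, pderiv, h1.fderiv_eq, Matrix.add_apply, Matrix.smul_apply, hσ, hG,
      smul_eq_mul]
    have h3 : HasFDerivAt (fun y => s y * (Φ y).g i j) _ x :=
      hs.hasFDerivAt.mul (hasFDerivAt_g hdΦ.hasFDerivAt i j)
    rw [h3.fderiv,
      (hasFDerivAt_g hdΦ.hasFDerivAt i j).fderiv]
    simp only [add_apply, smul_apply, smul_eq_mul]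
    ring
  have e2 : ∀ a, pderiv a (fun y => (Ψ y).Kring a b) x =
      -(d / 2) * u * (σ a / s x) * (Φ x).Kring a b
        + u * pderiv a (fun y => (Φ y).Kring a b) x := by
    intro a
    have h1 : (fun y => (Ψ y).Kring a b) =ᶠ[nhds x]
        fun y => (γ * s y ^ (-(d / 2 : ℝ))) * (Φ y).Kring a b := by
      filter_upwards [hU.mem_nhds hx] with y hy
      rw [hk y hy]; rfl
    have h2 := (hs.hasFDerivAt.rpow_const (p := -(d / 2 : ℝ)) (Or.inl hs0)).const_mul γ
    have h3 : HasFDerivAt (fun y => (γ * s y ^ (-(d / 2 : ℝ))) * (Φ y).Kring a b) _ x :=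
      h2.mul (hasFDerivAt_Kring hdΦ.hasFDerivAt a b)
    simp only [pderiv, h1.fderiv_eq, hσ]
    rw [h3.fderiv, (hasFDerivAt_Kring hdΦ.hasFDerivAt a b).fderiv]
    simp only [add_apply, smul_apply, smul_eq_mul, hu, Real.rpow_sub_one hs0]
    field_simp
    ring
  have hinv : (Ψ x).g⁻¹ = (s x)⁻¹ • (Φ x).g⁻¹ := by
    rw [hg x hx]
    refine Matrix.inv_eq_left_inv ?_
    rw [Matrix.smul_mul, Matrix.mul_smul, smul_smul, inv_mul_cancel₀ hs0, one_smul,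
      Matrix.nonsing_inv_mul _ (isUnit_det_of_posDef (hΦ x hx).posDef)]
  have e3 : ∀ c, (Ψ x).g⁻¹ * (Matrix.of fun i j => pderiv c (fun y => (Ψ y).g i j) x)
      = (σ c / s x) • 1 + (Φ x).g⁻¹ * G c := by
    intro c
    rw [e1, hinv, Matrix.mul_add, Matrix.smul_mul, Matrix.mul_smul, Matrix.smul_mul,
      Matrix.mul_smul, Matrix.nonsing_inv_mul _ (isUnit_det_of_posDef (hΦ x hx).posDef), smul_smul,
      smul_smul, inv_mul_cancel₀ hs0, one_smul, div_eq_inv_mul]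
  have htr := trace_Kring hd (hΦ x hx).trace_eq
  rw [divergence_of_admissible hU hΦ hx, divergence_of_admissible hU hΨ hx, hk x hx, ← hu]
  simp only [e2, e3, Matrix.trace_add, Matrix.trace_smul, Matrix.trace_one, Matrix.smul_mul,
    Matrix.mul_add, Matrix.mul_smul, Matrix.mul_one, htr, Finset.sum_add_distrib, smul_eq_mul,
    add_mul, mul_zero, zero_add, Fintype.card_fin, Matrix.smul_apply]
  have h4 : ∑ a, -(d / 2) * u * (σ a / s x) * (Φ x).Kring a b
      = -(1 / 2 * ∑ c, σ c / s x * d * (u * (Φ x).Kring c b)) := by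
    rw [Finset.mul_sum, ← Finset.sum_neg_distrib]
    exact Finset.sum_congr rfl fun a _ => by ring
  have h5 : ∑ c, ((Φ x).g⁻¹ * G c).trace * (u * (Φ x).Kring c b)
      = u * ∑ c, ((Φ x).g⁻¹ * G c).trace * (Φ x).Kring c b := by
    rw [Finset.mul_sum]
    exact Finset.sum_congr rfl fun a _ => by ring
  rw [h4, h5, ← Finset.mul_sum]
  ring

end Divergence

/-! ### Isotropic and anisotropic maps preserve the constraints -/

section Sufficiency

variable {d : ℕ} {S : PointData d → PointData d}

theorem mem_singularPointData_of_satisfies {U : Set (Fin d → ℝ)} {Φ : (Fin d → ℝ) → PointData d}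
    (h : SatisfiesConstraints U Φ) {x : Fin d → ℝ} (hx : x ∈ U) : Φ x ∈ singularPointData d :=
  ⟨h.admissible x hx, h.hamiltonian x hx⟩

theorem differentiableAt_comp (hdiff : DifferentiableOn ℝ S (singularPointData d))
    {X : Type*} [NormedAddCommGroup X] [NormedSpace ℝ X] {U : Set X} (hU : IsOpen U)
    {Φ : X → PointData d} (hΦ : ∀ x ∈ U, Φ x ∈ singularPointData d) {x : X} (hx : x ∈ U)
    (hd : DifferentiableAt ℝ Φ x) : DifferentiableAt ℝ (fun y => S (Φ y)) x :=
  ((hdiff (Φ x) (hΦ x hx)).comp x hd.differentiableWithinAt hΦ).differentiableAt (hU.mem_nhds hx)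

theorem IsIsotropic.preservesConstraints (hd : 0 < d) (hS : IsIsotropic S) :
    PreservesConstraints S := by
  intro U hU Φ _ hC
  have hd' : (d : ℝ) ≠ 0 := by exact_mod_cast hd.ne'
  have hmem := fun x (hx : x ∈ U) => mem_singularPointData_of_satisfies hC hx
  have hK : ∀ x ∈ U, (S (Φ x)).K = (1 / (d : ℝ)) • 1 := by
    intro x hx
    rw [K_eq, hS.kring _ (hmem x hx), add_zero]
  have hadm : ∀ x ∈ U, (S (Φ x)).IsAdmissible := by
    intro x hx
    refine ⟨hS.posDef _ (hmem x hx), ?_, ?_, ?_⟩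
    · rw [hK x hx, Matrix.trace_smul, Matrix.trace_one]
      simp [hd']
    · rw [hK x hx, Matrix.mul_smul, Matrix.mul_one]
      exact (isSymm_of_posDef (hS.posDef _ (hmem x hx))).smul _
    · rw [hS.dens _ (hmem x hx)]
      have : (1 : ℝ) ≤ d := by exact_mod_cast hd
      exact div_nonneg (by linarith) (by linarith)
  refine ⟨hadm, ?_, ?_⟩
  · intro x hx
    rw [Hamiltonian, hK x hx, hS.dens _ (hmem x hx)]
    simp only [Matrix.smul_mul, Matrix.one_mul, Matrix.trace_smul, Matrix.trace_one,
      Fintype.card_fin, smul_eq_mul]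
    field_simp
  · intro x hx b
    rw [divergence_of_admissible hU hadm hx, hS.vel _ (hmem x hx), hS.kring _ (hmem x hx)]
    have h1 : ∀ a, pderiv a (fun y => (S (Φ y)).Kring a b) x = 0 := by
      intro a
      have h2 : (fun y => (S (Φ y)).Kring a b) =ᶠ[nhds x] fun _ => (0 : ℝ) := by
        filter_upwards [hU.mem_nhds hx] with y hy
        rw [hS.kring _ (hmem y hy)]; rfl
      rw [pderiv, h2.fderiv_eq]
      simp
    simp [h1]

theorem IsAnisotropic.preservesConstraints (hd : 0 < d)
    (hdiff : DifferentiableOn ℝ S (singularPointData d)) (hS : IsAnisotropic S) :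
    PreservesConstraints S := by
  obtain ⟨γ, ω, -, hω, hS⟩ := hS
  intro U hU Φ hΦ hC
  have hd' : (d : ℝ) ≠ 0 := by exact_mod_cast hd.ne'
  have hmem := fun x (hx : x ∈ U) => mem_singularPointData_of_satisfies hC hx
  set s : (Fin d → ℝ) → ℝ := fun y => (ω (Φ y).tau (Φ y).upsilon) ^ (2 / (d : ℝ)) with hs
  have hpos : ∀ y, 0 < s y := fun y => Real.rpow_pos_of_pos (hω _ _) _
  have hsω : ∀ y, s y ^ (-(d / 2 : ℝ)) = (ω (Φ y).tau (Φ y).upsilon)⁻¹ := by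
    intro y
    rw [hs, ← Real.rpow_mul (hω _ _).le, ← Real.rpow_neg_one]
    congr 1
    field_simp
  have hg : ∀ y ∈ U, (S (Φ y)).g = s y • (Φ y).g := fun y hy => hS.metric _ (hmem y hy)
  have hk : ∀ y ∈ U, (S (Φ y)).Kring = (γ * s y ^ (-(d / 2 : ℝ))) • (Φ y).Kring := by
    intro y hy
    rw [hS.kring _ (hmem y hy), hsω]
  have htr : ∀ y ∈ U, (S (Φ y)).Kring.trace = 0 := by
    intro y hy
    rw [hk y hy, Matrix.trace_smul, trace_Kring hd (hC.admissible y hy).trace_eq, smul_zero]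
  have hadm : ∀ y ∈ U, (S (Φ y)).IsAdmissible := by
    intro y hy
    refine ⟨?_, ?_, ?_, hS.nonneg _ (hmem y hy)⟩
    · rw [hg y hy]
      exact (hC.admissible y hy).posDef.smul (hpos y)
    · rw [K_eq, Matrix.trace_add, htr y hy, Matrix.trace_smul, Matrix.trace_one]
      simp [hd']
    · have h1 : (Φ y).g.IsSymm := isSymm_of_posDef (hC.admissible y hy).posDef
      have h2 : ((Φ y).g * (Φ y).Kring).IsSymm := by
        rw [Kring, Matrix.mul_sub, Matrix.mul_smul, Matrix.mul_one]
        exact (hC.admissible y hy).symm.sub (h1.smul _)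
      rw [K_eq (S (Φ y)), hg y hy, hk y hy, Matrix.mul_add, Matrix.mul_smul, Matrix.mul_one,
        Matrix.smul_mul, Matrix.mul_smul]
      exact ((h1.smul _).smul _).add ((h2.smul _).smul _)
  refine ⟨hadm, ?_, ?_⟩
  · intro y hy
    have h1 := hS.dens _ (hmem y hy)
    have h2 := hC.hamiltonian y hy
    rw [Hamiltonian, trace_K_mul_K hd (trace_Kring hd (hC.admissible y hy).trace_eq)] at h2
    rw [Hamiltonian, trace_K_mul_K hd (htr y hy), hS.kring _ (hmem y hy)]
    simp only [Matrix.smul_mul, Matrix.mul_smul, Matrix.trace_smul, smul_eq_mul]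
    have h3 : (Φ y).μ = (1 - (1 / d + ((Φ y).Kring * (Φ y).Kring).trace)) / 2 := by linarith
    have h4 : (S (Φ y)).μ = ((d : ℝ) - 1) / (2 * d) -
      γ ^ 2 * ((ω (Φ y).tau (Φ y).upsilon) ^ 2)⁻¹ * (((d : ℝ) - 1) / (2 * d) - (Φ y).μ) := by
      linarith
    have h5 := (hω (Φ y).tau (Φ y).upsilon).ne'
    rw [h4, h3]
    field_simp
    ring
  · intro x hx b
    have hdΦ : DifferentiableAt ℝ Φ x :=
      (hΦ.contDiffAt (hU.mem_nhds hx)).differentiableAt (by simp)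
    have hdS := differentiableAt_comp hdiff hU hmem hx hdΦ
    have hsd : DifferentiableAt ℝ s x := by
      -- `ω` is not assumed to be differentiable, but the conformal factor is a quotient of
      -- components.
      set p : Fin d := ⟨0, hd⟩
      have hgp : ∀ y ∈ U, 0 < (Φ y).g p p := fun y hy => (hC.admissible y hy).posDef.diag_pos
      have h0 : DifferentiableAt ℝ (fun y => (S (Φ y)).g p p) x :=
        (hasFDerivAt_g hdS.hasFDerivAt p p).differentiableAt
      have h0' : DifferentiableAt ℝ (fun y => (Φ y).g p p) x :=
        (hasFDerivAt_g hdΦ.hasFDerivAt p p).differentiableAt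
      have h1 := h0.mul (h0'.inv (hgp x hx).ne')
      refine h1.congr_of_eventuallyEq ?_
      filter_upwards [hU.mem_nhds hx] with y hy
      change s y = (S (Φ y)).g p p * ((Φ y).g p p)⁻¹
      rw [hg y hy, Matrix.smul_apply, smul_eq_mul, mul_inv_cancel_right₀ (hgp y hy).ne']
    rw [divergence_conformal hU hC.admissible hadm hx hdΦ hd γ hsd hpos hg hk b,
      hC.momentum x hx b, hsω]
    have h6 := congrFun (hS.momentum _ (hmem x hx)) b
    simp only [Pi.smul_apply, smul_eq_mul] at h6
    rw [mul_assoc 2 (S (Φ x)).μ, h6]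
    ring

end Sufficiency

/-! ### Traceless symmetric matrices -/

section TracelessSymmetric

/-- The space of traceless symmetric matrices. -/
def tracelessSymm (d : ℕ) : Submodule ℝ (Matrix (Fin d) (Fin d) ℝ) where
  carrier := {k | k.IsSymm ∧ k.trace = 0}
  add_mem' := fun ha hb => ⟨ha.1.add hb.1, by rw [Matrix.trace_add, ha.2, hb.2, add_zero]⟩
  zero_mem' := ⟨Matrix.isSymm_zero, Matrix.trace_zero _ _⟩
  smul_mem' := fun c k hk => ⟨hk.1.smul c, by rw [Matrix.trace_smul, hk.2, smul_zero]⟩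

namespace tracelessSymm

variable {d : ℕ}

theorem isSymm (k : tracelessSymm d) : (k : Matrix (Fin d) (Fin d) ℝ).IsSymm := k.2.1

theorem trace_eq (k : tracelessSymm d) : (k : Matrix (Fin d) (Fin d) ℝ).trace = 0 := k.2.2

/-- The matrix entries as linear functionals on the traceless symmetric matrices. -/
noncomputable def entry (i j : Fin d) : tracelessSymm d →L[ℝ] ℝ :=
  LinearMap.toContinuousLinearMap
    { toFun := fun k => (k : Matrix (Fin d) (Fin d) ℝ) i j
      map_add' := fun _ _ => rfl
      map_smul' := fun _ _ => rfl }

theorem entry_apply (i j : Fin d) (k : tracelessSymm d) :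
    entry i j k = (k : Matrix (Fin d) (Fin d) ℝ) i j := rfl

/-- A row of a traceless symmetric matrix can be prescribed arbitrarily. -/
theorem exists_row (hd : 2 ≤ d) (i : Fin d) (w : Fin d → ℝ) :
    ∃ B : tracelessSymm d, ∀ b, (B : Matrix (Fin d) (Fin d) ℝ) i b = w b := by
  obtain ⟨f, hf⟩ : ∃ f : Fin d, f ≠ i := by
    have : Nontrivial (Fin d) := Fin.nontrivial_iff_two_le.2 hd
    exact exists_ne i
  refine ⟨⟨Matrix.of fun a b => if a = i then w b else if b = i then w a else
    if a = f ∧ b = f then -w i else 0, ?_, ?_⟩, ?_⟩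
  · ext a b
    simp only [Matrix.transpose_apply, Matrix.of_apply, and_comm (a := b = f)]
    by_cases ha : a = i <;> by_cases hb : b = i <;> simp [ha, hb]
  · have h1 : ∀ a, (if a = i then w a else if a = i then w a else
        if a = f ∧ a = f then -w i else 0) = (if a = i then w i else 0) +
          (if a = f then -w i else 0) := by
      intro a
      by_cases ha : a = i
      · subst ha; simp [hf.symm]
      · simp [ha]
    simp only [Matrix.trace, Matrix.diag, Matrix.of_apply, h1, Finset.sum_add_distrib,
      Finset.sum_ite_eq', Finset.mem_univ, if_true]
    ring
  · intro b
    simp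

/-- The density `μ` determined by the reduced Hamiltonian constraint. -/
noncomputable def density (k : tracelessSymm d) : ℝ :=
  (1 - 1 / d - ((k : Matrix (Fin d) (Fin d) ℝ) * (k : Matrix (Fin d) (Fin d) ℝ)).trace) / 2

theorem contDiff_density {n : WithTop ℕ∞} : ContDiff ℝ n (density (d := d)) := by
  have h : (density (d := d)) = fun k => (1 - 1 / d - ∑ i, ∑ j, entry i j k * entry j i k) / 2 := by
    funext k
    simp only [density, Matrix.trace, Matrix.diag, Matrix.mul_apply, entry_apply]
  rw [h]
  fun_prop

end tracelessSymm

end TracelessSymmetric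

open tracelessSymm

/-! ### Test fields in orthonormal frames -/

section OrthonormalData

variable {d : ℕ}

/-- Pointwise data in an orthonormal frame with positive density, parametrized by the traceless
part `k` of the extrinsic curvature and by the momentum density `p = 2 μ v`. -/
noncomputable def orthoData (z : tracelessSymm d × (Fin d → ℝ)) : PointData d :=
  (1, (1 / (d : ℝ)) • 1 + (z.1 : Matrix (Fin d) (Fin d) ℝ), density z.1,
    (2 * density z.1)⁻¹ • z.2)

/-- The parameters of data with positive density. -/
def positiveRegion (d : ℕ) : Set (tracelessSymm d × (Fin d → ℝ)) := {z | 0 < density z.1}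

theorem isOpen_positiveRegion : IsOpen (positiveRegion d) :=
  isOpen_lt continuous_const ((contDiff_density (n := 0)).continuous.comp continuous_fst)

theorem orthoData_g (z : tracelessSymm d × (Fin d → ℝ)) : (orthoData z).g = 1 := rfl

theorem orthoData_K (z : tracelessSymm d × (Fin d → ℝ)) :
    (orthoData z).K = (1 / (d : ℝ)) • 1 + (z.1 : Matrix (Fin d) (Fin d) ℝ) := rfl

theorem orthoData_Kring (z : tracelessSymm d × (Fin d → ℝ)) :
    (orthoData z).Kring = z.1 := by
  rw [PointData.Kring, orthoData_K]; abel

theorem orthoData_μ (z : tracelessSymm d × (Fin d → ℝ)) : (orthoData z).μ = density z.1 := rfl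

theorem orthoData_v (z : tracelessSymm d × (Fin d → ℝ)) :
    (orthoData z).v = (2 * density z.1)⁻¹ • z.2 := rfl

theorem orthoData_mem (hd : 0 < d) {z : tracelessSymm d × (Fin d → ℝ)}
    (hz : z ∈ positiveRegion d) : orthoData z ∈ singularPointData d := by
  have hd' : (d : ℝ) ≠ 0 := by exact_mod_cast hd.ne'
  refine ⟨⟨?_, ?_, ?_, le_of_lt hz⟩, ?_⟩
  · rw [orthoData_g]; exact Matrix.PosDef.one
  · rw [orthoData_K, Matrix.trace_add, trace_eq z.1, Matrix.trace_smul, Matrix.trace_one]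
    simp [hd']
  · rw [orthoData_g, Matrix.one_mul, orthoData_K]
    exact (Matrix.isSymm_one.smul _).add (isSymm z.1)
  · rw [PointData.Hamiltonian, trace_K_mul_K hd (by rw [orthoData_Kring, trace_eq z.1]),
      orthoData_Kring, orthoData_μ, density]
    ring

theorem contDiffOn_orthoData {n : WithTop ℕ∞} : ContDiffOn ℝ n orthoData (positiveRegion d) := by
  have h1 : ContDiff ℝ n fun z : tracelessSymm d × (Fin d → ℝ) => density z.1 :=
    contDiff_density.comp contDiff_fst
  have h2 : ContDiff ℝ n fun z : tracelessSymm d × (Fin d → ℝ) =>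
      (1 / (d : ℝ)) • (1 : Matrix (Fin d) (Fin d) ℝ) + (z.1 : Matrix (Fin d) (Fin d) ℝ) :=
    contDiff_const.add ((tracelessSymm d).subtypeL.contDiff.comp contDiff_fst)
  have h3 : ContDiffOn ℝ n (fun z : tracelessSymm d × (Fin d → ℝ) =>
      (2 * density z.1)⁻¹ • z.2) (positiveRegion d) :=
    ((contDiff_const.mul h1).contDiffOn.inv fun z hz =>
      (mul_pos two_pos hz).ne').smul contDiff_snd.contDiffOn
  exact contDiffOn_const.prodMk (h2.contDiffOn.prodMk (h1.contDiffOn.prodMk h3))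

/-- Fields in which the one-jet at the origin of `k` and `p` can be prescribed, subject only to the
momentum constraint `∂_a k_{ab} = p_b` at the origin: a second-order term in `k` corrects for the
prescribed derivative of `p`, so that the constraint holds everywhere. -/
theorem exists_field (hd : 2 ≤ d) (z : tracelessSymm d × (Fin d → ℝ))
    (Y : Fin d → tracelessSymm d × (Fin d → ℝ))
    (hY : ∀ b, ∑ a, ((Y a).1 : Matrix (Fin d) (Fin d) ℝ) a b = z.2 b) :
    ∃ ψ : (Fin d → ℝ) → tracelessSymm d × (Fin d → ℝ), ContDiff ℝ (⊤ : ℕ∞) ψ ∧ ψ 0 = z ∧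
      (∃ ψ' : (Fin d → ℝ) →L[ℝ] tracelessSymm d × (Fin d → ℝ), HasFDerivAt ψ ψ' 0 ∧
        ∀ a, ψ' (Pi.single a 1) = Y a) ∧
      ∀ x b, ∑ a, pderiv a (fun y => ((ψ y).1 : Matrix (Fin d) (Fin d) ℝ) a b) x = (ψ x).2 b := by
  choose B hB using fun c => exists_row hd c (Y c).2
  set k : (Fin d → ℝ) → tracelessSymm d :=
    fun x => z.1 + ∑ c, (x c • (Y c).1 + (x c ^ 2 / 2) • B c) with hk
  set p : (Fin d → ℝ) → (Fin d → ℝ) := fun x => z.2 + ∑ c, x c • (Y c).2 with hp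
  have hk' : ∀ x, ∃ k' : (Fin d → ℝ) →L[ℝ] tracelessSymm d, HasFDerivAt k k' x ∧
      ∀ a, k' (Pi.single a 1) = (Y a).1 + x a • B a := by
    intro x
    have h1 : ∀ c, HasFDerivAt (fun x : Fin d → ℝ => x c) (ContinuousLinearMap.proj c) x :=
      fun c => (ContinuousLinearMap.proj (R := ℝ) (φ := fun _ : Fin d => ℝ) c).hasFDerivAt
    have h2 : ∀ c, HasFDerivAt (fun x : Fin d → ℝ => x c ^ 2 / 2)
        (x c • (ContinuousLinearMap.proj c : (Fin d → ℝ) →L[ℝ] ℝ)) x := by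
      intro c
      have h3 : HasDerivAt (fun t : ℝ => t ^ 2 / 2) (x c) (x c) := by
        simpa using (hasDerivAt_pow 2 (x c)).div_const 2
      exact h3.comp_hasFDerivAt x (h1 c)
    refine ⟨∑ c, ((ContinuousLinearMap.proj (R := ℝ) (φ := fun _ : Fin d => ℝ) c).smulRight (Y c).1
        + (x c • ContinuousLinearMap.proj (R := ℝ) (φ := fun _ : Fin d => ℝ) c).smulRight (B c)),
      (HasFDerivAt.fun_sum fun c _ =>
        ((h1 c).smul_const (Y c).1).fun_add ((h2 c).smul_const (B c))).const_add z.1, fun a => ?_⟩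
    rw [sum_apply]
    rw [Finset.sum_eq_single a]
    · simp
    · intro c _ hc
      simp [hc]
    · simp
  have hp' : ∃ p' : (Fin d → ℝ) →L[ℝ] (Fin d → ℝ), HasFDerivAt p p' 0 ∧
      ∀ a, p' (Pi.single a 1) = (Y a).2 := by
    have h1 : ∀ c, HasFDerivAt (fun x : Fin d → ℝ => x c) (ContinuousLinearMap.proj c) 0 :=
      fun c => (ContinuousLinearMap.proj (R := ℝ) (φ := fun _ : Fin d => ℝ) c).hasFDerivAt
    refine ⟨_, (HasFDerivAt.fun_sum fun c _ =>
      (h1 c).smul_const (Y c).2).const_add z.2, fun a => ?_⟩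
    rw [sum_apply]
    rw [Finset.sum_eq_single a]
    · simp
    · intro c _ hc
      simp [hc]
    · simp
  refine ⟨fun x => (k x, p x), ?_, ?_, ?_, ?_⟩
  · refine ContDiff.prodMk ?_ ?_
    · refine contDiff_const.add (ContDiff.sum fun c _ => ContDiff.add ?_ ?_)
      · exact (contDiff_apply ℝ ℝ c).smul contDiff_const
      · exact (((contDiff_apply ℝ ℝ c).pow 2).div_const 2).smul contDiff_const
    · exact contDiff_const.add (ContDiff.sum fun c _ => (contDiff_apply ℝ ℝ c).smul contDiff_const)
  · simp [hk, hp]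
  · obtain ⟨k', h1, h2⟩ := hk' 0
    obtain ⟨p', h3, h4⟩ := hp'
    refine ⟨k'.prod p', h1.prodMk h3, fun a => ?_⟩
    rw [ContinuousLinearMap.prod_apply, h2, h4]
    simp
  · intro x b
    obtain ⟨k', h1, h2⟩ := hk' x
    have h3 : ∀ a, pderiv a (fun y => (k y : Matrix (Fin d) (Fin d) ℝ) a b) x
        = ((Y a).1 : Matrix (Fin d) (Fin d) ℝ) a b + x a * (Y a).2 b := by
      intro a
      have h4 : HasFDerivAt (fun y => (k y : Matrix (Fin d) (Fin d) ℝ) a b)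
        ((entry a b).comp k') x := (entry a b).hasFDerivAt.comp x h1
      rw [pderiv, h4.fderiv, ContinuousLinearMap.comp_apply, h2, entry_apply, ← hB a b]
      rfl
    simp only [h3, Finset.sum_add_distrib, hY, hp, Pi.add_apply, Finset.sum_apply, Pi.smul_apply,
      smul_eq_mul]

/-- In an orthonormal coordinate frame the metric is flat, and the momentum constraint is
`∂_a k_{ab} = p_b`. -/
theorem satisfiesConstraints_orthoData (hd : 0 < d)
    {ψ : (Fin d → ℝ) → tracelessSymm d × (Fin d → ℝ)} (hψ : ContDiff ℝ (⊤ : ℕ∞) ψ)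
    (h : ∀ x b, ∑ a, pderiv a (fun y => ((ψ y).1 : Matrix (Fin d) (Fin d) ℝ) a b) x = (ψ x).2 b) :
    SatisfiesConstraints (ψ ⁻¹' positiveRegion d) (fun x => orthoData (ψ x)) := by
  have hU : IsOpen (ψ ⁻¹' positiveRegion d) := isOpen_positiveRegion.preimage hψ.continuous
  have hadm : ∀ x ∈ ψ ⁻¹' positiveRegion d, (orthoData (ψ x)).IsAdmissible :=
    fun x hx => (orthoData_mem hd hx).1
  refine ⟨hadm, fun x hx => (orthoData_mem hd hx).2, fun x hx b => ?_⟩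
  rw [divergence_of_admissible hU hadm hx]
  have h0 : ∀ c, (Matrix.of fun i j => pderiv c (fun y => (orthoData (ψ y)).g i j) x) = 0 := by
    intro c
    ext i j
    simp only [orthoData_g, pderiv, Matrix.of_apply]
    simp
  have hx' : density (ψ x).1 ≠ 0 := (show 0 < density (ψ x).1 from hx).ne'
  simp only [h0, Matrix.trace_zero, zero_mul, Finset.sum_const_zero, mul_zero,
    add_zero, sub_zero, orthoData_Kring, h, orthoData_μ, orthoData_v, Pi.smul_apply, smul_eq_mul]
  field_simp

end OrthonormalData

/-! ### The outgoing constraint as a condition on one-jets -/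

section Jets

variable {d : ℕ} {S : PointData d → PointData d}

/-- A solution `H` of the constraint `∂_c k_{cb} = p_b` on jets that only varies in the direction
`a`. -/
theorem exists_jet (hd : 2 ≤ d) (p : Fin d → ℝ) (a : Fin d) : ∃ H : Fin d → tracelessSymm d,
    (∀ b, ∑ c, (H c : Matrix (Fin d) (Fin d) ℝ) c b = p b) ∧ ∀ c, c ≠ a → H c = 0 := by
  obtain ⟨B, hB⟩ := exists_row hd a p
  refine ⟨Pi.single a B, fun b => ?_, fun c hc => Pi.single_eq_of_ne hc _⟩
  rw [Finset.sum_eq_single a]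
  · rw [Pi.single_eq_same, hB]
  · intro c _ hc
    rw [Pi.single_eq_of_ne hc]
    rfl
  · simp

/-- Pointwise data with positive density belong to a singular data set, whose image is admissible. -/
theorem map_orthoData_mem (hd : 2 ≤ d) (hS : PreservesConstraints S)
    {z : tracelessSymm d × (Fin d → ℝ)} (hz : z ∈ positiveRegion d) :
    S (orthoData z) ∈ singularPointData d := by
  obtain ⟨H, hH, -⟩ := exists_jet hd z.2 ⟨0, by omega⟩
  obtain ⟨ψ, hψ, h0, -, hdiv⟩ := exists_field hd z (fun a => (H a, 0)) hH
  have hU : IsOpen (ψ ⁻¹' positiveRegion d) := isOpen_positiveRegion.preimage hψ.continuous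
  have h0' : (0 : Fin d → ℝ) ∈ ψ ⁻¹' positiveRegion d := by rwa [Set.mem_preimage, h0]
  have h1 := hS _ hU (fun x => orthoData (ψ x))
    (contDiffOn_orthoData.comp hψ.contDiffOn (fun x hx => hx))
    (satisfiesConstraints_orthoData (by omega) hψ hdiv)
  have h2 := mem_singularPointData_of_satisfies h1 h0'
  simpa only [h0] using h2

theorem differentiableAt_map_orthoData (hd : 0 < d)
    (hdiff : DifferentiableOn ℝ S (singularPointData d))
    {z : tracelessSymm d × (Fin d → ℝ)} (hz : z ∈ positiveRegion d) :
    DifferentiableAt ℝ (fun y => S (orthoData y)) z :=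
  differentiableAt_comp hdiff isOpen_positiveRegion (fun _ hy => orthoData_mem hd hy) hz
    ((contDiffOn_orthoData (n := 1)).contDiffAt (isOpen_positiveRegion.mem_nhds hz)
      |>.differentiableAt one_ne_zero)

/-- The momentum constraint of the outgoing data, as an identity between the values and the
derivatives of the map at a point, for each admissible one-jet of the incoming data. -/
theorem momentum_jet (hd : 2 ≤ d)
    (hS : PreservesConstraints S) {z : tracelessSymm d × (Fin d → ℝ)} (hz : z ∈ positiveRegion d)
    {T' : tracelessSymm d × (Fin d → ℝ) →L[ℝ] PointData d}
    (hT' : HasFDerivAt (fun y => S (orthoData y)) T' z)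
    (Y : Fin d → tracelessSymm d × (Fin d → ℝ))
    (hY : ∀ b, ∑ a, ((Y a).1 : Matrix (Fin d) (Fin d) ℝ) a b = z.2 b) (b : Fin d) :
    (∑ a, (T' (Y a)).K a b)
      + 1 / 2 * ∑ c, ((S (orthoData z)).g⁻¹ * (T' (Y c)).g).trace * (S (orthoData z)).Kring c b
      - 1 / 2 * ((S (orthoData z)).Kring * ((S (orthoData z)).g⁻¹ * (T' (Y b)).g)).trace
      = 2 * (S (orthoData z)).μ * (S (orthoData z)).v b := by
  obtain ⟨ψ, hψ, h0, ⟨ψ', hψ', hY'⟩, hdiv⟩ := exists_field hd z Y hY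
  have hU : IsOpen (ψ ⁻¹' positiveRegion d) := isOpen_positiveRegion.preimage hψ.continuous
  have h0' : (0 : Fin d → ℝ) ∈ ψ ⁻¹' positiveRegion d := by rwa [Set.mem_preimage, h0]
  have h1 := hS _ hU (fun x => orthoData (ψ x))
    (contDiffOn_orthoData.comp hψ.contDiffOn (fun x hx => hx))
    (satisfiesConstraints_orthoData (by omega) hψ hdiv)
  have h2 := h1.momentum 0 h0' b
  have hcomp : HasFDerivAt (fun x => S (orthoData (ψ x))) (T'.comp ψ') 0 := by
    rw [← h0] at hT'
    exact hT'.comp 0 hψ'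
  rw [divergence_of_admissible hU h1.admissible h0'] at h2
  have hg : ∀ c, (Matrix.of fun i j => pderiv c (fun y => (S (orthoData (ψ y))).g i j) 0)
      = (T' (Y c)).g := by
    intro c
    ext i j
    rw [Matrix.of_apply, pderiv_g hcomp, ContinuousLinearMap.comp_apply, hY']
  have hK : ∀ a, pderiv a (fun y => (S (orthoData (ψ y))).Kring a b) 0 = (T' (Y a)).K a b := by
    intro a
    rw [pderiv, (hasFDerivAt_Kring hcomp a b).fderiv, ← hY']
    rfl
  simp only [hg, hK, h0] at h2
  exact h2

end Jets

/-! ### Test directions and the orthogonal action -/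

section TracelessSymmetricElements

namespace tracelessSymm

variable {d : ℕ}

/-- The diagonal traceless matrix with diagonal `l`. -/
def diag (l : Fin d → ℝ) (hl : ∑ i, l i = 0) : tracelessSymm d :=
  ⟨Matrix.diagonal l, Matrix.isSymm_diagonal l, by rw [Matrix.trace_diagonal, hl]⟩

theorem coe_diag (l : Fin d → ℝ) (hl : ∑ i, l i = 0) :
    (diag l hl : Matrix (Fin d) (Fin d) ℝ) = Matrix.diagonal l := rfl

/-- The diagonal matrix with entries `1` at `i` and `-1` at `j`. -/
def diagPair (i j : Fin d) : tracelessSymm d :=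
  diag (fun a => (if a = i then 1 else 0) - if a = j then 1 else 0) (by simp)

/-- The symmetric matrix with entries `1` at `(i, j)` and `(j, i)`. -/
def offDiag {i j : Fin d} (hij : i ≠ j) : tracelessSymm d :=
  ⟨Matrix.of fun a b => (if a = i ∧ b = j then 1 else 0) + if a = j ∧ b = i then 1 else 0, by
    ext a b
    simp only [Matrix.transpose_apply, Matrix.of_apply, and_comm (b := a = i),
      and_comm (b := a = j)]
    ring, by
    refine Finset.sum_eq_zero fun a _ => ?_
    have h1 : ¬ (a = i ∧ a = j) := fun h => hij (h.1.symm.trans h.2)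
    have h2 : ¬ (a = j ∧ a = i) := fun h => hij (h.2.symm.trans h.1)
    simp [h1, h2]⟩

theorem coe_diagPair (i j : Fin d) : (diagPair i j : Matrix (Fin d) (Fin d) ℝ) =
    Matrix.diagonal fun a => (if a = i then 1 else 0) - if a = j then 1 else 0 := rfl

theorem offDiag_apply {i j : Fin d} (hij : i ≠ j) (a b : Fin d) :
    (offDiag hij : Matrix (Fin d) (Fin d) ℝ) a b =
      (if a = i ∧ b = j then 1 else 0) + if a = j ∧ b = i then 1 else 0 := rfl

theorem trace_mul_self (k : tracelessSymm d) :
    ((k : Matrix (Fin d) (Fin d) ℝ) * (k : Matrix (Fin d) (Fin d) ℝ)).trace =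
      ∑ i, ∑ j, (k : Matrix (Fin d) (Fin d) ℝ) i j ^ 2 := by
  simp only [Matrix.trace, Matrix.diag, Matrix.mul_apply]
  refine Finset.sum_congr rfl fun i _ => Finset.sum_congr rfl fun j _ => ?_
  rw [(isSymm k).apply i j, sq]

theorem convex_density_pos : Convex ℝ {k : tracelessSymm d | 0 < density k} := by
  intro x hx y hy a b ha hb hab
  simp only [Set.mem_ofPred_eq, density, trace_mul_self] at hx hy ⊢
  have h1 : ∑ i, ∑ j, ((a • x + b • y : tracelessSymm d) : Matrix (Fin d) (Fin d) ℝ) i j ^ 2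
      ≤ a * ∑ i, ∑ j, (x : Matrix (Fin d) (Fin d) ℝ) i j ^ 2
        + b * ∑ i, ∑ j, (y : Matrix (Fin d) (Fin d) ℝ) i j ^ 2 := by
    simp only [Finset.mul_sum, ← Finset.sum_add_distrib]
    refine Finset.sum_le_sum fun i _ => Finset.sum_le_sum fun j _ => ?_
    change (a * (x : Matrix (Fin d) (Fin d) ℝ) i j + b * (y : Matrix (Fin d) (Fin d) ℝ) i j) ^ 2 ≤ _
    obtain rfl : b = 1 - a := by linarith
    nlinarith [mul_nonneg (mul_nonneg ha hb)
      (sq_nonneg ((x : Matrix (Fin d) (Fin d) ℝ) i j - (y : Matrix (Fin d) (Fin d) ℝ) i j))]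
  have hx' : ∑ i, ∑ j, (x : Matrix (Fin d) (Fin d) ℝ) i j ^ 2 < 1 - 1 / d := by linarith
  have hy' : ∑ i, ∑ j, (y : Matrix (Fin d) (Fin d) ℝ) i j ^ 2 < 1 - 1 / d := by linarith
  have h2 : a * ∑ i, ∑ j, (x : Matrix (Fin d) (Fin d) ℝ) i j ^ 2
        + b * ∑ i, ∑ j, (y : Matrix (Fin d) (Fin d) ℝ) i j ^ 2 < 1 - 1 / d :=
    (convex_Iio (𝕜 := ℝ) (1 - 1 / (d : ℝ))) hx' hy' ha hb hab
  linarith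

theorem density_zero_pos (hd : 2 ≤ d) : 0 < density (0 : tracelessSymm d) := by
  have h2 : (2 : ℝ) ≤ d := by exact_mod_cast hd
  have h1 : 1 / (d : ℝ) ≤ 1 / 2 := one_div_le_one_div_of_le two_pos h2
  simp only [density, ZeroMemClass.coe_zero, Matrix.zero_mul, Matrix.trace_zero]
  linarith

/-- The action of an orthogonal change of frame. -/
def conj (O : Matrix (Fin d) (Fin d) ℝ) (hO : O * Oᵀ = 1) (k : tracelessSymm d) :
    tracelessSymm d :=
  ⟨O * k * Oᵀ, by
    rw [Matrix.IsSymm, Matrix.transpose_mul, Matrix.transpose_mul, Matrix.transpose_transpose,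
      (isSymm k).eq, Matrix.mul_assoc], by
    rw [Matrix.trace_mul_comm, ← Matrix.mul_assoc, mul_eq_one_comm.1 hO, Matrix.one_mul,
      trace_eq]⟩

theorem coe_conj (O : Matrix (Fin d) (Fin d) ℝ) (hO : O * Oᵀ = 1) (k : tracelessSymm d) :
    (conj O hO k : Matrix (Fin d) (Fin d) ℝ) = O * k * Oᵀ := rfl

theorem conj_add_smul (O : Matrix (Fin d) (Fin d) ℝ) (hO : O * Oᵀ = 1) (k X : tracelessSymm d)
    (t : ℝ) : conj O hO (k + t • X) = conj O hO k + t • conj O hO X := by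
  ext1
  change O * ((k : Matrix (Fin d) (Fin d) ℝ) + t • (X : Matrix (Fin d) (Fin d) ℝ)) * Oᵀ =
    O * (k : Matrix (Fin d) (Fin d) ℝ) * Oᵀ + t • (O * (X : Matrix (Fin d) (Fin d) ℝ) * Oᵀ)
  rw [Matrix.mul_add, Matrix.add_mul, Matrix.mul_smul, Matrix.smul_mul]

theorem density_conj (O : Matrix (Fin d) (Fin d) ℝ) (hO : O * Oᵀ = 1) (k : tracelessSymm d) :
    density (conj O hO k) = density k := by
  have h : O * (k : Matrix (Fin d) (Fin d) ℝ) * Oᵀ * (O * (k : Matrix (Fin d) (Fin d) ℝ) * Oᵀ) =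
      O * ((k : Matrix (Fin d) (Fin d) ℝ) * (k : Matrix (Fin d) (Fin d) ℝ)) * Oᵀ := by
    simp only [Matrix.mul_assoc]
    rw [← Matrix.mul_assoc Oᵀ O, mul_eq_one_comm.1 hO, Matrix.one_mul]
  rw [density, density, coe_conj, h, Matrix.trace_mul_comm, ← Matrix.mul_assoc,
    mul_eq_one_comm.1 hO, Matrix.one_mul]

theorem exists_conj_diagonal (k : tracelessSymm d) :
    ∃ (O : Matrix (Fin d) (Fin d) ℝ) (hO : O * Oᵀ = 1) (l : Fin d → ℝ) (hl : ∑ i, l i = 0),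
      conj O hO k = diag l hl := by
  obtain ⟨O, l, hO, h⟩ := exists_ortho_diagonal (isSymm k)
  have hl : ∑ i, l i = 0 := by
    have h1 := trace_eq (conj O hO k)
    rwa [coe_conj, h, Matrix.trace_diagonal] at h1
  exact ⟨O, hO, l, hl, Subtype.ext h⟩

end tracelessSymm

end TracelessSymmetricElements

/-! ### The outgoing curvature density -/

section OutgoingDensity

variable {d : ℕ} {S : PointData d → PointData d}

/-- The outgoing traceless curvature as a tensor density, `√(det g⁺) K̊⁺`. -/
noncomputable def outDensity (S : PointData d → PointData d)
    (z : tracelessSymm d × (Fin d → ℝ)) : Matrix (Fin d) (Fin d) ℝ :=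
  √(S (orthoData z)).g.det • (S (orthoData z)).Kring

theorem orthoData_conj (O : Matrix (Fin d) (Fin d) ℝ) (hO : O * Oᵀ = 1)
    (z : tracelessSymm d × (Fin d → ℝ)) :
    orthoData (conj O hO z.1, O *ᵥ z.2) = (orthoData z).transform (orthoGL O hO) := by
  refine ext_of ?_ ?_ ?_ ?_
  · rw [transform_g, orthoData_g, orthoData_g, orthoGL_inv, Matrix.mul_one,
      Matrix.transpose_transpose, hO]
  · rw [transform_K, orthoData_K, orthoData_K, orthoGL_inv, orthoGL_val, coe_conj, Matrix.mul_add,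
      Matrix.mul_smul, Matrix.mul_one, Matrix.add_mul, Matrix.smul_mul, hO]
  · exact density_conj O hO z.1
  · rw [transform_v, orthoData_v, orthoData_v, density_conj, orthoGL_inv,
      Matrix.transpose_transpose, Matrix.mulVec_smul]

theorem map_g_conj (hd : 0 < d) (hcov : IsCovariant S) (O : Matrix (Fin d) (Fin d) ℝ)
    (hO : O * Oᵀ = 1) {z : tracelessSymm d × (Fin d → ℝ)} (hz : z ∈ positiveRegion d) :
    (S (orthoData (conj O hO z.1, O *ᵥ z.2))).g = O * (S (orthoData z)).g * Oᵀ := by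
  rw [orthoData_conj, hcov _ _ (orthoData_mem hd hz), transform_g, orthoGL_inv,
    Matrix.transpose_transpose]

theorem outDensity_conj (hd : 0 < d) (hcov : IsCovariant S) (O : Matrix (Fin d) (Fin d) ℝ)
    (hO : O * Oᵀ = 1) {z : tracelessSymm d × (Fin d → ℝ)} (hz : z ∈ positiveRegion d) :
    outDensity S (conj O hO z.1, O *ᵥ z.2) = O * outDensity S z * Oᵀ := by
  have hdet : O.det * Oᵀ.det = 1 := by rw [← Matrix.det_mul, hO, Matrix.det_one]
  rw [outDensity, map_g_conj hd hcov O hO hz, orthoData_conj, hcov _ _ (orthoData_mem hd hz),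
    transform_Kring, orthoGL_inv, orthoGL_val, outDensity, Matrix.mul_smul, Matrix.smul_mul,
    Matrix.det_mul, Matrix.det_mul, mul_comm O.det, mul_assoc, hdet, mul_one]

/-- In an eigenframe of `k` and for `v = 0`, the reflections of the axes fix the incoming data, so
that the outgoing curvature is diagonal as well. -/
theorem outDensity_diag_apply (hd : 0 < d) (hcov : IsCovariant S) {l : Fin d → ℝ}
    (hl : ∑ i, l i = 0) (hz : 0 < density (diag l hl)) {i j : Fin d} (hij : i ≠ j) :
    outDensity S (diag l hl, 0) i j = 0 := by
  have hz' : ((diag l hl, 0) : tracelessSymm d × (Fin d → ℝ)) ∈ positiveRegion d := hz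
  have hc : conj (PointData.flip j) (flip_mul_transpose j) (diag l hl) = diag l hl := by
    ext a b
    rw [coe_conj, coe_diag, flip_transpose, flip_conj_apply, Matrix.diagonal_apply]
    split_ifs <;> simp_all
  have h := outDensity_conj hd hcov (PointData.flip j) (flip_mul_transpose j) hz'
  rw [Matrix.mulVec_zero, hc, flip_transpose] at h
  exact (apply_eq_zero_of_flip h.symm hij).1

theorem outDensity_isSymm (hd : 0 < d) (hcov : IsCovariant S) {k : tracelessSymm d}
    (hk : 0 < density k) : (outDensity S (k, 0)).IsSymm := by
  obtain ⟨O, hO, l, hl, h⟩ := exists_conj_diagonal k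
  have h1 := outDensity_conj hd hcov O hO (z := (k, 0)) hk
  rw [Matrix.mulVec_zero, h] at h1
  have hpos : 0 < density (diag l hl) := by rw [← h, density_conj]; exact hk
  have h2 : (outDensity S (diag l hl, 0)).IsSymm := by
    ext i j
    rw [Matrix.transpose_apply]
    by_cases hij : i = j
    · rw [hij]
    · rw [outDensity_diag_apply hd hcov hl hpos hij,
        outDensity_diag_apply hd hcov hl hpos (Ne.symm hij)]
  have h3 : outDensity S (k, 0) = Oᵀ * outDensity S (diag l hl, 0) * O := by
    rw [h1]
    simp only [Matrix.mul_assoc]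
    rw [mul_eq_one_comm.1 hO, ← Matrix.mul_assoc Oᵀ, mul_eq_one_comm.1 hO, Matrix.one_mul,
      Matrix.mul_one]
  rw [h3, Matrix.IsSymm, Matrix.transpose_mul, Matrix.transpose_mul, h2.eq,
    Matrix.transpose_transpose, Matrix.mul_assoc]

theorem outDensity_trace (hd : 2 ≤ d) (hS : PreservesConstraints S)
    {z : tracelessSymm d × (Fin d → ℝ)} (hz : z ∈ positiveRegion d) :
    (outDensity S z).trace = 0 := by
  rw [outDensity, Matrix.trace_smul,
    trace_Kring (by omega) (map_orthoData_mem hd hS hz).1.trace_eq, smul_zero]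

/-- The isotropy of the data `k = 0`, `v = 0` forces the outgoing traceless curvature to vanish. -/
theorem outDensity_zero (hd : 2 ≤ d) (hcov : IsCovariant S) (hS : PreservesConstraints S) :
    outDensity S (0, 0) = 0 := by
  have h0 : (0 : tracelessSymm d) = diag 0 (by simp) := by
    ext i j
    rw [coe_diag]
    simp
  have hz := density_zero_pos hd
  have hz' : ((0, 0) : tracelessSymm d × (Fin d → ℝ)) ∈ positiveRegion d := hz
  have hoff : ∀ i j, i ≠ j → outDensity S (0, 0) i j = 0 := by
    intro i j hij
    have := outDensity_diag_apply (S := S) (by omega) hcov (l := 0) (by simp) (h0 ▸ hz) hij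
    rwa [← h0] at this
  have hdiag : ∀ i j, outDensity S (0, 0) i i = outDensity S (0, 0) j j := by
    intro i j
    have hc : conj (permMatrix (Equiv.swap i j)) (permMatrix_mul_transpose _)
        (0 : tracelessSymm d) = 0 := by
      ext a b
      rw [coe_conj]
      simp
    have h := outDensity_conj (by omega) hcov (permMatrix (Equiv.swap i j))
      (permMatrix_mul_transpose _) hz'
    rw [Matrix.mulVec_zero, hc, permMatrix_mul_mul] at h
    have h1 := congrFun (congrFun h j) j
    rw [Matrix.submatrix_apply, Equiv.swap_apply_right] at h1
    exact h1.symm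
  have htr := outDensity_trace hd hS hz'
  ext i j
  by_cases hij : i = j
  · subst hij
    have h2 : (outDensity S (0, 0)).trace = d * outDensity S (0, 0) i i := by
      have h3 : ∀ a, (outDensity S (0, 0)).diag a = outDensity S (0, 0) i i := fun a => hdiag a i
      rw [Matrix.trace, Finset.sum_congr rfl fun a _ => h3 a]
      simp
    rw [htr] at h2
    have hd' : (d : ℝ) ≠ 0 := by
      have : d ≠ 0 := by omega
      exact_mod_cast this
    exact (mul_eq_zero.1 h2.symm).resolve_left hd'
  · exact hoff i j hij

/-- The derivative of the map in the parameters of the incoming data. -/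
noncomputable def mapDeriv (S : PointData d → PointData d) (z : tracelessSymm d × (Fin d → ℝ)) :
    tracelessSymm d × (Fin d → ℝ) →L[ℝ] PointData d := fderiv ℝ (fun y => S (orthoData y)) z

theorem hasFDerivAt_mapDeriv (hd : 0 < d) (hdiff : DifferentiableOn ℝ S (singularPointData d))
    {z : tracelessSymm d × (Fin d → ℝ)} (hz : z ∈ positiveRegion d) :
    HasFDerivAt (fun y => S (orthoData y)) (mapDeriv S z) z :=
  (differentiableAt_map_orthoData hd hdiff hz).hasFDerivAt

/-- The linear functional `½ √(det g⁺) tr (K̊⁺ (g⁺)⁻¹ δg⁺)` of the variation of the incoming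
data. -/
noncomputable def metricWork (S : PointData d → PointData d)
    (z : tracelessSymm d × (Fin d → ℝ)) : tracelessSymm d × (Fin d → ℝ) →ₗ[ℝ] ℝ where
  toFun Y := 1 / 2 * √(S (orthoData z)).g.det * ((S (orthoData z)).Kring *
    ((S (orthoData z)).g⁻¹ * (mapDeriv S z Y).g)).trace
  map_add' x y := by
    have h : (mapDeriv S z (x + y)).g =
      (mapDeriv S z x).g + (mapDeriv S z y).g := by
      rw [map_add]; rfl
    rw [h, Matrix.mul_add, Matrix.mul_add, Matrix.trace_add, mul_add]
  map_smul' c x := by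
    have h : (mapDeriv S z (c • x)).g =
      c • (mapDeriv S z x).g := by
      rw [map_smul]; rfl
    rw [h, Matrix.mul_smul, Matrix.mul_smul, Matrix.trace_smul, smul_eq_mul, smul_eq_mul,
      RingHom.id_apply]
    ring

theorem metricWork_apply (z Y : tracelessSymm d × (Fin d → ℝ)) : metricWork S z Y =
    1 / 2 * √(S (orthoData z)).g.det * ((S (orthoData z)).Kring *
    ((S (orthoData z)).g⁻¹ * (mapDeriv S z Y).g)).trace := rfl

theorem hasFDerivAt_sqrt_det_mul_Kring {X : Type*} [NormedAddCommGroup X] [NormedSpace ℝ X]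
    {Φ : X → PointData d} {Φ' : X →L[ℝ] PointData d} {x : X} (h : HasFDerivAt Φ Φ' x)
    (hdet : 0 < (Φ x).g.det) (i j : Fin d) : ∃ L : X →L[ℝ] ℝ,
      HasFDerivAt (fun y => √(Φ y).g.det * (Φ y).Kring i j) L x ∧
      ∀ Y, L Y = √(Φ x).g.det * (Φ' Y).K i j +
        1 / 2 * √(Φ x).g.det * (((Φ x).g⁻¹ * (Φ' Y).g).trace * (Φ x).Kring i j) := by
  have hg : HasFDerivAt (fun y => (Φ y).g) _ x := h.fst
  obtain ⟨r', hr, hr'⟩ := hasFDerivAt_sqrt_det hg hdet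
  have hr'' : ∀ Y, r' Y = 1 / 2 * √(Φ x).g.det * ((Φ x).g⁻¹ * (Φ' Y).g).trace := hr'
  refine ⟨_, hr.mul (hasFDerivAt_Kring h i j), fun Y => ?_⟩
  change √(Φ x).g.det * (Φ' Y).K i j + (Φ x).Kring i j * r' Y = _
  rw [hr'']
  ring

/-- The outgoing momentum constraint in terms of the density `√(det g⁺) K̊⁺`. -/
theorem exists_outDensity_deriv (hd : 2 ≤ d) (hdiff : DifferentiableOn ℝ S (singularPointData d))
    (hS : PreservesConstraints S) {z : tracelessSymm d × (Fin d → ℝ)} (hz : z ∈ positiveRegion d) :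
    ∃ Q' : Fin d → Fin d → tracelessSymm d × (Fin d → ℝ) →L[ℝ] ℝ,
      (∀ i j, HasFDerivAt (fun y => outDensity S y i j) (Q' i j) z) ∧
      (∀ Y, ∑ i, Q' i i Y = 0) ∧
      ∀ Y : Fin d → tracelessSymm d × (Fin d → ℝ),
        (∀ b, ∑ a, ((Y a).1 : Matrix (Fin d) (Fin d) ℝ) a b = z.2 b) →
        ∀ b, ∑ a, Q' a b (Y a) - metricWork S z (Y b) =
          2 * √(S (orthoData z)).g.det * (S (orthoData z)).μ * (S (orthoData z)).v b := by
  have hT := hasFDerivAt_mapDeriv (by omega) hdiff hz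
  have hmem := map_orthoData_mem hd hS hz
  have hdet : 0 < (S (orthoData z)).g.det := hmem.1.posDef.det_pos
  have key : ∀ i j, ∃ L : tracelessSymm d × (Fin d → ℝ) →L[ℝ] ℝ,
      HasFDerivAt (fun y => outDensity S y i j) L z ∧
      ∀ Y, L Y = √(S (orthoData z)).g.det * (mapDeriv S z Y).K i j +
        1 / 2 * √(S (orthoData z)).g.det * (((S (orthoData z)).g⁻¹ * (mapDeriv S z Y).g).trace *
          (S (orthoData z)).Kring i j) :=
    fun i j => hasFDerivAt_sqrt_det_mul_Kring hT hdet i j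
  choose Q' hQ hQ' using key
  refine ⟨Q', hQ, fun Y => ?_, fun Y hY b => ?_⟩
  · have h1 : HasFDerivAt (fun y => ∑ i, outDensity S y i i) (∑ i, Q' i i) z :=
      HasFDerivAt.fun_sum fun i (_ : i ∈ Finset.univ) => hQ i i
    have h2 : (fun y => ∑ i, outDensity S y i i) =ᶠ[nhds z] fun _ => (0 : ℝ) := by
      filter_upwards [isOpen_positiveRegion.mem_nhds hz] with y hy
      exact outDensity_trace hd hS hy
    have h3 := h1.unique ((hasFDerivAt_const (0 : ℝ) z).congr_of_eventuallyEq h2)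
    have h4 := congrArg (fun f : tracelessSymm d × (Fin d → ℝ) →L[ℝ] ℝ => f Y) h3
    simpa using h4
  · have h1 := momentum_jet hd hS hz hT Y hY b
    rw [metricWork_apply]
    simp only [hQ', Finset.sum_add_distrib, ← Finset.mul_sum]
    linear_combination √(S (orthoData z)).g.det * h1

end OutgoingDensity

/-! ### Linearity of the outgoing curvature density -/

section Rigidity

variable {d : ℕ} {S : PointData d → PointData d}

/-- The derivative of the outgoing density does not involve `v`, and acts on variations of `k`
through a matrix `θ` of Lagrange multipliers of the incoming momentum constraint. -/
theorem exists_lagrange_multiplier (hd : 2 ≤ d)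
    (hdiff : DifferentiableOn ℝ S (singularPointData d))
    (hS : PreservesConstraints S) {z : tracelessSymm d × (Fin d → ℝ)} (hz : z ∈ positiveRegion d) :
    ∃ (Q' : Fin d → Fin d → tracelessSymm d × (Fin d → ℝ) →L[ℝ] ℝ) (θ : Fin d → Fin d → ℝ),
      (∀ i j, HasFDerivAt (fun y => outDensity S y i j) (Q' i j) z) ∧
      (∀ Y, ∑ i, Q' i i Y = 0) ∧ (∀ i b w, Q' i b (0, w) = 0) ∧
      ∀ i b X, Q' i b (X, 0) = (if i = b then metricWork S z (X, 0) else 0) +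
        ∑ c, (X : Matrix (Fin d) (Fin d) ℝ) i c * θ c b := by
  obtain ⟨Q', hQ, htr, hjet⟩ := exists_outDensity_deriv hd hdiff hS hz
  set P := metricWork S z with hP
  set j₀ : Fin d := ⟨0, by omega⟩ with hj₀
  -- Subtract the constraints of two jets to remove the source terms.
  have hhom : ∀ Y : Fin d → tracelessSymm d × (Fin d → ℝ),
      (∀ b, ∑ a, ((Y a).1 : Matrix (Fin d) (Fin d) ℝ) a b = 0) →
      ∀ b, ∑ a, Q' a b (Y a) = P (Y b) := by
    intro Y hY b
    obtain ⟨H, hH, -⟩ := exists_jet hd z.2 j₀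
    have h1 := hjet (fun a => (H a, 0)) hH b
    have h2 := hjet (fun a => (H a, 0) + Y a) (fun b => by
      have h3 : ∀ a, (((H a, 0) + Y a : tracelessSymm d × (Fin d → ℝ)).1 :
          Matrix (Fin d) (Fin d) ℝ) a b = (H a : Matrix (Fin d) (Fin d) ℝ) a b +
            ((Y a).1 : Matrix (Fin d) (Fin d) ℝ) a b := fun a => rfl
      rw [Finset.sum_congr rfl fun a _ => h3 a, Finset.sum_add_distrib, hH, hY, add_zero]) b
    simp only [map_add, Finset.sum_add_distrib] at h2
    linarith
  -- The variation of `v` is unconstrained, so it can be placed in a single direction; the trace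
  -- condition then excludes the remaining multiple of the identity.
  have hw : ∀ i b w, Q' i b (0, w) = 0 := by
    intro i b w
    have h1 : ∀ i b, Q' i b (0, w) = if i = b then P (0, w) else 0 := by
      intro i b
      have h2 := hhom (Pi.single i (0, w)) (fun b => by
        refine Finset.sum_eq_zero fun a _ => ?_
        by_cases h : a = i
        · subst h; rw [Pi.single_eq_same]; rfl
        · rw [Pi.single_eq_of_ne h]; rfl) b
      rw [Finset.sum_eq_single i (fun a _ ha => by rw [Pi.single_eq_of_ne ha, map_zero])
        (by simp), Pi.single_eq_same] at h2
      rw [h2]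
      split_ifs with h
      · subst h; rw [Pi.single_eq_same]
      · rw [Pi.single_eq_of_ne (Ne.symm h), map_zero]
    have h3 := htr (0, w)
    simp only [h1, if_true, Finset.sum_const, Finset.card_univ, Fintype.card_fin,
      nsmul_eq_mul] at h3
    have hd' : (d : ℝ) ≠ 0 := by
      have : d ≠ 0 := by omega
      exact_mod_cast this
    rw [h1, (mul_eq_zero.1 h3).resolve_left hd', ite_self]
  -- The divergence of a jet `X` in the direction `i` is the row `X i`. It is compensated by a jet in
  -- the fixed direction `j₀` with the same row there, built from the matrices `B c` with row `e_c`.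
  choose B hB using fun c : Fin d => exists_row hd j₀ (Pi.single c 1)
  refine ⟨Q', fun c b => Q' j₀ b (B c, 0) - if j₀ = b then P (B c, 0) else 0, hQ, htr, hw, ?_⟩
  intro i b X
  set X' : tracelessSymm d := ∑ c, (X : Matrix (Fin d) (Fin d) ℝ) i c • B c with hX'
  have hrow : ∀ b, (X' : Matrix (Fin d) (Fin d) ℝ) j₀ b = (X : Matrix (Fin d) (Fin d) ℝ) i b := by
    intro b
    rw [← entry_apply j₀ b X', hX', map_sum]
    simp only [map_smul, entry_apply, hB, smul_eq_mul]
    rw [Finset.sum_eq_single b]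
    · simp
    · intro c _ hc; simp [Pi.single_eq_of_ne (Ne.symm hc)]
    · simp
  have hsingle : ∀ (i : Fin d) (X : tracelessSymm d) b,
      ∑ a, (((Pi.single i (X, 0) : Fin d → tracelessSymm d × (Fin d → ℝ)) a).1 :
        Matrix (Fin d) (Fin d) ℝ) a b = (X : Matrix (Fin d) (Fin d) ℝ) i b := by
    intro i X b
    rw [Finset.sum_eq_single i (fun a _ ha => by rw [Pi.single_eq_of_ne ha]; rfl) (by simp),
      Pi.single_eq_same]
  have hQs : ∀ (i : Fin d) (X : tracelessSymm d) b,
      ∑ a, Q' a b ((Pi.single i (X, 0) : Fin d → tracelessSymm d × (Fin d → ℝ)) a) =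
        Q' i b (X, 0) := by
    intro i X b
    rw [Finset.sum_eq_single i (fun a _ ha => by rw [Pi.single_eq_of_ne ha, map_zero]) (by simp),
      Pi.single_eq_same]
  have hPs : ∀ (i : Fin d) (X : tracelessSymm d) b,
      P ((Pi.single i (X, 0) : Fin d → tracelessSymm d × (Fin d → ℝ)) b) =
        if i = b then P (X, 0) else 0 := by
    intro i X b
    split_ifs with h
    · subst h; rw [Pi.single_eq_same]
    · rw [Pi.single_eq_of_ne (Ne.symm h), map_zero]
  have h1 := hhom (Pi.single i (X, 0) - Pi.single j₀ (X', 0)) (fun b => by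
    have h3 : ∀ a, (((Pi.single i (X, 0) - Pi.single j₀ (X', 0) :
        Fin d → tracelessSymm d × (Fin d → ℝ)) a).1 : Matrix (Fin d) (Fin d) ℝ) a b =
        (((Pi.single i (X, 0) : Fin d → tracelessSymm d × (Fin d → ℝ)) a).1 :
          Matrix (Fin d) (Fin d) ℝ) a b -
        (((Pi.single j₀ (X', 0) : Fin d → tracelessSymm d × (Fin d → ℝ)) a).1 :
          Matrix (Fin d) (Fin d) ℝ) a b := fun a => rfl
    rw [Finset.sum_congr rfl fun a _ => h3 a, Finset.sum_sub_distrib, hsingle, hsingle, hrow,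
      sub_self]) b
  simp only [Pi.sub_apply, map_sub, Finset.sum_sub_distrib, hQs, hPs] at h1
  have hX0 : ((X', 0) : tracelessSymm d × (Fin d → ℝ)) =
      ∑ c, (X : Matrix (Fin d) (Fin d) ℝ) i c • ((B c, 0) : tracelessSymm d × (Fin d → ℝ)) := by
    refine Prod.ext ?_ ?_
    · rw [Prod.fst_sum]; rfl
    · rw [Prod.snd_sum]; simp
  have h4 : Q' j₀ b (X', 0) = ∑ c, (X : Matrix (Fin d) (Fin d) ℝ) i c * Q' j₀ b (B c, 0) := by
    rw [hX0, map_sum]; simp only [map_smul, smul_eq_mul]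
  have h5 : P (X', 0) = ∑ c, (X : Matrix (Fin d) (Fin d) ℝ) i c * P (B c, 0) := by
    rw [hX0, map_sum]; simp only [map_smul, smul_eq_mul]
  have h6 : ∑ c, (X : Matrix (Fin d) (Fin d) ℝ) i c *
      (Q' j₀ b (B c, 0) - if j₀ = b then P (B c, 0) else 0) =
      Q' j₀ b (X', 0) - if j₀ = b then P (X', 0) else 0 := by
    simp only [mul_sub, Finset.sum_sub_distrib, ← h4]
    congr 1
    split_ifs
    · rw [h5]
    · simp
  rw [h6]
  linarith

theorem sub_eq_zero_of_hasDerivAt_zero {f : ℝ → ℝ} (hc : ContinuousOn f (Set.Icc 0 1))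
    (hf : ∀ t ∈ Set.Ioo (0 : ℝ) 1, HasDerivAt f 0 t) : f 1 = f 0 := by
  obtain ⟨c, -, h⟩ := exists_hasDerivAt_eq_slope f (fun _ => 0) zero_lt_one hc hf
  rw [sub_zero, div_one] at h
  linarith

/-- The outgoing density does not depend on the velocity. -/
theorem outDensity_eq (hd : 2 ≤ d) (hdiff : DifferentiableOn ℝ S (singularPointData d))
    (hS : PreservesConstraints S) {k : tracelessSymm d} (hk : 0 < density k) (p : Fin d → ℝ) :
    outDensity S (k, p) = outDensity S (k, 0) := by
  ext i j
  have h1 : ∀ t : ℝ, HasDerivAt (fun t : ℝ => outDensity S (k, t • p) i j) 0 t := by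
    intro t
    have hz : ((k, t • p) : tracelessSymm d × (Fin d → ℝ)) ∈ positiveRegion d := hk
    obtain ⟨Q', θ, hQ, -, hw, -⟩ := exists_lagrange_multiplier hd hdiff hS hz
    have h2 : HasDerivAt (fun t : ℝ => ((k, t • p) : tracelessSymm d × (Fin d → ℝ))) (0, p) t := by
      have h3 : HasDerivAt (fun t : ℝ => t • p) p t := by
        have := (hasDerivAt_id t).smul_const p
        rwa [one_smul] at this
      exact (hasDerivAt_const t k).prodMk h3
    have h3 := (hQ i j).comp_hasDerivAt t h2
    have h4 : HasDerivAt (fun t : ℝ => outDensity S (k, t • p) i j) (Q' i j (0, p)) t := h3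
    rw [hw] at h4
    exact h4
  have h2 := sub_eq_zero_of_hasDerivAt_zero (fun t _ => (h1 t).continuousAt.continuousWithinAt)
    (fun t _ => h1 t)
  simpa only [one_smul, zero_smul] using h2

theorem hasDerivAt_line (k X : tracelessSymm d) (p : Fin d → ℝ) (t : ℝ) :
    HasDerivAt (fun t : ℝ => ((k + t • X, p) : tracelessSymm d × (Fin d → ℝ))) (X, 0) t := by
  have h3 : HasDerivAt (fun t : ℝ => k + t • X) X t := by
    have := ((hasDerivAt_id t).smul_const X).const_add k
    rwa [one_smul] at this
  exact h3.prodMk (hasDerivAt_const t p)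

theorem eventually_density_pos {k : tracelessSymm d} (hk : 0 < density k) (X : tracelessSymm d) :
    ∀ᶠ t : ℝ in nhds 0, 0 < density (k + t • X) := by
  have h1 : Continuous fun t : ℝ => density (k + t • X) :=
    (contDiff_density (n := 0)).continuous.comp (by fun_prop)
  have h2 : 0 < density (k + (0 : ℝ) • X) := by rwa [zero_smul, add_zero]
  exact h1.continuousAt.eventually (lt_mem_nhds h2)

theorem diag_add_smul {l n : Fin d → ℝ} (hl : ∑ i, l i = 0) (hn : ∑ i, n i = 0) (t : ℝ) :
    ∃ h, diag l hl + t • diag n hn = diag (l + t • n) h := by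
  refine ⟨by simp [Finset.sum_add_distrib, ← Finset.mul_sum, hl, hn], ?_⟩
  ext i j
  change Matrix.diagonal l i j + t * Matrix.diagonal n i j = Matrix.diagonal (l + t • n) i j
  by_cases h : i = j
  · subst h; simp
  · simp [h]

/-- At a diagonal `k` the derivative of the outgoing density is a multiple of the identity. -/
theorem exists_deriv_outDensity_diag (hd : 2 ≤ d)
    (hdiff : DifferentiableOn ℝ S (singularPointData d)) (hcov : IsCovariant S)
    (hS : PreservesConstraints S) {l : Fin d → ℝ} (hl : ∑ i, l i = 0)
    (hk : 0 < density (diag l hl)) :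
    ∃ θ : ℝ, ∀ (X : tracelessSymm d) i b,
      HasDerivAt (fun t : ℝ => outDensity S (diag l hl + t • X, 0) i b)
        (θ * (X : Matrix (Fin d) (Fin d) ℝ) i b) 0 := by
  have hz : ((diag l hl, 0) : tracelessSymm d × (Fin d → ℝ)) ∈ positiveRegion d := hk
  obtain ⟨Q', θ, hQ, htr, -, hQ'⟩ := exists_lagrange_multiplier hd hdiff hS hz
  have hder : ∀ (X : tracelessSymm d) i b,
      HasDerivAt (fun t : ℝ => outDensity S (diag l hl + t • X, 0) i b) (Q' i b (X, 0)) 0 := by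
    intro X i b
    have h1 := hasDerivAt_line (diag l hl) X 0 0
    have h2 : HasFDerivAt (fun y => outDensity S y i b) (Q' i b)
        ((diag l hl + (0 : ℝ) • X, 0) : tracelessSymm d × (Fin d → ℝ)) := by
      rw [zero_smul, add_zero]; exact hQ i b
    exact h2.comp_hasDerivAt 0 h1
  -- Along diagonal variations the density stays diagonal, which makes `θ` diagonal.
  have hθoff : ∀ i b, i ≠ b → θ i b = 0 := by
    intro i b hib
    have h1 := hQ' i b (diagPair i b)
    have h2 : Q' i b (diagPair i b, 0) = 0 := by
      refine (hder (diagPair i b) i b).unique ?_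
      refine (hasDerivAt_const (0 : ℝ) (0 : ℝ)).congr_of_eventuallyEq ?_
      filter_upwards [eventually_density_pos hk (diagPair i b)] with t ht
      obtain ⟨h, he⟩ := diag_add_smul hl (n := fun a => (if a = i then 1 else 0) -
        if a = b then 1 else 0) (by simp) t
      change diag l hl + t • diagPair i b = _ at he
      rw [he] at ht ⊢
      exact outDensity_diag_apply (by omega) hcov h ht hib
    rw [h2, if_neg hib, zero_add, Finset.sum_eq_single i] at h1
    · simpa [coe_diagPair, hib] using h1.symm
    · intro c _ hc
      rw [coe_diagPair, Matrix.diagonal_apply_ne _ (Ne.symm hc), zero_mul]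
    · simp
  have hsum : ∀ (X : tracelessSymm d) i b, ∑ c, (X : Matrix (Fin d) (Fin d) ℝ) i c * θ c b =
      (X : Matrix (Fin d) (Fin d) ℝ) i b * θ b b := by
    intro X i b
    rw [Finset.sum_eq_single b]
    · intro c _ hc
      rw [hθoff c b hc, mul_zero]
    · simp
  -- Symmetry of the density makes the diagonal entries of `θ` equal.
  have hθdiag : ∀ i j, θ i i = θ j j := by
    intro i j
    by_cases hij : i = j
    · rw [hij]
    have h1 := hQ' i j (offDiag hij)
    have h2 := hQ' j i (offDiag hij)
    have h3 : Q' i j (offDiag hij, 0) = Q' j i (offDiag hij, 0) := by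
      refine (hder (offDiag hij) i j).unique
        ((hder (offDiag hij) j i).congr_of_eventuallyEq ?_)
      filter_upwards [eventually_density_pos hk (offDiag hij)] with t ht
      exact (outDensity_isSymm (by omega) hcov ht).apply j i
    rw [hsum, if_neg hij, offDiag_apply] at h1
    rw [hsum, if_neg (Ne.symm hij), offDiag_apply] at h2
    simp [hij, Ne.symm hij] at h1 h2
    rw [← h1, ← h2, h3]
  set j₀ : Fin d := ⟨0, by omega⟩
  -- The density is traceless, which leaves no room for the metric work.
  have hP : ∀ X, metricWork S (diag l hl, 0) (X, 0) = 0 := by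
    intro X
    have h1 := htr (X, 0)
    simp only [hQ', hsum, if_true, Finset.sum_add_distrib, Finset.sum_const, Finset.card_univ,
      Fintype.card_fin, nsmul_eq_mul] at h1
    have h2 : ∑ i, (X : Matrix (Fin d) (Fin d) ℝ) i i * θ i i = 0 := by
      rw [Finset.sum_congr rfl fun i _ => by rw [hθdiag i j₀], ← Finset.sum_mul]
      have : ∑ i, (X : Matrix (Fin d) (Fin d) ℝ) i i = 0 := trace_eq X
      rw [this, zero_mul]
    rw [h2, add_zero] at h1
    have hd' : (d : ℝ) ≠ 0 := by
      have : d ≠ 0 := by omega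
      exact_mod_cast this
    exact (mul_eq_zero.1 h1).resolve_left hd'
  refine ⟨θ j₀ j₀, fun X i b => ?_⟩
  have h1 := hder X i b
  rw [hQ', hP, hsum, ite_self, zero_add, hθdiag b j₀, mul_comm] at h1
  exact h1

theorem outDensity_eq_conj (hd : 0 < d) (hcov : IsCovariant S) (O : Matrix (Fin d) (Fin d) ℝ)
    (hO : O * Oᵀ = 1) {k : tracelessSymm d} (hk : 0 < density k) :
    outDensity S (k, 0) = Oᵀ * outDensity S (conj O hO k, 0) * O := by
  have h1 := outDensity_conj hd hcov O hO (z := (k, 0)) hk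
  rw [Matrix.mulVec_zero] at h1
  rw [h1]
  simp only [Matrix.mul_assoc]
  rw [mul_eq_one_comm.1 hO, ← Matrix.mul_assoc Oᵀ, mul_eq_one_comm.1 hO, Matrix.one_mul,
    Matrix.mul_one]

theorem exists_deriv_outDensity (hd : 2 ≤ d)
    (hdiff : DifferentiableOn ℝ S (singularPointData d)) (hcov : IsCovariant S)
    (hS : PreservesConstraints S) {k : tracelessSymm d} (hk : 0 < density k) :
    ∃ θ : ℝ, ∀ (X : tracelessSymm d) i b,
      HasDerivAt (fun t : ℝ => outDensity S (k + t • X, 0) i b)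
        (θ * (X : Matrix (Fin d) (Fin d) ℝ) i b) 0 := by
  obtain ⟨O, hO, l, hl, h⟩ := exists_conj_diagonal k
  have hpos : 0 < density (diag l hl) := by rw [← h, density_conj]; exact hk
  obtain ⟨θ, hθ⟩ := exists_deriv_outDensity_diag hd hdiff hcov hS hl hpos
  refine ⟨θ, fun X i b => ?_⟩
  have h1 : HasDerivAt (fun t : ℝ => ∑ c, (∑ a, Oᵀ i a *
      outDensity S (diag l hl + t • conj O hO X, 0) a c) * O c b)
      (∑ c, (∑ a, Oᵀ i a * (θ * (conj O hO X : Matrix (Fin d) (Fin d) ℝ) a c)) * O c b) 0 :=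
    HasDerivAt.fun_sum fun c _ => (HasDerivAt.fun_sum fun a _ =>
      (hθ (conj O hO X) a c).const_mul (Oᵀ i a)).mul_const (O c b)
  have h2 : (∑ c, (∑ a, Oᵀ i a * (θ * (conj O hO X : Matrix (Fin d) (Fin d) ℝ) a c)) * O c b)
      = θ * (X : Matrix (Fin d) (Fin d) ℝ) i b := by
    have h3 : (Oᵀ * (conj O hO X : Matrix (Fin d) (Fin d) ℝ) * O) = X := by
      rw [coe_conj]
      simp only [Matrix.mul_assoc]
      rw [mul_eq_one_comm.1 hO, ← Matrix.mul_assoc Oᵀ, mul_eq_one_comm.1 hO, Matrix.one_mul,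
        Matrix.mul_one]
    have h4 := congrFun (congrFun h3 i) b
    simp only [Matrix.mul_apply (N := O), Matrix.mul_apply (M := Oᵀ)] at h4
    rw [← h4, Finset.mul_sum]
    refine Finset.sum_congr rfl fun c _ => ?_
    rw [Finset.sum_mul, Finset.sum_mul, Finset.mul_sum]
    exact Finset.sum_congr rfl fun a _ => by ring
  rw [h2] at h1
  refine h1.congr_of_eventuallyEq ?_
  filter_upwards [eventually_density_pos hk X] with t ht
  rw [outDensity_eq_conj (by omega) hcov O hO ht, conj_add_smul, h]
  simp only [Matrix.mul_apply (N := O), Matrix.mul_apply (M := Oᵀ)]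

theorem hasDerivAt_line_of_hasDerivAt_zero {f : tracelessSymm d → ℝ} {k X : tracelessSymm d}
    {t c : ℝ} (h : HasDerivAt (fun s : ℝ => f (k + t • X + s • X)) c 0) :
    HasDerivAt (fun s : ℝ => f (k + s • X)) c t := by
  have h2 : HasDerivAt (fun s : ℝ => f (k + t • X + s • X)) c (t - t) := by rwa [sub_self]
  have h3 := h2.comp_sub_const t t
  refine h3.congr_of_eventuallyEq (Filter.Eventually.of_forall fun s => ?_)
  change f (k + s • X) = f (k + t • X + (s - t) • X)
  congr 1
  module

/-- Rigidity: a density whose derivative is everywhere a multiple of the identity is linear. The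
multiple `θ` is constant: for a functional `ℓ`, the function `ℓ ∘ Q` is constant on the level sets of
`ℓ` and has slope `θ` across them, so that `θ` is a function of `ℓ` alone. As the space of traceless
symmetric matrices has dimension at least two, each `k` lies with `0` on a level set of some
non-zero `ℓ`. -/
theorem exists_outDensity_eq_smul (hd : 2 ≤ d)
    (hdiff : DifferentiableOn ℝ S (singularPointData d)) (hcov : IsCovariant S)
    (hS : PreservesConstraints S) :
    ∃ γ : ℝ, ∀ z ∈ positiveRegion d, outDensity S z = γ • (z.1 : Matrix (Fin d) (Fin d) ℝ) := by
  have h0 := density_zero_pos hd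
  have hex : ∀ k : tracelessSymm d, ∃ θ : ℝ, 0 < density k → ∀ (X : tracelessSymm d) i b,
      HasDerivAt (fun t : ℝ => outDensity S (k + t • X, 0) i b)
        (θ * (X : Matrix (Fin d) (Fin d) ℝ) i b) 0 := by
    intro k
    by_cases hk : 0 < density k
    · obtain ⟨θ, hθ⟩ := exists_deriv_outDensity hd hdiff hcov hS hk
      exact ⟨θ, fun _ => hθ⟩
    · exact ⟨0, fun h => absurd h hk⟩
  choose θ hθ using hex
  have hseg : ∀ k k' : tracelessSymm d, 0 < density k → 0 < density k' → ∀ t ∈ Set.Icc (0 : ℝ) 1,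
      0 < density (k + t • (k' - k)) := by
    intro k k' hk hk' t ht
    have := convex_density_pos hk hk' (sub_nonneg.2 ht.2) ht.1 (sub_add_cancel 1 t)
    have e : (1 - t) • k + t • k' = k + t • (k' - k) := by module
    rw [e] at this
    exact this
  have hconst : ∀ k, 0 < density k → θ k = θ 0 := by
    intro k hk
    have hij : (⟨0, by omega⟩ : Fin d) ≠ ⟨1, by omega⟩ := by simp
    set i : Fin d := ⟨0, by omega⟩
    set j : Fin d := ⟨1, by omega⟩
    -- `(α, β)` defines a non-zero functional `ℓ` vanishing at `k`, and `X` is transverse to its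
    -- kernel.
    obtain ⟨α, β, hαβ, hk0⟩ : ∃ α β : ℝ, 0 < α ^ 2 + β ^ 2 ∧
        β * ((k : Matrix (Fin d) (Fin d) ℝ) i i - (k : Matrix (Fin d) (Fin d) ℝ) j j)
          - α * (2 * (k : Matrix (Fin d) (Fin d) ℝ) i j) = 0 := by
      by_cases h : (k : Matrix (Fin d) (Fin d) ℝ) i j = 0
      · exact ⟨1, 0, by norm_num, by rw [h]; ring⟩
      · exact ⟨(k : Matrix (Fin d) (Fin d) ℝ) i i - (k : Matrix (Fin d) (Fin d) ℝ) j j,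
          2 * (k : Matrix (Fin d) (Fin d) ℝ) i j, by positivity, by ring⟩
    set ℓ : Matrix (Fin d) (Fin d) ℝ → ℝ := fun M => β * (M i i - M j j) - α * (2 * M i j) with hℓ
    set X : tracelessSymm d := β • diagPair i j - α • offDiag hij with hX
    have hℓX : ℓ X = 2 * (α ^ 2 + β ^ 2) := by
      have e : ∀ a b, (X : Matrix (Fin d) (Fin d) ℝ) a b =
        β * (diagPair i j : Matrix (Fin d) (Fin d) ℝ) a b -
          α * (offDiag hij : Matrix (Fin d) (Fin d) ℝ) a b := fun a b => rfl
      simp only [hℓ, e, offDiag_apply, coe_diagPair]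
      simp [hij, hij.symm]
      ring
    have hder : ∀ k' : tracelessSymm d, 0 < density k' → ∀ Y : tracelessSymm d,
        HasDerivAt (fun t : ℝ => ℓ (outDensity S (k' + t • Y, 0))) (θ k' * ℓ Y) 0 := by
      intro k' hk' Y
      have h1 := (((hθ k' hk' Y i i).sub (hθ k' hk' Y j j)).const_mul β).sub
        (((hθ k' hk' Y i j).const_mul 2).const_mul α)
      convert! h1 using 1
      simp only [hℓ]
      ring
    have hlev : ∀ k₁ k₂ : tracelessSymm d, 0 < density k₁ → 0 < density k₂ →
        ℓ (k₂ - k₁ : tracelessSymm d) = 0 →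
        ℓ (outDensity S (k₂, 0)) = ℓ (outDensity S (k₁, 0)) := by
      intro k₁ k₂ h₁ h₂ h12
      have h3 : ∀ t ∈ Set.Icc (0 : ℝ) 1,
          HasDerivAt (fun s : ℝ => ℓ (outDensity S (k₁ + s • (k₂ - k₁), 0))) 0 t := by
        intro t ht
        have h4 := hder _ (hseg k₁ k₂ h₁ h₂ t ht) (k₂ - k₁)
        rw [h12, mul_zero] at h4
        exact hasDerivAt_line_of_hasDerivAt_zero
          (f := fun k => ℓ (outDensity S (k, 0))) h4
      have h5 := sub_eq_zero_of_hasDerivAt_zero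
        (fun t ht => (h3 t ht).continuousAt.continuousWithinAt)
        (fun t ht => h3 t (Set.Ioo_subset_Icc_self ht))
      simpa using h5
    have h6 : θ k * ℓ X = θ 0 * ℓ X := by
      refine (hder k hk X).unique ((hder 0 h0 X).congr_of_eventuallyEq ?_)
      filter_upwards [eventually_density_pos hk X, eventually_density_pos h0 X] with t ht ht'
      refine hlev _ _ ht' ht ?_
      have e : k + t • X - (0 + t • X) = k := by module
      rw [e]
      exact hk0
    have h7 : ℓ X ≠ 0 := by rw [hℓX]; positivity
    exact mul_right_cancel₀ h7 h6
  refine ⟨θ 0, fun z hz => ?_⟩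
  have hz' : 0 < density z.1 := hz
  rw [show z = (z.1, z.2) from rfl, outDensity_eq hd hdiff hS hz']
  ext i b
  have h3 : ∀ t ∈ Set.Icc (0 : ℝ) 1, HasDerivAt
      (fun s : ℝ => outDensity S (0 + s • z.1, 0) i b -
        s * (θ 0 * (z.1 : Matrix (Fin d) (Fin d) ℝ) i b)) 0 t := by
    intro t ht
    have hp : 0 < density (0 + t • z.1) := by
      have := hseg 0 z.1 h0 hz' t ht
      rwa [sub_zero] at this
    have h4 := hθ _ hp z.1 i b
    rw [hconst _ hp] at h4
    have h5 := hasDerivAt_line_of_hasDerivAt_zero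
      (f := fun k => outDensity S (k, 0) i b) h4
    have h6 := h5.sub ((hasDerivAt_id t).mul_const (θ 0 * (z.1 : Matrix (Fin d) (Fin d) ℝ) i b))
    rw [one_mul, sub_self] at h6
    exact h6
  have h5 := sub_eq_zero_of_hasDerivAt_zero
    (fun t ht => (h3 t ht).continuousAt.continuousWithinAt)
    (fun t ht => h3 t (Set.Ioo_subset_Icc_self ht))
  simp only [one_smul, zero_smul, add_zero, zero_add, one_mul, zero_mul, sub_zero,
    outDensity_zero hd hcov hS, Matrix.zero_apply] at h5
  rw [Matrix.smul_apply, smul_eq_mul]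
  linarith

/-- Once the outgoing density is `γ k`, the momentum constraint determines `μ⁺ v⁺` and the
work of `K̊⁺` against all variations of the outgoing metric vanishes. -/
theorem momentum_and_metricWork (hd : 2 ≤ d)
    (hdiff : DifferentiableOn ℝ S (singularPointData d))
    (hS : PreservesConstraints S) {γ : ℝ}
    (hγ : ∀ z ∈ positiveRegion d, outDensity S z = γ • (z.1 : Matrix (Fin d) (Fin d) ℝ))
    {z : tracelessSymm d × (Fin d → ℝ)} (hz : z ∈ positiveRegion d) :
    (∀ b, 2 * √(S (orthoData z)).g.det * (S (orthoData z)).μ * (S (orthoData z)).v b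
      = γ * z.2 b) ∧ metricWork S z = 0 := by
  obtain ⟨Q', hQ, -, hjet⟩ := exists_outDensity_deriv hd hdiff hS hz
  have hQ' : ∀ i j Y, Q' i j Y = γ * (Y.1 : Matrix (Fin d) (Fin d) ℝ) i j := by
    intro i j Y
    have h1 : HasFDerivAt (fun y : tracelessSymm d × (Fin d → ℝ) =>
        γ * (y.1 : Matrix (Fin d) (Fin d) ℝ) i j)
        (γ • (entry i j).comp (ContinuousLinearMap.fst ℝ _ _)) z :=
      ((entry i j).comp
        (ContinuousLinearMap.fst ℝ (tracelessSymm d) (Fin d → ℝ))).hasFDerivAt.const_mul γ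
    have h2 : (fun y => outDensity S y i j) =ᶠ[nhds z] fun y =>
        γ * (y.1 : Matrix (Fin d) (Fin d) ℝ) i j := by
      filter_upwards [isOpen_positiveRegion.mem_nhds hz] with y hy
      rw [hγ y hy]; rfl
    rw [(hQ i j).unique (h1.congr_of_eventuallyEq h2)]
    rfl
  -- An arbitrary variation `y` in the direction `b` is completed to an admissible jet in another
  -- direction `a`.
  have key : ∀ (b : Fin d) (y : tracelessSymm d × (Fin d → ℝ)), γ * z.2 b - metricWork S z y =
      2 * √(S (orthoData z)).g.det * (S (orthoData z)).μ * (S (orthoData z)).v b := by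
    intro b y
    obtain ⟨a, ha⟩ : ∃ a : Fin d, a ≠ b := by
      have : Nontrivial (Fin d) := Fin.nontrivial_iff_two_le.2 hd
      exact exists_ne b
    obtain ⟨H, hH, hH0⟩ := exists_jet hd
      (fun c => z.2 c - (y.1 : Matrix (Fin d) (Fin d) ℝ) b c) a
    set Y : Fin d → tracelessSymm d × (Fin d → ℝ) := fun c => if c = b then y else (H c, 0) with hY
    have hYsum : ∀ c, ∑ e, ((Y e).1 : Matrix (Fin d) (Fin d) ℝ) e c = z.2 c := by
      intro c
      have h1 : ∀ e, ((Y e).1 : Matrix (Fin d) (Fin d) ℝ) e c =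
          (H e : Matrix (Fin d) (Fin d) ℝ) e c +
            if e = b then (y.1 : Matrix (Fin d) (Fin d) ℝ) b c else 0 := by
        intro e
        by_cases he : e = b
        · subst he
          simp only [hY, if_true, hH0 e (Ne.symm ha)]
          simp
        · simp [hY, he]
      rw [Finset.sum_congr rfl fun e _ => h1 e, Finset.sum_add_distrib, hH]
      simp
    have h2 := hjet Y hYsum b
    simp only [hQ', ← Finset.mul_sum, hYsum] at h2
    rw [← h2]
    simp [hY]
  have hb : ∀ b, 2 * √(S (orthoData z)).g.det * (S (orthoData z)).μ * (S (orthoData z)).v b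
      = γ * z.2 b := by
    intro b
    rw [← key b 0, map_zero, sub_zero]
  refine ⟨hb, LinearMap.ext fun y => ?_⟩
  have h1 := key ⟨0, by omega⟩ y
  rw [hb] at h1
  rw [LinearMap.zero_apply]
  linarith

end Rigidity

/-! ### The outgoing metric is conformal to the incoming one -/

section ConformalMetric

variable {d : ℕ} {S : PointData d → PointData d}

theorem map_g_isSymm (hd : 2 ≤ d) (hS : PreservesConstraints S)
    {z : tracelessSymm d × (Fin d → ℝ)} (hz : z ∈ positiveRegion d) :
    (S (orthoData z)).g.IsSymm :=
  isSymm_of_posDef (map_orthoData_mem hd hS hz).1.posDef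

/-- For `γ ≠ 0`, symmetry of `K̊⁺` with respect to `g⁺` passes to `k`. -/
theorem map_g_mul_isSymm (hd : 2 ≤ d) (hS : PreservesConstraints S) {γ : ℝ} (hγ0 : γ ≠ 0)
    {z : tracelessSymm d × (Fin d → ℝ)} (hz : z ∈ positiveRegion d)
    (hγ : outDensity S z = γ • (z.1 : Matrix (Fin d) (Fin d) ℝ)) :
    ((S (orthoData z)).g * (z.1 : Matrix (Fin d) (Fin d) ℝ)).IsSymm := by
  have h1 : ((S (orthoData z)).g * (S (orthoData z)).Kring).IsSymm := by
    rw [Kring, Matrix.mul_sub, Matrix.mul_smul, Matrix.mul_one]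
    exact (map_orthoData_mem hd hS hz).1.symm.sub ((map_g_isSymm hd hS hz).smul _)
  have h2 : (S (orthoData z)).g * (z.1 : Matrix (Fin d) (Fin d) ℝ) =
      (γ⁻¹ * √(S (orthoData z)).g.det) • ((S (orthoData z)).g * (S (orthoData z)).Kring) := by
    have h3 : (z.1 : Matrix (Fin d) (Fin d) ℝ) = γ⁻¹ • outDensity S z := by
      rw [hγ, smul_smul, inv_mul_cancel₀ hγ0, one_smul]
    rw [h3, outDensity, Matrix.mul_smul, Matrix.mul_smul, smul_smul]
  rw [h2]
  exact h1.smul _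

theorem hasDerivAt_map_g_line (hd : 0 < d) (hdiff : DifferentiableOn ℝ S (singularPointData d))
    {k X : tracelessSymm d} {p : Fin d → ℝ} {t : ℝ} (hk : 0 < density (k + t • X)) (i j : Fin d) :
    HasDerivAt (fun s : ℝ => (S (orthoData (k + s • X, p))).g i j)
      ((mapDeriv S (k + t • X, p) (X, 0)).g i j) t := by
  have hz : ((k + t • X, p) : tracelessSymm d × (Fin d → ℝ)) ∈ positiveRegion d := hk
  have h1 := (hasFDerivAt_g (hasFDerivAt_mapDeriv hd hdiff hz) i j).comp_hasDerivAt t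
    (hasDerivAt_line k X p t)
  exact h1

theorem eq_zero_of_eventually_punctured {f : ℝ → ℝ} (hf : ContinuousAt f 0)
    (h : ∀ᶠ t in nhdsWithin (0 : ℝ) {0}ᶜ, f t = 0) : f 0 = 0 := by
  have h1 : Filter.Tendsto f (nhdsWithin 0 {0}ᶜ) (nhds (f 0)) :=
    hf.tendsto.mono_left nhdsWithin_le_nhds
  have h2 : Filter.Tendsto f (nhdsWithin 0 {0}ᶜ) (nhds 0) :=
    tendsto_const_nhds.congr' (h.mono fun t ht => ht.symm)
  exact tendsto_nhds_unique h1 h2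

theorem density_smul_pos (hd : 2 ≤ d) {k : tracelessSymm d} (hk : 0 < density k) {t : ℝ}
    (ht : t ∈ Set.Icc (0 : ℝ) 1) : 0 < density (0 + t • k) := by
  have := convex_density_pos (density_zero_pos hd) hk (sub_nonneg.2 ht.2) ht.1
    (sub_add_cancel 1 t)
  rwa [smul_zero] at this

/-- At `k = 0` the outgoing metric is a multiple of the identity: by continuity it commutes with
every traceless symmetric matrix. -/
theorem map_g_zero (hd : 2 ≤ d) (hdiff : DifferentiableOn ℝ S (singularPointData d))
    (hS : PreservesConstraints S) {γ : ℝ} (hγ0 : γ ≠ 0)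
    (hγ : ∀ z ∈ positiveRegion d, outDensity S z = γ • (z.1 : Matrix (Fin d) (Fin d) ℝ))
    (p : Fin d → ℝ) (i j : Fin d) :
    (S (orthoData (0, p))).g i i = (S (orthoData (0, p))).g j j := by
  by_cases hij : i = j
  · rw [hij]
  set X := offDiag hij with hX
  have h0 := density_zero_pos hd
  have h0' : 0 < density (0 + (0 : ℝ) • X) := by rwa [zero_smul, add_zero]
  have hcont : ∀ a b, ContinuousAt (fun t : ℝ => (S (orthoData (0 + t • X, p))).g a b) 0 :=
    fun a b => (hasDerivAt_map_g_line (by omega) hdiff h0' a b).continuousAt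
  have h1 : (fun t : ℝ => (S (orthoData (0 + t • X, p))).g i i -
      (S (orthoData (0 + t • X, p))).g j j) 0 = 0 := by
    refine eq_zero_of_eventually_punctured ((hcont i i).sub (hcont j j)) ?_
    filter_upwards [self_mem_nhdsWithin,
      (eventually_density_pos h0 X).filter_mono nhdsWithin_le_nhds] with t ht ht'
    have ht0 : t ≠ 0 := ht
    have hz : ((0 + t • X, p) : tracelessSymm d × (Fin d → ℝ)) ∈ positiveRegion d := ht'
    have h2 := (map_g_mul_isSymm hd hS hγ0 hz (hγ _ hz)).apply i j
    have h3 : ∀ a b, ((0 + t • X : tracelessSymm d) : Matrix (Fin d) (Fin d) ℝ) a b =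
        t * ((if a = i ∧ b = j then 1 else 0) + if a = j ∧ b = i then 1 else 0) := by
      intro a b
      rw [zero_add]
      rfl
    simp only [Matrix.mul_apply, h3] at h2
    simp [hij, Ne.symm hij, ht0] at h2
    simp only [Pi.sub_apply, zero_add] at h2 ⊢
    rw [h2, sub_self]
  simp only [zero_smul, add_zero] at h1
  linarith

theorem smul_diag {l : Fin d → ℝ} (hl : ∑ i, l i = 0) (t : ℝ) :
    0 + t • diag l hl = diag (t • l) (by simp [← Finset.mul_sum, hl]) := by
  rw [zero_add]
  ext i j
  change t * Matrix.diagonal l i j = Matrix.diagonal (t • l) i j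
  by_cases h : i = j
  · subst h; simp
  · simp [h]

/-- In an eigenframe of `k` with distinct eigenvalues the outgoing metric is diagonal. -/
theorem map_g_off_diag (hd : 2 ≤ d) (hS : PreservesConstraints S) {γ : ℝ} (hγ0 : γ ≠ 0)
    (hγ : ∀ z ∈ positiveRegion d, outDensity S z = γ • (z.1 : Matrix (Fin d) (Fin d) ℝ))
    {l : Fin d → ℝ} (hl : ∑ i, l i = 0) (hinj : Function.Injective l)
    (hk : 0 < density (diag l hl)) (p : Fin d → ℝ) {i j : Fin d} (hij : i ≠ j) :
    (S (orthoData (diag l hl, p))).g i j = 0 := by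
  have hz : ((diag l hl, p) : tracelessSymm d × (Fin d → ℝ)) ∈ positiveRegion d := hk
  have h1 := (map_g_mul_isSymm hd hS hγ0 hz (hγ _ hz)).apply i j
  rw [coe_diag, Matrix.mul_diagonal, Matrix.mul_diagonal, (map_g_isSymm hd hS hz).apply i j] at h1
  have h2 : (S (orthoData (diag l hl, p))).g i j * (l i - l j) = 0 := by linarith
  exact (mul_eq_zero.1 h2).resolve_right (sub_ne_zero.2 fun h => hij (hinj h))

/-- The outgoing metric only varies in such a way that `∑ k_i δ log g⁺_{ii} = 0`. -/
theorem sum_mul_deriv_log (hd : 2 ≤ d) (hdiff : DifferentiableOn ℝ S (singularPointData d))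
    (hS : PreservesConstraints S) {γ : ℝ} (hγ0 : γ ≠ 0)
    (hγ : ∀ z ∈ positiveRegion d, outDensity S z = γ • (z.1 : Matrix (Fin d) (Fin d) ℝ))
    {l : Fin d → ℝ} (hl : ∑ i, l i = 0) (hinj : Function.Injective l)
    (hk : 0 < density (diag l hl)) (p : Fin d → ℝ) (Y : tracelessSymm d × (Fin d → ℝ)) :
    ∑ i, l i * ((mapDeriv S (diag l hl, p) Y).g i i / (S (orthoData (diag l hl, p))).g i i) = 0 := by
  have hz : ((diag l hl, p) : tracelessSymm d × (Fin d → ℝ)) ∈ positiveRegion d := hk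
  have hpos := (map_orthoData_mem hd hS hz).1.posDef
  set D := S (orthoData (diag l hl, p)) with hD
  have hdiag : D.g = Matrix.diagonal fun i => D.g i i := by
    ext i j
    by_cases h : i = j
    · subst h; simp
    · rw [Matrix.diagonal_apply_ne _ h]
      exact map_g_off_diag hd hS hγ0 hγ hl hinj hk p h
  have hinv : D.g⁻¹ = Matrix.diagonal fun i => (D.g i i)⁻¹ := by
    refine Matrix.inv_eq_left_inv ?_
    rw [hdiag, Matrix.diagonal_mul_diagonal, ← Matrix.diagonal_one]
    congr 1
    funext i
    simp only [Matrix.diagonal_apply_eq]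
    exact inv_mul_cancel₀ (hpos.diag_pos).ne'
  have hw : metricWork S (diag l hl, p) Y = 0 := by
    rw [(momentum_and_metricWork hd hdiff hS hγ hz).2, LinearMap.zero_apply]
  rw [metricWork_apply, ← hD] at hw
  have h1 : (outDensity S (diag l hl, p) * (D.g⁻¹ * (mapDeriv S (diag l hl, p) Y).g)).trace = 0 := by
    rw [outDensity, ← hD, Matrix.smul_mul, Matrix.trace_smul, smul_eq_mul]
    linarith
  rw [hγ _ hz, Matrix.smul_mul, Matrix.trace_smul, smul_eq_mul, coe_diag, hinv] at h1
  have h2 := (mul_eq_zero.1 h1).resolve_left hγ0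
  rw [← h2, Matrix.trace]
  refine Finset.sum_congr rfl fun i _ => ?_
  rw [Matrix.diag_apply, Matrix.diagonal_mul, Matrix.diagonal_mul, div_eq_inv_mul]

/-- The function `∑ k_i log g⁺_{ii}` is constant along rays through `k = 0`, where it vanishes. -/
theorem sum_mul_log (hd : 2 ≤ d) (hdiff : DifferentiableOn ℝ S (singularPointData d))
    (hS : PreservesConstraints S) {γ : ℝ} (hγ0 : γ ≠ 0)
    (hγ : ∀ z ∈ positiveRegion d, outDensity S z = γ • (z.1 : Matrix (Fin d) (Fin d) ℝ))
    {l : Fin d → ℝ} (hl : ∑ i, l i = 0) (hinj : Function.Injective l)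
    (hk : 0 < density (diag l hl)) (p : Fin d → ℝ) :
    ∑ i, l i * Real.log ((S (orthoData (diag l hl, p))).g i i) = 0 := by
  have hgpos : ∀ t ∈ Set.Icc (0 : ℝ) 1, ∀ i, 0 < (S (orthoData (0 + t • diag l hl, p))).g i i :=
    fun t ht i => (map_orthoData_mem hd hS (z := (0 + t • diag l hl, p))
      (density_smul_pos hd hk ht)).1.posDef.diag_pos
  have hder : ∀ t ∈ Set.Icc (0 : ℝ) 1, HasDerivAt
      (fun s : ℝ => ∑ i, l i * Real.log ((S (orthoData (0 + s • diag l hl, p))).g i i))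
      (∑ i, l i * ((mapDeriv S (0 + t • diag l hl, p) (diag l hl, 0)).g i i /
        (S (orthoData (0 + t • diag l hl, p))).g i i)) t := fun t ht =>
    HasDerivAt.fun_sum fun i _ => ((hasDerivAt_map_g_line (by omega) hdiff
      (density_smul_pos hd hk ht) i i).log (hgpos t ht i).ne').const_mul (l i)
  have h1 := sub_eq_zero_of_hasDerivAt_zero
    (fun t ht => (hder t ht).continuousAt.continuousWithinAt) (fun t ht => by
      have h2 := hder t (Set.Ioo_subset_Icc_self ht)
      have h3 := density_smul_pos hd hk (Set.Ioo_subset_Icc_self ht)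
      rw [smul_diag hl t] at h2 h3
      have h4 := sum_mul_deriv_log hd hdiff hS hγ0 hγ _
        (fun a b hab => hinj (mul_left_cancel₀ ht.1.ne' hab)) h3 p (diag l hl, 0)
      convert! h2 using 1
      refine (mul_left_cancel₀ ht.1.ne' ?_).symm
      refine Eq.trans ?_ (h4.trans (mul_zero t).symm)
      rw [Finset.mul_sum]
      exact Finset.sum_congr rfl fun i _ => (mul_assoc _ _ _).symm)
  simp only [one_smul, zero_smul, add_zero, zero_add] at h1
  rw [h1, Finset.sum_congr rfl fun i _ => by
    rw [map_g_zero hd hdiff hS hγ0 hγ p i ⟨0, by omega⟩], ← Finset.sum_mul, hl, zero_mul]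

/-- The identity `∑ k_i log g⁺_{ii} = 0` holds in a neighbourhood. In its derivative in the direction
`e_i - e_j` the variation of `g⁺` drops out, which leaves `log g⁺_{ii} = log g⁺_{jj}`. -/
theorem map_g_diag_eq_of_injective (hd : 2 ≤ d)
    (hdiff : DifferentiableOn ℝ S (singularPointData d))
    (hS : PreservesConstraints S) {γ : ℝ} (hγ0 : γ ≠ 0)
    (hγ : ∀ z ∈ positiveRegion d, outDensity S z = γ • (z.1 : Matrix (Fin d) (Fin d) ℝ))
    {l : Fin d → ℝ} (hl : ∑ i, l i = 0) (hinj : Function.Injective l)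
    (hk : 0 < density (diag l hl)) (p : Fin d → ℝ) (i j : Fin d) :
    (S (orthoData (diag l hl, p))).g i i = (S (orthoData (diag l hl, p))).g j j := by
  have hz : ((diag l hl, p) : tracelessSymm d × (Fin d → ℝ)) ∈ positiveRegion d := hk
  have hpos : ∀ a, 0 < (S (orthoData (diag l hl, p))).g a a :=
    fun a => (map_orthoData_mem hd hS hz).1.posDef.diag_pos
  set n : Fin d → ℝ := fun a => (if a = i then 1 else 0) - if a = j then 1 else 0 with hn
  have hn0 : ∑ a, n a = 0 := by simp [hn]
  have hk0 : 0 < density (diag l hl + (0 : ℝ) • diag n hn0) := by rwa [zero_smul, add_zero]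
  have hder : HasDerivAt (fun t : ℝ => ∑ a, (l a + t * n a) *
      Real.log ((S (orthoData (diag l hl + t • diag n hn0, p))).g a a))
      (∑ a, (n a * Real.log ((S (orthoData (diag l hl, p))).g a a) +
        l a * ((mapDeriv S (diag l hl, p) (diag n hn0, 0)).g a a /
          (S (orthoData (diag l hl, p))).g a a))) 0 := by
    refine HasDerivAt.fun_sum fun a _ => ?_
    have h1 : HasDerivAt (fun t : ℝ => l a + t * n a) (n a) 0 := by
      simpa using ((hasDerivAt_id (0 : ℝ)).mul_const (n a)).const_add (l a)
    have h2 := hasDerivAt_map_g_line (by omega) hdiff (p := p) hk0 a a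
    have h3 := h1.mul (h2.log (by rw [zero_smul, add_zero]; exact (hpos a).ne'))
    simp only [zero_smul, add_zero, zero_mul] at h3
    exact h3
  -- Distinct eigenvalues stay distinct, so that `sum_mul_log` holds for all small `t`.
  have hev : (fun t : ℝ => ∑ a, (l a + t * n a) *
      Real.log ((S (orthoData (diag l hl + t • diag n hn0, p))).g a a)) =ᶠ[nhds 0]
      fun _ => (0 : ℝ) := by
    have hinj' : ∀ᶠ t : ℝ in nhds 0, ∀ a b, a ≠ b → l a + t * n a ≠ l b + t * n b := by
      rw [Filter.eventually_all]; intro a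
      rw [Filter.eventually_all]; intro b
      by_cases hab : a = b
      · exact Filter.Eventually.of_forall fun t h => absurd hab h
      have hc : Continuous fun t : ℝ => l a + t * n a - (l b + t * n b) := by fun_prop
      have h0 : (fun t : ℝ => l a + t * n a - (l b + t * n b)) 0 ≠ 0 := by
        simpa [sub_eq_zero] using fun h => hab (hinj h)
      filter_upwards [hc.continuousAt.eventually_ne h0] with t ht _ h
      exact ht (sub_eq_zero.2 h)
    filter_upwards [eventually_density_pos hk (diag n hn0), hinj'] with t ht ht'
    obtain ⟨h, he⟩ := diag_add_smul hl hn0 t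
    rw [he] at ht ⊢
    have h5 := sum_mul_log hd hdiff hS hγ0 hγ h (fun a b hab => by
      by_contra hne
      exact ht' a b hne (by simpa using hab)) ht p
    simpa using h5
  have h1 := hder.unique ((hasDerivAt_const (0 : ℝ) (0 : ℝ)).congr_of_eventuallyEq hev)
  rw [Finset.sum_add_distrib, sum_mul_deriv_log hd hdiff hS hγ0 hγ hl hinj hk p, add_zero] at h1
  have h2 : Real.log ((S (orthoData (diag l hl, p))).g i i) -
      Real.log ((S (orthoData (diag l hl, p))).g j j) = 0 := by
    rw [← h1]
    simp [hn, sub_mul, Finset.sum_sub_distrib]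
  exact Real.log_injOn_pos (hpos i) (hpos j) (sub_eq_zero.1 h2)

/-- The outgoing metric is a multiple of the incoming one in an eigenframe of `k`, by approximation
with distinct eigenvalues. -/
theorem map_g_diag (hd : 2 ≤ d)
    (hdiff : DifferentiableOn ℝ S (singularPointData d))
    (hS : PreservesConstraints S) {γ : ℝ} (hγ0 : γ ≠ 0)
    (hγ : ∀ z ∈ positiveRegion d, outDensity S z = γ • (z.1 : Matrix (Fin d) (Fin d) ℝ))
    {l : Fin d → ℝ} (hl : ∑ i, l i = 0)
    (hk : 0 < density (diag l hl)) (p : Fin d → ℝ) :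
    ∃ c : ℝ, (S (orthoData (diag l hl, p))).g = c • 1 := by
  have hd' : (d : ℝ) ≠ 0 := by
    have : d ≠ 0 := by omega
    exact_mod_cast this
  -- `n` is traceless with distinct entries, so `l + t n` has distinct entries for small `t ≠ 0`.
  set n : Fin d → ℝ := fun a => (a : ℕ) - (∑ b : Fin d, ((b : ℕ) : ℝ)) / d with hn
  have hn0 : ∑ a, n a = 0 := by
    simp only [hn, Finset.sum_sub_distrib, Finset.sum_const, Finset.card_univ, Fintype.card_fin,
      nsmul_eq_mul]
    field_simp
    ring
  have hninj : Function.Injective n := by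
    intro a b hab
    have h1 : ((a : ℕ) : ℝ) = (b : ℕ) := by simpa [hn] using hab
    exact Fin.ext (by exact_mod_cast h1)
  have hk0 : 0 < density (diag l hl + (0 : ℝ) • diag n hn0) := by rwa [zero_smul, add_zero]
  have hcont : ∀ a b, ContinuousAt
      (fun t : ℝ => (S (orthoData (diag l hl + t • diag n hn0, p))).g a b) 0 :=
    fun a b => (hasDerivAt_map_g_line (by omega) hdiff hk0 a b).continuousAt
  have hinj' : ∀ᶠ t : ℝ in nhdsWithin 0 {0}ᶜ, Function.Injective (l + t • n) := by
    have h1 : ∀ᶠ t : ℝ in nhdsWithin 0 {0}ᶜ, ∀ a b, a ≠ b → l a + t * n a ≠ l b + t * n b := by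
      rw [Filter.eventually_all]; intro a
      rw [Filter.eventually_all]; intro b
      by_cases hab : l a = l b
      · filter_upwards [self_mem_nhdsWithin] with t ht hne h
        rw [hab] at h
        exact hne (hninj (mul_left_cancel₀ ht (add_left_cancel h)))
      have hc : Continuous fun t : ℝ => l a + t * n a - (l b + t * n b) := by fun_prop
      have h0 : (fun t : ℝ => l a + t * n a - (l b + t * n b)) 0 ≠ 0 := by
        simpa [sub_eq_zero] using hab
      filter_upwards [(hc.continuousAt.eventually_ne h0).filter_mono nhdsWithin_le_nhds]
        with t ht _ h
      exact ht (sub_eq_zero.2 h)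
    filter_upwards [h1] with t ht a b hab
    by_contra hne
    exact ht a b hne hab
  have hpos' := (eventually_density_pos hk (diag n hn0)).filter_mono
    (nhdsWithin_le_nhds (s := {0}ᶜ))
  have hoff : ∀ i j, i ≠ j → (S (orthoData (diag l hl, p))).g i j = 0 := by
    intro i j hij
    have h1 := eq_zero_of_eventually_punctured (hcont i j) (by
      filter_upwards [hinj', hpos'] with t ht ht'
      obtain ⟨h, he⟩ := diag_add_smul hl hn0 t
      rw [he] at ht' ⊢
      exact map_g_off_diag hd hS hγ0 hγ h ht ht' p hij)
    simpa only [zero_smul, add_zero] using h1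
  have hdiag : ∀ i j, (S (orthoData (diag l hl, p))).g i i =
      (S (orthoData (diag l hl, p))).g j j := by
    intro i j
    have h1 := eq_zero_of_eventually_punctured ((hcont i i).sub (hcont j j)) (by
      filter_upwards [hinj', hpos'] with t ht ht'
      obtain ⟨h, he⟩ := diag_add_smul hl hn0 t
      simp only [Pi.sub_apply]
      rw [he] at ht' ⊢
      rw [map_g_diag_eq_of_injective hd hdiff hS hγ0 hγ h ht ht' p i j, sub_self])
    simp only [Pi.sub_apply, zero_smul, add_zero] at h1
    linarith
  refine ⟨(S (orthoData (diag l hl, p))).g ⟨0, by omega⟩ ⟨0, by omega⟩, ?_⟩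
  ext i j
  by_cases hij : i = j
  · subst hij
    rw [Matrix.smul_apply, Matrix.one_apply_eq, smul_eq_mul, mul_one]
    exact hdiag _ _
  · rw [hoff i j hij, Matrix.smul_apply, Matrix.one_apply_ne hij, smul_zero]

theorem map_g_eq_smul_one (hd : 2 ≤ d)
    (hdiff : DifferentiableOn ℝ S (singularPointData d)) (hcov : IsCovariant S)
    (hS : PreservesConstraints S) {γ : ℝ} (hγ0 : γ ≠ 0)
    (hγ : ∀ z ∈ positiveRegion d, outDensity S z = γ • (z.1 : Matrix (Fin d) (Fin d) ℝ))
    {z : tracelessSymm d × (Fin d → ℝ)} (hz : z ∈ positiveRegion d) :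
    ∃ c : ℝ, (S (orthoData z)).g = c • 1 := by
  obtain ⟨O, hO, l, hl, h⟩ := exists_conj_diagonal z.1
  have hpos : 0 < density (diag l hl) := by rw [← h, density_conj]; exact hz
  obtain ⟨c, hc⟩ := map_g_diag hd hdiff hS hγ0 hγ hl hpos (O *ᵥ z.2)
  rw [← h, map_g_conj (by omega) hcov O hO hz] at hc
  refine ⟨c, ?_⟩
  have h1 : (S (orthoData z)).g = Oᵀ * (O * (S (orthoData z)).g * Oᵀ) * O := by
    simp only [Matrix.mul_assoc]
    rw [mul_eq_one_comm.1 hO, ← Matrix.mul_assoc Oᵀ, mul_eq_one_comm.1 hO, Matrix.one_mul,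
      Matrix.mul_one]
  rw [h1, hc, Matrix.mul_smul, Matrix.smul_mul, Matrix.mul_one, mul_eq_one_comm.1 hO]

end ConformalMetric

/-! ### The scattering law -/

section Necessity

variable {d : ℕ} {S : PointData d → PointData d}

/-- The ratio of the outgoing to the incoming volume density. -/
noncomputable def volumeRatio (S : PointData d → PointData d) (D : PointData d) : ℝ :=
  √((S D).g.det / D.g.det)

theorem volumeRatio_transform (hcov : IsCovariant S) {D : PointData d}
    (hD : D ∈ singularPointData d) (A : GL (Fin d) ℝ) :
    volumeRatio S (D.transform A) = volumeRatio S D := by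
  rw [volumeRatio, volumeRatio, hcov A D hD, transform_det_div]

/-- Data with positive density are given by `k` and `2 μ v` in an orthonormal frame. -/
theorem exists_transform_eq_orthoData (hd : 0 < d) {D : PointData d}
    (hD : D ∈ singularPointData d) (hμ : 0 < D.μ) :
    ∃ (A : GL (Fin d) ℝ) (z : tracelessSymm d × (Fin d → ℝ)), z ∈ positiveRegion d ∧
      D = (orthoData z).transform A := by
  obtain ⟨A, hA⟩ := exists_transform_g_eq_one hD.1.posDef
  have hm := transform_mem hD A
  set D₁ := D.transform A with hD₁
  have htr := trace_Kring hd hm.1.trace_eq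
  have hsymm : D₁.Kring.IsSymm := by
    have h1 := hm.1.symm
    rw [hA, Matrix.one_mul] at h1
    exact h1.sub (Matrix.isSymm_one.smul _)
  set k : tracelessSymm d := ⟨D₁.Kring, hsymm, htr⟩
  have hk : density k = D₁.μ := by
    rw [μ_eq hm, trace_K_mul_K hd htr]
    change (1 - 1 / d - (D₁.Kring * D₁.Kring).trace) / 2 = _
    ring
  have hμ₁ : 0 < D₁.μ := hμ
  refine ⟨A⁻¹, (k, (2 * D₁.μ) • D₁.v), ?_, ?_⟩
  · change 0 < density k
    rw [hk]; exact hμ₁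
  · have h2 : orthoData (k, (2 * D₁.μ) • D₁.v) = D₁ := by
      refine ext_of hA.symm ?_ hk ?_
      · rw [orthoData_K, K_eq D₁]
      · rw [orthoData_v, hk, smul_smul, inv_mul_cancel₀ (by positivity), one_smul]
    rw [h2, hD₁, transform_inv_transform]

theorem map_mem (hd : 2 ≤ d) (hcov : IsCovariant S) (hS : PreservesConstraints S)
    {D : PointData d} (hD : D ∈ singularPointData d) : S D ∈ singularPointData d := by
  rcases hD.1.nonneg.lt_or_eq with hμ | hμ
  · obtain ⟨A, z, hz, rfl⟩ := exists_transform_eq_orthoData (by omega) hD hμ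
    rw [hcov A _ (orthoData_mem (by omega) hz)]
    exact transform_mem (map_orthoData_mem hd hS hz) A
  · -- For `μ = 0` the constant field satisfies the momentum constraint, whatever `v` is.
    have h1 : SatisfiesConstraints Set.univ (fun _ : Fin d → ℝ => D) := by
      refine ⟨fun _ _ => hD.1, fun _ _ => hD.2, fun x _ b => ?_⟩
      rw [← hμ]
      simp [divergence, christoffel, pderiv]
    exact mem_singularPointData_of_satisfies (hS _ isOpen_univ _ contDiffOn_const h1)
      (Set.mem_univ (0 : Fin d → ℝ))

/-- The scattering law at positive density, in a form that is independent of the frame. -/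
theorem exists_relation_of_pos (hd : 2 ≤ d)
    (hdiff : DifferentiableOn ℝ S (singularPointData d)) (hcov : IsCovariant S)
    (hS : PreservesConstraints S) :
    ∃ γ : ℝ, ∀ D ∈ singularPointData d, 0 < D.μ →
      volumeRatio S D • (S D).Kring = γ • D.Kring ∧
      (volumeRatio S D * (S D).μ) • (S D).v = (γ * D.μ) • D.v ∧
      (γ ≠ 0 → ∃ c : ℝ, (S D).g = c • D.g) := by
  obtain ⟨γ, hγ⟩ := exists_outDensity_eq_smul hd hdiff hcov hS
  refine ⟨γ, fun D hD hμ => ?_⟩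
  obtain ⟨A, z, hz, rfl⟩ := exists_transform_eq_orthoData (by omega) hD hμ
  have hm := orthoData_mem (by omega) hz
  have hr : volumeRatio S (orthoData z) = √(S (orthoData z)).g.det := by
    rw [volumeRatio, orthoData_g, Matrix.det_one, div_one]
  rw [volumeRatio_transform hcov hm, hcov A _ hm, hr]
  refine ⟨?_, ?_, fun hγ0 => ?_⟩
  · have h1 := hγ z hz
    rw [outDensity] at h1
    rw [transform_Kring, transform_Kring, orthoData_Kring, ← Matrix.smul_mul, ← Matrix.mul_smul,
      h1, Matrix.mul_smul, Matrix.smul_mul]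
  · rw [transform_v, transform_v, transform_μ, transform_μ, ← Matrix.mulVec_smul,
      ← Matrix.mulVec_smul]
    congr 1
    funext b
    have h1 := (momentum_and_metricWork hd hdiff hS hγ hz).1 b
    have hz' : density z.1 ≠ 0 := (show 0 < density z.1 from hz).ne'
    rw [Pi.smul_apply, Pi.smul_apply, smul_eq_mul, smul_eq_mul, orthoData_μ, orthoData_v,
      Pi.smul_apply, smul_eq_mul]
    field_simp
    linarith
  · obtain ⟨c, hc⟩ := map_g_eq_smul_one hd hdiff hcov hS hγ0 hγ hz
    refine ⟨c, ?_⟩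
    rw [transform_g, transform_g, hc, orthoData_g, Matrix.mul_smul, Matrix.smul_mul]

/-- Shrinking the traceless curvature of `D` by `1 - t` makes the density positive. -/
noncomputable def shrink (D : PointData d) (t : ℝ) : PointData d :=
  (D.g, (1 / (d : ℝ)) • 1 + (1 - t) • D.Kring,
    (1 - 1 / d - (1 - t) ^ 2 * (D.Kring * D.Kring).trace) / 2, D.v)

theorem shrink_zero (hd : 0 < d) {D : PointData d} (hD : D ∈ singularPointData d) :
    shrink D 0 = D := by
  refine ext_of rfl ?_ ?_ rfl
  · change (1 / (d : ℝ)) • 1 + (1 - (0 : ℝ)) • D.Kring = _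
    rw [sub_zero, one_smul, ← K_eq]
  · change (1 - 1 / d - (1 - (0 : ℝ)) ^ 2 * (D.Kring * D.Kring).trace) / 2 = _
    rw [μ_eq hD, trace_K_mul_K hd (trace_Kring hd hD.1.trace_eq)]
    ring

theorem shrink_mem (hd : 2 ≤ d) {D : PointData d} (hD : D ∈ singularPointData d) {t : ℝ}
    (ht : 0 < t) (ht1 : t ≤ 1) : shrink D t ∈ singularPointData d ∧ 0 < (shrink D t).μ := by
  have hd2 : (2 : ℝ) ≤ d := by exact_mod_cast hd
  have hd' : (d : ℝ) ≠ 0 := by positivity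
  have hk : (shrink D t).Kring = (1 - t) • D.Kring := by
    rw [PointData.Kring]
    change (1 / (d : ℝ)) • 1 + (1 - t) • D.Kring - _ = _
    abel
  have htr := trace_Kring (by omega) hD.1.trace_eq
  have hμ : 0 < (shrink D t).μ := by
    change 0 < (1 - 1 / d - (1 - t) ^ 2 * (D.Kring * D.Kring).trace) / 2
    have h1 := hD.1.nonneg
    rw [μ_eq hD, trace_K_mul_K (by omega) htr] at h1
    have h2 : 1 / (d : ℝ) ≤ 1 / 2 := one_div_le_one_div_of_le two_pos hd2
    have h3 : 0 ≤ (1 - t) ^ 2 := sq_nonneg _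
    have h4 : (1 - t) ^ 2 < 1 := by nlinarith
    have h5 : (1 - t) ^ 2 * (D.Kring * D.Kring).trace ≤ (1 - t) ^ 2 * (1 - 1 / d) :=
      mul_le_mul_of_nonneg_left (by linarith) h3
    have h6 : (1 - t) ^ 2 * (1 - 1 / (d : ℝ)) < 1 * (1 - 1 / d) :=
      mul_lt_mul_of_pos_right h4 (by linarith)
    linarith
  refine ⟨⟨⟨hD.1.posDef, ?_, ?_, hμ.le⟩, ?_⟩, hμ⟩
  · rw [K_eq, hk, Matrix.trace_add, Matrix.trace_smul, Matrix.trace_smul, htr, Matrix.trace_one]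
    simp [hd']
  · have h1 := isSymm_of_posDef hD.1.posDef
    have h2 : (D.g * D.Kring).IsSymm := by
      rw [PointData.Kring, Matrix.mul_sub, Matrix.mul_smul, Matrix.mul_one]
      exact hD.1.symm.sub (h1.smul _)
    change (D.g * ((1 / (d : ℝ)) • 1 + (1 - t) • D.Kring)).IsSymm
    rw [Matrix.mul_add, Matrix.mul_smul, Matrix.mul_smul, Matrix.mul_one]
    exact (h1.smul _).add (h2.smul _)
  · have h1 : (shrink D t).Kring.trace = 0 := by rw [hk, Matrix.trace_smul, htr, smul_zero]
    rw [PointData.Hamiltonian, trace_K_mul_K (by omega) h1, hk, Matrix.smul_mul, Matrix.mul_smul,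
      Matrix.trace_smul, Matrix.trace_smul]
    change _ = 2 * ((1 - 1 / d - (1 - t) ^ 2 * (D.Kring * D.Kring).trace) / 2)
    simp only [smul_eq_mul]
    ring

theorem continuous_shrink (D : PointData d) : Continuous (shrink D) := by
  have h1 : Continuous fun t : ℝ => (1 / (d : ℝ)) • (1 : Matrix (Fin d) (Fin d) ℝ) +
      (1 - t) • D.Kring :=
    continuous_const.add ((continuous_const.sub continuous_id).smul continuous_const)
  exact continuous_const.prodMk (h1.prodMk ((by fun_prop : Continuous fun t : ℝ =>
    (1 - 1 / d - (1 - t) ^ 2 * (D.Kring * D.Kring).trace) / 2).prodMk continuous_const))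

theorem continuous_g_apply (i j : Fin d) : Continuous fun D : PointData d => D.g i j :=
  (gEntry i j).continuous

theorem continuous_Kring_apply (i j : Fin d) : Continuous fun D : PointData d => D.Kring i j :=
  (KEntry i j).continuous.sub continuous_const

theorem continuous_μ : Continuous fun D : PointData d => D.μ :=
  continuous_fst.comp (continuous_snd.comp continuous_snd)

theorem continuous_v_apply (b : Fin d) : Continuous fun D : PointData d => D.v b :=
  (continuous_apply b).comp (continuous_snd.comp (continuous_snd.comp continuous_snd))

theorem continuous_det_g : Continuous fun D : PointData d => D.g.det :=
  (differentiable_det d).continuous.comp continuous_fst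

/-- Pointwise form of the scattering law, extended by continuity to vanishing density. -/
theorem exists_relation (hd : 2 ≤ d)
    (hdiff : DifferentiableOn ℝ S (singularPointData d)) (hcov : IsCovariant S)
    (hS : PreservesConstraints S) :
    ∃ γ : ℝ, ∀ D ∈ singularPointData d,
      volumeRatio S D • (S D).Kring = γ • D.Kring ∧
      (volumeRatio S D * (S D).μ) • (S D).v = (γ * D.μ) • D.v ∧
      (γ ≠ 0 → ∃ c : ℝ, (S D).g = c • D.g) := by
  obtain ⟨γ, hγ⟩ := exists_relation_of_pos hd hdiff hcov hS
  refine ⟨γ, fun D hD => ?_⟩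
  have hmem : ∀ᶠ t in nhdsWithin (0 : ℝ) (Set.Ioi 0),
      shrink D t ∈ singularPointData d ∧ 0 < (shrink D t).μ := by
    filter_upwards [Ioc_mem_nhdsGT (zero_lt_one (α := ℝ))] with t ht
    exact shrink_mem hd hD ht.1 ht.2
  have hlim : Filter.Tendsto (shrink D) (nhdsWithin 0 (Set.Ioi 0)) (nhds D) := by
    have := (continuous_shrink D).tendsto 0
    rw [shrink_zero (by omega) hD] at this
    exact this.mono_left nhdsWithin_le_nhds
  have hlimS : Filter.Tendsto (fun t => S (shrink D t)) (nhdsWithin 0 (Set.Ioi 0))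
      (nhds (S D)) :=
    (hdiff.continuousOn D hD).tendsto.comp
      (tendsto_nhdsWithin_iff.2 ⟨hlim, hmem.mono fun t ht => ht.1⟩)
  have hr : Filter.Tendsto (fun t => volumeRatio S (shrink D t)) (nhdsWithin 0 (Set.Ioi 0))
      (nhds (volumeRatio S D)) :=
    (Real.continuous_sqrt.tendsto _).comp (((continuous_det_g.tendsto _).comp hlimS).div
      ((continuous_det_g.tendsto _).comp hlim) hD.1.posDef.det_pos.ne')
  have hrel := hmem.mono fun t ht => hγ _ ht.1 ht.2
  refine ⟨?_, ?_, fun hγ0 => ?_⟩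
  · ext i j
    refine tendsto_nhds_unique_of_eventuallyEq
      (hr.mul (((continuous_Kring_apply i j).tendsto _).comp hlimS))
      (tendsto_const_nhds.mul (((continuous_Kring_apply i j).tendsto _).comp hlim)) ?_
    filter_upwards [hrel] with t ht
    exact congrFun (congrFun ht.1 i) j
  · funext b
    refine tendsto_nhds_unique_of_eventuallyEq
      ((hr.mul ((continuous_μ.tendsto _).comp hlimS)).mul
        (((continuous_v_apply b).tendsto _).comp hlimS))
      ((tendsto_const_nhds.mul ((continuous_μ.tendsto _).comp hlim)).mul
        (((continuous_v_apply b).tendsto _).comp hlim)) ?_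
    filter_upwards [hrel] with t ht
    exact congrFun ht.2.1 b
  · set p : Fin d := ⟨0, by omega⟩
    have h1 : ∀ i j, (S D).g i j * D.g p p = (S D).g p p * D.g i j := by
      intro i j
      refine tendsto_nhds_unique_of_eventuallyEq
        ((((continuous_g_apply i j).tendsto _).comp hlimS).mul
          (((continuous_g_apply p p).tendsto _).comp hlim))
        ((((continuous_g_apply p p).tendsto _).comp hlimS).mul
          (((continuous_g_apply i j).tendsto _).comp hlim)) ?_
      filter_upwards [hrel] with t ht
      obtain ⟨c, hc⟩ := ht.2.2 hγ0
      simp only [Function.comp_apply, hc, Matrix.smul_apply, smul_eq_mul]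
      ring
    have hp : 0 < D.g p p := hD.1.posDef.diag_pos
    refine ⟨(S D).g p p / D.g p p, ?_⟩
    ext i j
    rw [Matrix.smul_apply, smul_eq_mul, div_mul_eq_mul_div, eq_div_iff hp.ne', h1]

/-- The reduced Hamiltonian constraint in terms of the traceless curvature. -/
theorem density_relation (hd : 0 < d) {D : PointData d} (hD : D ∈ singularPointData d) :
    ((d : ℝ) - 1) / (2 * d) - D.μ = (D.Kring * D.Kring).trace / 2 := by
  have hd' : (d : ℝ) ≠ 0 := by exact_mod_cast hd.ne'
  rw [μ_eq hD, trace_K_mul_K hd (trace_Kring hd hD.1.trace_eq)]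
  field_simp
  ring

theorem PreservesConstraints.isIsotropic_or_isAnisotropic (hd : 2 ≤ d)
    (hdiff : DifferentiableOn ℝ S (singularPointData d)) (hcov : IsCovariant S)
    (hS : PreservesConstraints S) : IsIsotropic S ∨ IsAnisotropic S := by
  classical
  obtain ⟨γ, hγ⟩ := exists_relation hd hdiff hcov hS
  have hm := fun D (hD : D ∈ singularPointData d) => map_mem hd hcov hS hD
  have hd2 : (2 : ℝ) ≤ d := by exact_mod_cast hd
  have hd' : (d : ℝ) ≠ 0 := by positivity
  have hrpos : ∀ D ∈ singularPointData d, 0 < volumeRatio S D := fun D hD =>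
    Real.sqrt_pos.2 (div_pos (hm D hD).1.posDef.det_pos hD.1.posDef.det_pos)
  by_cases hγ0 : γ = 0
  · left
    subst hγ0
    have hK : ∀ D ∈ singularPointData d, (S D).Kring = 0 := by
      intro D hD
      have h1 := (hγ D hD).1
      rw [zero_smul] at h1
      exact (smul_eq_zero.1 h1).resolve_left (hrpos D hD).ne'
    have hμ : ∀ D ∈ singularPointData d, (S D).μ = ((d : ℝ) - 1) / (2 * d) := by
      intro D hD
      have h1 := density_relation (by omega) (hm D hD)
      rw [hK D hD, Matrix.mul_zero, Matrix.trace_zero] at h1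
      linarith
    refine ⟨hK, fun D hD => ?_, hμ, fun D hD => (hm D hD).1.posDef,
      isCovariantCombination_of_isCovariant (by omega) hcov⟩
    -- Here `d ≥ 2` enters: `μ⁺ > 0`, so that `μ⁺ v⁺ = 0` forces `v⁺ = 0`.
    have h1 := (hγ D hD).2.1
    rw [zero_mul, zero_smul] at h1
    refine (smul_eq_zero.1 h1).resolve_left (mul_pos (hrpos D hD) ?_).ne'
    rw [hμ D hD]
    exact div_pos (by linarith) (by linarith)
  · right
    -- The volume ratio is constant on orbits; off the range of the invariants any positive value
    -- serves.
    set ω : (Fin (d - 1) → ℝ) → (Fin d → ℝ) → ℝ := fun t u =>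
      if h : ∃ D ∈ singularPointData d, D.tau = t ∧ D.upsilon = u then volumeRatio S h.choose
      else 1 with hω
    have hωeq : ∀ D ∈ singularPointData d, ω D.tau D.upsilon = volumeRatio S D := by
      intro D hD
      have hex : ∃ E ∈ singularPointData d, E.tau = D.tau ∧ E.upsilon = D.upsilon :=
        ⟨D, hD, rfl, rfl⟩
      simp only [hω, dif_pos hex]
      obtain ⟨h1, h2, h3⟩ := hex.choose_spec
      obtain ⟨A, hA⟩ := exists_transform_eq (by omega) h1 hD h2 h3
      rw [← volumeRatio_transform hcov h1 A, hA]
    refine ⟨γ, ω, hγ0, fun t u => ?_, ?_⟩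
    · by_cases hex : ∃ D ∈ singularPointData d, D.tau = t ∧ D.upsilon = u
      · simp only [hω, dif_pos hex]
        exact hrpos _ hex.choose_spec.1
      · simp only [hω, dif_neg hex]
        exact one_pos
    have hK : ∀ D ∈ singularPointData d,
        (S D).Kring = (γ * (volumeRatio S D)⁻¹) • D.Kring := by
      intro D hD
      rw [mul_comm, ← smul_smul, ← (hγ D hD).1, smul_smul, inv_mul_cancel₀ (hrpos D hD).ne',
        one_smul]
    refine ⟨fun D hD => ?_, fun D hD => ?_, fun D hD => ?_, fun D hD => ?_,
      fun D hD => (hm D hD).1.nonneg⟩ <;> try rw [hωeq D hD]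
    · exact hK D hD
    · obtain ⟨c, hc⟩ := (hγ D hD).2.2 hγ0
      have hcpos : 0 < c := by
        have h1 : 0 < (S D).g ⟨0, by omega⟩ ⟨0, by omega⟩ := (hm D hD).1.posDef.diag_pos
        have h2 : 0 < D.g ⟨0, by omega⟩ ⟨0, by omega⟩ := hD.1.posDef.diag_pos
        rw [hc, Matrix.smul_apply, smul_eq_mul] at h1
        exact (mul_pos_iff_of_pos_right h2).1 h1
      have hr : volumeRatio S D = c ^ ((d : ℝ) / 2) := by
        rw [volumeRatio, hc, Matrix.det_smul, Fintype.card_fin,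
          mul_div_cancel_right₀ _ hD.1.posDef.det_pos.ne', Real.sqrt_eq_rpow, ← Real.rpow_natCast,
          ← Real.rpow_mul hcpos.le]
        congr 1
        ring
      have he : (d : ℝ) / 2 * (2 / d) = 1 := by field_simp
      rw [hr, ← Real.rpow_mul hcpos.le, he, Real.rpow_one, hc]
    · rw [mul_comm γ, mul_assoc, ← smul_smul, ← (hγ D hD).2.1, smul_smul, ← mul_assoc,
        inv_mul_cancel₀ (hrpos D hD).ne', one_mul]
    · rw [density_relation (by omega) (hm D hD), density_relation (by omega) hD, hK D hD,
        Matrix.smul_mul, Matrix.mul_smul, Matrix.trace_smul, Matrix.trace_smul, smul_eq_mul,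
        smul_eq_mul, ← inv_pow]
      ring

end Necessity

theorem theorem1 (d : ℕ) (hd : 2 ≤ d) (S : PointData d → PointData d)
    (hdiff : DifferentiableOn ℝ S (singularPointData d)) (hcov : IsCovariant S) :
    PreservesConstraints S ↔ IsIsotropic S ∨ IsAnisotropic S := by
  refine ⟨fun hS => hS.isIsotropic_or_isAnisotropic hd hdiff hcov, ?_⟩
  rintro (h | h)
  · exact h.preservesConstraints (by omega)
  · exact h.preservesConstraints (by omega) hdiff
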